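/- **Function spaces.** For measurable $f:\mathbb R\to\mathbb C$ let $\|f\|_{L^{2,1}}=\big(\int_{\mathbb R}(1+x^2)|f(x)|^2dx\big)^{1/2}$, and let $L^{2,1}(\mathbb R)$ be the space of $f$ with $\|f\|_{L^{2,1}}<\infty$. Let $H^{1,1}(\mathbb R)=\{u\in L^{2,1}(\mathbb R):\ \partial_xu\in L^{2,1}(\mathbb R)\}$ (weak derivative). Norms: $\|f\|_{H^1}=\|f\|_{L^2}+\|f'\|_{L^2}$, $\|f\|_{H^2}=\|f\|_{L^2}+\|f'\|_{L^2}+\|f''\|_{L^2}$, $\|u\|_{H^{1,1}}=\|u\|_{L^{2,1}}+\|\partial_xu\|_{L^{2,1}}$, $\|u\|_{H^2\cap H^{1,1}}=\|u\|_{H^2}+\|u\|_{H^{1,1}}$. **Scattering coefficients.** For $u\in H^{1,1}(\mathbb R)$ put $Q(u)=\begin{pmatrix}0&u\\-\bar u&0\end{pmatrix}$, and consider the Kaup–Newell spectral problem $\partial_x\psi=[-i\lambda^2\sigma_3+\lambda Q(u)]\psi$, $\sigma_3=\mathrm{diag}(1,-1)$, for $\lambda\in\mathbb R\cup i\mathbb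 R$, that is, $z:=\lambda^2\in\mathbb R$. Its normalized Jost functions $\varphi_\pm(\cdot;\lambda)$, $\phi_+(\cdot;\lambda)\in L^\infty(\mathbb R;\mathbb C^2)$ are the unique bounded solutions of $$\varphi_\pm(x;\lambda)=\begin{pmatrix}1\\0\end{pmatrix}+\lambda\int_{\pm\infty}^x\begin{pmatrix}1&0\\0&e^{2i\lambda^2(x-y)}\end{pmatrix}Q(u(y))\varphi_\pm(y;\lambda)\,dy,$$ $$\phi_+(x;\lambda)=\begin{pmatrix}0\\1\end{pmatrix}+\lambda\int_{+\infty}^x\begin{pmatrix}e^{-2i\lambda^2(x-y)}&0\\0&1\end{pmatrix}Q(u(y))\phi_+(y;\lambda)\,dy,$$ and $a(\lambda),b(\lambda)$ are the unique complex numbers with $$\varphi_-(x;\lambda)=a(\lambda)\varphi_+(x;\lambda)+b(\lambda)e^{2i\lambda^2x}\phi_+(x;\lambda)\qquad\text{for all }x\in\mathbb R.$$ Let $a_\infty=\exp\big(\tfrac1{2i}\int_{\mathbb R}|u|^2dx\big)$. **Statement.** 1. Let $u\in H^{1,1}(\mathbb R)$. As a function of $z=\lambda^2\in\mathbb R$,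 $a(\lambda)$ extends to a continuous function on $\{\operatorname{Im}z\ge0\}$ that is analytic in $\mathbb C^+=\{\operatorname{Im}z>0\}$, and $\overline{a(\bar\lambda)}$ extends to a continuous function on $\{\operatorname{Im}z\le0\}$ that is analytic in $\mathbb C^-=\{\operatorname{Im}z<0\}$. Moreover, on $\mathbb R\cup i\mathbb R$ the quantities $a(\lambda)-a_\infty$, $\lambda b(\lambda)$ and (for $\lambda\neq0$) $\lambda^{-1}b(\lambda)$ depend only on $z=\lambda^2$, and as functions of $z\in\mathbb R$ they belong to $H^1(\mathbb R)$. 2. If $u\in H^2(\mathbb R)\cap H^{1,1}(\mathbb R)$, then $\lambda b(\lambda)$ and $\lambda^{-1}b(\lambda)$, as functions of $z$, also belong to $L^{2,1}(\mathbb R)$. 3. For every $U>0$ there is a constant $C(U)>0$ such that for all $u,\tilde u\in H^{1,1}(\mathbb R)$ with $\|u\|_{H^{1,1}},\|\tilde u\|_{H^{1,1}}\le U$ and corresponding coefficients $(a,b)$, $(\tilde a,\tilde b)$, $$\|a-a_\infty-\tilde a+\tilde a_\infty\|_{H^1_z}+\|\lambda b-\lambda\tilde b\|_{H^1_z}+\|\lambda^{-1}b-\lambda^{-1}\tilde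 b\|_{H^1_z}\le C(U)\|u-\tilde u\|_{H^{1,1}}.$$ 4. For every $U>0$ there is a constant $C(U)>0$ such that for all $u,\tilde u\in H^2(\mathbb R)\cap H^{1,1}(\mathbb R)$ with $\|u\|_{H^2\cap H^{1,1}},\|\tilde u\|_{H^2\cap H^{1,1}}\le U$, $$\|\lambda b-\lambda\tilde b\|_{L^{2,1}_z}+\|\lambda^{-1}b-\lambda^{-1}\tilde b\|_{L^{2,1}_z}\le C(U)\|u-\tilde u\|_{H^2\cap H^{1,1}}.$$ -/

import Mathlib

open MeasureTheory
open scoped ENNReal NNReal ContDiff Matrix ComplexConjugate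

noncomputable section

namespace KaupNewell

/-! Function spaces on the real line. -/

/-- `g` is the weak derivative of `f` on `ℝ`. -/
def HasWeakDeriv (f g : ℝ → ℂ) : Prop :=
  LocallyIntegrable f volume ∧ LocallyIntegrable g volume ∧
    ∀ η : ℝ → ℝ, ContDiff ℝ ∞ η → HasCompactSupport η →
      ∫ x, deriv η x • f x = -∫ x, η x • g x

/-- The function `⟨x⟩ f(x)`, where `⟨x⟩ = (1 + x²)^{1/2}`. -/
def weighted (f : ℝ → ℂ) : ℝ → ℂ := fun x => (Real.sqrt (1 + x ^ 2) : ℂ) * f x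

/-- The weighted space `L^{2,1}(ℝ)`. -/
def MemL21 (f : ℝ → ℂ) : Prop := MemLp (weighted f) 2 volume

/-- The norm of `L^{2,1}(ℝ)`, with values in `[0, ∞]`. -/
def normL21 (f : ℝ → ℂ) : ℝ≥0∞ := eLpNorm (weighted f) 2 volume

/-- The Sobolev space `H^1(ℝ)`. -/
def MemH1 (f : ℝ → ℂ) : Prop :=
  MemLp f 2 volume ∧ ∃ g, HasWeakDeriv f g ∧ MemLp g 2 volume

/-- The norm `‖f‖_{L²} + ‖f'‖_{L²}` of `H^1(ℝ)`. The weak derivative is unique up to a null set,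
so the infimum is over equal values; it is `∞` if there is no weak derivative. -/
def normH1 (f : ℝ → ℂ) : ℝ≥0∞ :=
  ⨅ (g : ℝ → ℂ) (_ : HasWeakDeriv f g), eLpNorm f 2 volume + eLpNorm g 2 volume

/-- The Sobolev space `H^2(ℝ)`. -/
def MemH2 (f : ℝ → ℂ) : Prop :=
  MemLp f 2 volume ∧ ∃ g h, HasWeakDeriv f g ∧ HasWeakDeriv g h ∧
    MemLp g 2 volume ∧ MemLp h 2 volume

/-- The norm `‖f‖_{L²} + ‖f'‖_{L²} + ‖f''‖_{L²}` of `H^2(ℝ)`. -/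
def normH2 (f : ℝ → ℂ) : ℝ≥0∞ :=
  ⨅ (g : ℝ → ℂ) (h : ℝ → ℂ) (_ : HasWeakDeriv f g) (_ : HasWeakDeriv g h),
    eLpNorm f 2 volume + eLpNorm g 2 volume + eLpNorm h 2 volume

/-- The space `H^{1,1}(ℝ)` of `u ∈ L^{2,1}(ℝ)` with `∂ₓu ∈ L^{2,1}(ℝ)`. -/
def MemH11 (u : ℝ → ℂ) : Prop := MemL21 u ∧ ∃ v, HasWeakDeriv u v ∧ MemL21 v

/-- The norm `‖u‖_{L^{2,1}} + ‖∂ₓu‖_{L^{2,1}}` of `H^{1,1}(ℝ)`. -/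
def normH11 (u : ℝ → ℂ) : ℝ≥0∞ :=
  ⨅ (v : ℝ → ℂ) (_ : HasWeakDeriv u v), normL21 u + normL21 v

/-! Jost functions and scattering coefficients of
`∂ₓψ = (-iλ²σ₃ + λQ(u))ψ`. -/

/-- The potential matrix `Q(u)` at a point where the value of the potential is `w`. -/
def Q (w : ℂ) : Matrix (Fin 2) (Fin 2) ℂ := !![0, w; -conj w, 0]

/-- `∫_{-∞}^x f(y) dy`. -/
def intBot (x : ℝ) (f : ℝ → Fin 2 → ℂ) : Fin 2 → ℂ := ∫ y in Set.Iic x, f y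

/-- `∫_{+∞}^x f(y) dy`. -/
def intTop (x : ℝ) (f : ℝ → Fin 2 → ℂ) : Fin 2 → ℂ := -∫ y in Set.Ioi x, f y

/-- The Volterra equation with bounded solution
`φ(x) = e₁ + λ ∫^x diag(1, e^{2iλ²(x-y)}) Q(u(y)) φ(y) dy`;
the lower limit is `-∞` for `J = intBot` and `+∞` for `J = intTop`. -/
def IsJostFst (J : ℝ → (ℝ → Fin 2 → ℂ) → Fin 2 → ℂ) (u : ℝ → ℂ) (lam : ℂ)
    (φ : ℝ → Fin 2 → ℂ) : Prop :=
  MemLp φ ⊤ volume ∧ ∀ x : ℝ, φ x = ![1, 0] + lam • J x (fun y =>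
    (!![1, 0; 0, Complex.exp (2 * Complex.I * lam ^ 2 * ((x : ℂ) - y))] * Q (u y)) *ᵥ φ y)

/-- The Volterra equation with bounded solution
`φ(x) = e₂ + λ ∫^x diag(e^{-2iλ²(x-y)}, 1) Q(u(y)) φ(y) dy`. -/
def IsJostSnd (J : ℝ → (ℝ → Fin 2 → ℂ) → Fin 2 → ℂ) (u : ℝ → ℂ) (lam : ℂ)
    (φ : ℝ → Fin 2 → ℂ) : Prop :=
  MemLp φ ⊤ volume ∧ ∀ x : ℝ, φ x = ![0, 1] + lam • J x (fun y =>
    (!![Complex.exp (-(2 * Complex.I * lam ^ 2 * ((x : ℂ) - y))), 0; 0, 1] * Q (u y)) *ᵥ φ y)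

/-- The normalized Jost function with limit `e₁` as `x → -∞`: the bounded solution of its Volterra
equation (it exists and is unique for integrable `u` and real `λ²`). -/
def jostMinus (u : ℝ → ℂ) (lam : ℂ) : ℝ → Fin 2 → ℂ :=
  Classical.epsilon (IsJostFst intBot u lam)

/-- The normalized Jost function with limit `e₁` as `x → +∞`. -/
def jostPlusFst (u : ℝ → ℂ) (lam : ℂ) : ℝ → Fin 2 → ℂ :=
  Classical.epsilon (IsJostFst intTop u lam)

/-- The normalized Jost function with limit `e₂` as `x → +∞`. -/
def jostPlusSnd (u : ℝ → ℂ) (lam : ℂ) : ℝ → Fin 2 → ℂ :=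
  Classical.epsilon (IsJostSnd intTop u lam)

/-- The first row of the scattering relation: the pair `p = (a, b)` satisfies
`φ₋(x) = a φ₊(x) + b e^{2iλ²x} ϕ₊(x)` for all `x`, where `φ₋`, `φ₊`, `ϕ₊` are the three Jost
functions above. -/
def IsScattering (u : ℝ → ℂ) (lam : ℂ) (p : ℂ × ℂ) : Prop :=
  ∀ x : ℝ, jostMinus u lam x =
    p.1 • jostPlusFst u lam x +
      (p.2 * Complex.exp (2 * Complex.I * lam ^ 2 * (x : ℂ))) • jostPlusSnd u lam x

/-- The scattering coefficient `a(λ)`, used for `λ ∈ ℝ ∪ iℝ`. The pair `(a, b)` in the scattering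
relation exists and is unique, as `φ₊ e^{-iλ²x}`, `ϕ₊ e^{iλ²x}` is a basis of the solutions. -/
def scatA (u : ℝ → ℂ) (lam : ℂ) : ℂ := (Classical.epsilon (IsScattering u lam)).1

/-- The scattering coefficient `b(λ)`, used for `λ ∈ ℝ ∪ iℝ`. -/
def scatB (u : ℝ → ℂ) (lam : ℂ) : ℂ := (Classical.epsilon (IsScattering u lam)).2

/-- `a_∞ = exp((1/2i) ∫ |u|² dx)`. -/
def aInf (u : ℝ → ℂ) : ℂ :=
  Complex.exp (1 / (2 * Complex.I) * ((∫ x, ‖u x‖ ^ 2 : ℝ) : ℂ))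

/-- `λ ↦ a(λ) - a_∞`. -/
def aSub (u : ℝ → ℂ) (lam : ℂ) : ℂ := scatA u lam - aInf u

/-- `λ ↦ λ b(λ)`. -/
def lamB (u : ℝ → ℂ) (lam : ℂ) : ℂ := lam * scatB u lam

/-- `λ ↦ λ⁻¹ b(λ)`; the value at `λ = 0` is immaterial. -/
def lamInvB (u : ℝ → ℂ) (lam : ℂ) : ℂ := lam⁻¹ * scatB u lam

/-! Functions of `λ ∈ ℝ ∪ iℝ` as functions of `z = λ² ∈ ℝ`. Note that `λ ∈ ℝ ∪ iℝ` means
`(λ²).im = 0`. -/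

/-- On `ℝ ∪ iℝ`, the value `f(λ)` depends only on `z = λ²`. -/
def DependsOnSq (f : ℂ → ℂ) : Prop :=
  ∀ lam mu : ℂ, (lam ^ 2).im = 0 → mu ^ 2 = lam ^ 2 → f mu = f lam

/-- A `λ ∈ ℝ ∪ iℝ` with `λ² = z`. -/
def root (z : ℝ) : ℂ := if 0 ≤ z then (Real.sqrt z : ℂ) else Complex.I * (Real.sqrt (-z) : ℂ)

/-- The function of `z ∈ ℝ` given by a function of `λ` that depends only on `z = λ²`. -/
def onZ (f : ℂ → ℂ) : ℝ → ℂ := fun z => f (root z)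

end KaupNewell

end

namespace KaupNewell

open Filter Topology

/-! ### Square norms of functions with values in `[0, ∞]` -/

/-! Removing the phases and rescaling the second Jost component by λ⁻¹ turns the spectral problem
into P' = z u e^{2izx} S, S' = -ū e^{-2izx} P with (P, S) → (1, 0) at -∞. Its limit at +∞ is (a,
λ⁻¹b), so everything depends on z only (`scat_eq_jostInf`, `jostInf_scale`, `Pot.scat_eq`). The
factor z in front of u obstructs uniform estimates. Two substitutions, combined with the gauge
factors exp(±(1/2i)∫|u|²), remove it. Each leads to a Zakharov-Shabat system P' = α e^{2izx} S, S' =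
β e^{-2izx} P, where α, β lie in L^{2,1}, do not depend on z, and are Lipschitz in u on balls of
H^{1,1}. Up to unimodular gauge constants the limits at +∞ are (a, 2iλb) for the first system and
(a, λ⁻¹b) for the second (`Pot.jostInf_fst_system`, `Pot.jostInf_snd_system`).

Three facts about such systems carry the estimates.

L² in z: a Jost solution is bounded, and its x-derivative is dominated by an integrable function,
uniformly in z. By Fubini and Plancherel its oscillatory integral against an L² function is in L² of
z (`eLpNorm_oscillatory_le`). Gronwall's and Minkowski's inequalities carry this through the
Volterra equation for the difference of two solutions (`IsPotential.eLpNorm_jost_sub_le`).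

Derivative in z: the shift z → z + h multiplies the coefficients by e^{±2ihy}, a change of size 2|h|
times the weighted norm. The limits are thus Lipschitz under translation in L², hence in H¹ up to
constants (`exists_hasWeakDeriv_of_eLpNorm_translate_le`). Lipschitz dependence of the derivative on
u amounts to a second difference of four solutions
(`IsPotential.eLpNorm_jost_second_difference_le`).

Decay in z: translating the coefficients by t multiplies the second limit by e^{2izt}. Dividing by t
and letting t → 0 trades an L² derivative of the coefficients for a factor z
(`eLpNorm_mul_jostInf_snd_sub_le`). For the first system this controls zλb. There β contains u',
which is why u ∈ H² is needed. The weight on λ⁻¹b needs nothing new, since zλ⁻¹b = λb.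

Membership in H¹ and L^{2,1} is the Lipschitz estimate against the zero potential. For analyticity,
the propagator e^{2iw(x-y)} with y ≤ x is bounded by 1 when Im w ≥ 0. The Picard iterates are
holomorphic in w and converge uniformly for bounded w (`holoOn_scatExt`). -/

theorem eLpNorm_two_sq {α ε : Type*} [MeasurableSpace α] [ENorm ε] (f : α → ε) (μ : Measure α) :
    eLpNorm f 2 μ ^ 2 = ∫⁻ x, ‖f x‖ₑ ^ 2 ∂μ := by
  have := eLpNorm_nnreal_pow_eq_lintegral (f := f) (μ := μ) (p := 2) two_ne_zero
  simpa using this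

theorem eLpNorm_two_le_iff {α ε : Type*} [MeasurableSpace α] [ENorm ε] {f : α → ε} {μ : Measure α}
    {r : ℝ≥0∞} : eLpNorm f 2 μ ≤ r ↔ ∫⁻ x, ‖f x‖ₑ ^ 2 ∂μ ≤ r ^ 2 := by
  rw [← eLpNorm_two_sq]
  exact (ENNReal.pow_right_strictMono two_ne_zero).le_iff_le.symm

theorem lintegral_mul_sq_le {α : Type*} [MeasurableSpace α] {μ : Measure α} {f g : α → ℝ≥0∞}
    (hf : AEMeasurable f μ) (hg : AEMeasurable g μ) :
    (∫⁻ x, f x * g x ∂μ) ^ 2 ≤ (∫⁻ x, f x ^ 2 ∂μ) * ∫⁻ x, g x ^ 2 ∂μ := by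
  have h := ENNReal.lintegral_mul_le_Lp_mul_Lq μ (p := 2) (q := 2) (by
    constructor <;> norm_num) hf hg
  have h2 : ∀ a : ℝ≥0∞, (a ^ (1 / 2 : ℝ)) ^ 2 = a := fun a => by
    rw [← ENNReal.rpow_natCast, ← ENNReal.rpow_mul]; norm_num
  refine (pow_le_pow_left' h 2).trans_eq ?_
  rw [mul_pow, h2, h2]
  simp

/-- Cauchy-Schwarz for the measure with density g, by writing g as a product of two square roots. -/
theorem sq_lintegral_mul_le {α : Type*} [MeasurableSpace α] {μ : Measure α} {g φ : α → ℝ≥0∞}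
    (hg : AEMeasurable g μ) (hφ : AEMeasurable φ μ) :
    (∫⁻ x, g x * φ x ∂μ) ^ 2 ≤ (∫⁻ x, g x ∂μ) * ∫⁻ x, g x * φ x ^ 2 ∂μ := by
  have h2 : ∀ a : ℝ≥0∞, (a ^ (1 / 2 : ℝ)) ^ 2 = a := fun a => by
    rw [← ENNReal.rpow_natCast, ← ENNReal.rpow_mul]; norm_num
  have := lintegral_mul_sq_le (μ := μ) (f := fun x => g x ^ (1 / 2 : ℝ))
    (g := fun x => g x ^ (1 / 2 : ℝ) * φ x) (hg.pow_const _) ((hg.pow_const _).mul hφ)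
  simpa only [mul_pow, h2, ← mul_assoc, ← pow_two] using this

/-- Minkowski's integral inequality in `L²`, for a weight with uniformly bounded sections. -/
theorem eLpNorm_lintegral_mul_le {α β : Type*} [MeasurableSpace α] [MeasurableSpace β]
    {μ : Measure α} {ν : Measure β} [SFinite μ] [SFinite ν] {g : β → ℝ≥0∞} {φ : α → β → ℝ≥0∞}
    (hg : Measurable g) (hφ : Measurable (Function.uncurry φ)) {ρ : ℝ≥0∞}
    (h : ∀ y, eLpNorm (fun x => φ x y) 2 μ ≤ ρ) :
    eLpNorm (fun x => ∫⁻ y, g y * φ x y ∂ν) 2 μ ≤ ρ * ∫⁻ y, g y ∂ν := by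
  rw [eLpNorm_two_le_iff]
  have hm : ∀ x, Measurable (φ x) := fun x => hφ.comp measurable_prodMk_left
  -- Cauchy-Schwarz with weight g moves the square onto φ. Tonelli then brings the x-integral
  -- inside, where the uniform bound of the sections applies.
  calc ∫⁻ x, ‖∫⁻ y, g y * φ x y ∂ν‖ₑ ^ 2 ∂μ
      ≤ ∫⁻ x, (∫⁻ y, g y ∂ν) * ∫⁻ y, g y * φ x y ^ 2 ∂ν ∂μ := by
        refine lintegral_mono fun x => ?_
        simpa using sq_lintegral_mul_le hg.aemeasurable (hm x).aemeasurable
    _ = (∫⁻ y, g y ∂ν) * ∫⁻ x, ∫⁻ y, g y * φ x y ^ 2 ∂ν ∂μ := by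
        rw [lintegral_const_mul]
        exact Measurable.lintegral_prod_right' (f := fun p : α × β => g p.2 * φ p.1 p.2 ^ 2)
          ((hg.comp measurable_snd).mul (hφ.pow_const 2))
    _ = (∫⁻ y, g y ∂ν) * ∫⁻ y, g y * ∫⁻ x, φ x y ^ 2 ∂μ ∂ν := by
        rw [lintegral_lintegral_swap]
        · congr 2; ext y; rw [lintegral_const_mul]
          exact (hφ.comp measurable_prodMk_right).pow_const 2
        · exact ((hg.comp measurable_snd).mul (hφ.pow_const 2)).aemeasurable
    _ ≤ (∫⁻ y, g y ∂ν) * ∫⁻ y, g y * ρ ^ 2 ∂ν := by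
        gcongr with y
        have := eLpNorm_two_le_iff.1 (h y)
        simpa using this
    _ = (ρ * ∫⁻ y, g y ∂ν) ^ 2 := by
        rw [lintegral_mul_const _ hg]; ring

/-! ### Plancherel's theorem for integrable functions -/

-- On the Hilbert space L² the transform is isometric. What remains is that the integral transform
-- of an f in L¹ ∩ L² represents it. Both have the same pairing with test functions, because in
-- either case the transform can be moved onto the test function.
open FourierTransform SchwartzMap in
theorem eLpNorm_fourier_eq {f : ℝ → ℂ} (h1 : Integrable f) (h2 : MemLp f 2) :
    eLpNorm (𝓕 f) 2 volume = eLpNorm f 2 volume := by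
  set F : Lp ℂ 2 (volume : Measure ℝ) := h2.toLp f with hF
  have key : 𝓕 f =ᵐ[volume] (𝓕 F : Lp ℂ 2 (volume : Measure ℝ)) := by
    have hl1 : LocallyIntegrable (𝓕 f) volume :=
      (VectorFourier.fourierIntegral_continuous Real.continuous_fourierChar
        (by exact continuous_inner) h1).locallyIntegrable
    have hl2 : LocallyIntegrable (𝓕 F : Lp ℂ 2 (volume : Measure ℝ)) volume :=
      (Lp.memLp _).locallyIntegrable one_le_two
    rw [← sub_ae_eq_zero]
    refine ae_eq_zero_of_integral_contDiff_smul_eq_zero (hl1.sub hl2) fun η hη hc => ?_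
    have hg₁ : HasCompactSupport (Complex.ofRealCLM ∘ η) := hc.comp_left rfl
    have hg₂ : ContDiff ℝ ∞ (Complex.ofRealCLM ∘ η) := by fun_prop
    set s : SchwartzMap ℝ ℂ := hg₁.toSchwartzMap hg₂
    have hs : ∀ x, s x = η x := fun x => rfl
    have e1 : ∫ x, s x • (𝓕 F : Lp ℂ 2 (volume : Measure ℝ)) x = ∫ x, (𝓕 s) x • F x := by
      rw [← Lp.toTemperedDistribution_apply, ← Lp.toTemperedDistribution_apply,
        ← Lp.fourier_toTemperedDistribution_eq, TemperedDistribution.fourier_apply]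
    have e2 : ∫ x, s x • 𝓕 f x = ∫ x, (𝓕 s) x • f x := by
      have := VectorFourier.integral_fourierIntegral_smul_eq_flip (L := innerₗ ℝ)
        (μ := volume) (ν := volume) Real.continuous_fourierChar
        (by exact continuous_inner) s.integrable h1
      rw [SchwartzMap.fourier_coe]
      simp only [flip_innerₗ] at this
      exact this.symm
    have e3 : ∫ x, (𝓕 s) x • F x = ∫ x, (𝓕 s) x • f x := by
      refine integral_congr_ae ?_
      filter_upwards [h2.coeFn_toLp] with x hx
      rw [hF, hx]
    have i1 : Integrable (fun x => η x • 𝓕 f x) := hl1.integrable_smul_left_of_hasCompactSupport hη.continuous hc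
    have i2 : Integrable (fun x => η x • (𝓕 F : Lp ℂ 2 (volume : Measure ℝ)) x) :=
      hl2.integrable_smul_left_of_hasCompactSupport hη.continuous hc
    simp only [Pi.sub_apply, smul_sub]
    rw [integral_sub i1 i2, sub_eq_zero]
    have := e2.trans (e3.symm.trans e1.symm)
    simpa [hs] using this
  rw [eLpNorm_congr_ae key, ← Lp.enorm_def, ← eLpNorm_congr_ae h2.coeFn_toLp, ← Lp.enorm_def,
    ← ofReal_norm, ← ofReal_norm, Lp.norm_fourier_eq]

theorem eLpNorm_comp_mul_left_two (f : ℝ → ℂ) {c : ℝ} (hc : c ≠ 0) :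
    eLpNorm (fun x => f (c * x)) 2 volume ^ 2 = ENNReal.ofReal |c⁻¹| * eLpNorm f 2 volume ^ 2 := by
  rw [eLpNorm_two_sq, eLpNorm_two_sq]
  have h := (Homeomorph.mulLeft₀ c hc).measurableEmbedding.lintegral_map
    (μ := (volume : Measure ℝ)) (fun x => ‖f x‖ₑ ^ 2)
  simp only [Homeomorph.coe_mulLeft₀] at h
  rw [← h, Real.map_volume_mul_left hc, lintegral_smul_measure]
  rfl

/-- Plancherel's inequality in the normalization of the scattering problem. -/
theorem eLpNorm_integral_mul_exp_le {f : ℝ → ℂ} (h1 : Integrable f) {s : ℝ} (hs : |s| = 1) :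
    eLpNorm (fun z : ℝ => ∫ y, f y * Complex.exp (2 * Complex.I * (s * z) * y)) 2 volume
      ≤ 2 * eLpNorm f 2 volume := by
  -- If f is not square integrable, the right side is infinite.
  by_cases h2 : MemLp f 2
  swap
  · have : eLpNorm f 2 volume = ⊤ := by
      by_contra h; exact h2 ⟨h1.1, lt_top_iff_ne_top.2 h⟩
    simp [this]
  have hc : -s / Real.pi ≠ 0 := by
    have : s ≠ 0 := by rintro rfl; simp at hs
    exact div_ne_zero (neg_ne_zero.2 this) Real.pi_ne_zero
  have e : (fun z : ℝ => ∫ y, f y * Complex.exp (2 * Complex.I * (s * z) * y)) =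
      fun z => FourierTransform.fourier f (-s / Real.pi * z) := by
    ext z
    rw [Real.fourier_real_eq_integral_exp_smul]
    congr 1; ext y
    rw [smul_eq_mul, mul_comm]
    congr 2
    push_cast
    have := Complex.ofReal_ne_zero.2 Real.pi_ne_zero
    field_simp
  have h := eLpNorm_comp_mul_left_two (FourierTransform.fourier f) hc
  rw [eLpNorm_fourier_eq h1 h2] at h
  rw [e, ← (ENNReal.pow_right_strictMono two_ne_zero).le_iff_le]
  rw [h, mul_pow]
  gcongr
  -- The frequency is -sz/π, so the change of variables costs a factor π in the squared norm, and π
  -- ≤ 4 = 2².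
  rw [inv_div, abs_div, abs_neg, hs, div_one, abs_of_pos Real.pi_pos]
  have : ((2:ℝ≥0∞) ^ 2) = ENNReal.ofReal 4 := by
    rw [show (4:ℝ) = 2 ^ 2 by norm_num, ENNReal.ofReal_pow (by norm_num)]; simp
  rw [this]
  exact ENNReal.ofReal_le_ofReal Real.pi_le_four

/-! ### Weak derivatives -/

/-- Dominated convergence: the steps are at most 1, so the backward quotients of η live in one fixed
compact interval, where the Lipschitz constant of η bounds them. -/
theorem tendsto_integral_difference_quotient {f : ℝ → ℂ} (hf : LocallyIntegrable f volume)
    {η : ℝ → ℝ} (hη : ContDiff ℝ ∞ η) (hc : HasCompactSupport η) :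
    Tendsto (fun n : ℕ => ∫ x, (((n : ℝ) + 1) * (η (x - 1 / ((n : ℝ) + 1)) - η x)) • f x) atTop
      (𝓝 (-∫ x, deriv η x • f x)) := by
  have hη1 : ContDiff ℝ 1 η := hη.of_le (by exact_mod_cast le_top)
  obtain ⟨L, hL⟩ := hη1.lipschitzWith_of_hasCompactSupport hc one_ne_zero
  obtain ⟨R, hR⟩ := hc.isCompact.isBounded.subset_closedBall 0
  rw [← integral_neg]
  set b : ℝ → ℝ := fun x => Set.indicator (Set.Icc (-(R + 1)) (R + 1)) (fun x => L * ‖f x‖) x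
  have hb : Integrable b := by
    refine IntegrableOn.integrable_indicator ?_ measurableSet_Icc
    exact ((hf.integrableOn_isCompact isCompact_Icc).norm).const_mul _
  have hzero : ∀ x, R < |x| → η x = 0 := fun x hx => by
    by_contra h
    have := hR (subset_tsupport _ h)
    simp at this; linarith
  have hfm := hf.aestronglyMeasurable
  refine tendsto_integral_of_dominated_convergence b (fun n => ?_) hb (fun n => ?_) ?_
  · have hηc := hη.continuous
    have hcn : Continuous fun x : ℝ => ((n : ℝ) + 1) * (η (x - 1 / ((n : ℝ) + 1)) - η x) := by
      fun_prop
    exact hcn.aestronglyMeasurable.smul hfm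
  · refine Eventually.of_forall fun x => ?_
    have hn : (0 : ℝ) < (n : ℝ) + 1 := by positivity
    have hn1 : 1 / ((n : ℝ) + 1) ≤ 1 := by
      rw [div_le_one hn]; linarith [(Nat.cast_nonneg n : (0 : ℝ) ≤ n)]
    have hn0 : 0 < 1 / ((n : ℝ) + 1) := by positivity
    by_cases hx : x ∈ Set.Icc (-(R + 1)) (R + 1)
    · simp only [b, Set.indicator_of_mem hx, norm_smul, norm_mul]
      gcongr
      have := hL.dist_le_mul (x - 1 / ((n : ℝ) + 1)) x
      rw [Real.dist_eq, Real.dist_eq] at this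
      rw [Real.norm_of_nonneg hn.le, Real.norm_eq_abs]
      have h3 : |x - 1 / ((n : ℝ) + 1) - x| = 1 / ((n : ℝ) + 1) := by
        rw [sub_sub_cancel_left, abs_neg, abs_of_pos hn0]
      rw [h3] at this
      calc _ ≤ ((n : ℝ) + 1) * (L * (1 / ((n : ℝ) + 1))) := by gcongr
        _ = L := by field_simp
    · have h1 : R + 1 < |x| := by
        by_contra h
        exact hx (abs_le.1 (not_lt.1 h))
      have h2 : R < |x - 1 / ((n : ℝ) + 1)| := by
        have := abs_sub_abs_le_abs_sub x (1 / ((n : ℝ) + 1))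
        rw [abs_of_pos hn0] at this
        linarith
      have h0 := hzero x (by linarith)
      have h0' := hzero _ h2
      simp only [b, Set.indicator_of_notMem hx, h0, h0']
      simp
  · refine Eventually.of_forall fun x => ?_
    rw [← neg_smul]
    refine Tendsto.smul_const ?_ _
    have hd : HasDerivAt η (deriv η x) x :=
      (hη1.differentiable one_ne_zero x).hasDerivAt
    have h1 := hd.tendsto_slope_zero
    have h2 : Tendsto (fun n : ℕ => -(1 / ((n : ℝ) + 1))) atTop (𝓝[≠] 0) := by
      refine tendsto_nhdsWithin_iff.2 ⟨?_, Eventually.of_forall fun n => ?_⟩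
      · simpa using (tendsto_one_div_add_atTop_nhds_zero_nat (𝕜 := ℝ)).neg
      · simp; positivity
    refine (h1.comp h2).neg.congr fun n => ?_
    simp only [Function.comp, smul_eq_mul, inv_neg, one_div, inv_inv, ← sub_eq_add_neg]
    ring

/-- A square integrable function with Lipschitz continuous translates has a weak derivative in
`L²`. -/
theorem exists_hasWeakDeriv_of_eLpNorm_translate_le {f : ℝ → ℂ} (hf : MemLp f 2) {K : ℝ≥0}
    (h : ∀ t : ℝ, eLpNorm (fun x => f (x + t) - f x) 2 volume ≤ K * ‖t‖ₑ) :
    ∃ g, HasWeakDeriv f g ∧ MemLp g 2 ∧ eLpNorm g 2 volume ≤ K := by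
  have hfl : LocallyIntegrable f volume := hf.locallyIntegrable one_le_two
  -- The forward difference quotients are bounded by K in L². A weak limit of them is the weak
  -- derivative, and the bound K survives in the limit.
  set q : ℕ → ℝ → ℂ := fun n x => ((n : ℝ) + 1) • (f (x + 1 / ((n : ℝ) + 1)) - f x) with hq
  have hft : ∀ t : ℝ, MemLp (fun x => f (x + t)) 2 := fun t =>
    hf.comp_measurePreserving (measurePreserving_add_right volume t)
  have hqm : ∀ n, MemLp (q n) 2 := fun n => ((hft _).sub hf).const_smul ((n : ℝ) + 1)
  have hqn : ∀ n, eLpNorm (q n) 2 volume ≤ K := fun n => by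
    have hn : (0 : ℝ) < (n : ℝ) + 1 := by positivity
    have e : q n = ((n : ℝ) + 1) • (fun x => f (x + 1 / ((n : ℝ) + 1)) - f x) := rfl
    rw [e, eLpNorm_const_smul]
    calc _ ≤ ‖(n : ℝ) + 1‖ₑ * (K * ‖1 / ((n : ℝ) + 1)‖ₑ) := by gcongr; exact h _
      _ = K * ‖((n : ℝ) + 1) * (1 / ((n : ℝ) + 1))‖ₑ := by rw [enorm_mul]; ring
      _ = K := by rw [mul_one_div_cancel hn.ne']; simp
  let D := InnerProductSpace.toDual ℂ (Lp ℂ 2 (volume : Measure ℝ))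
  let φ : ℕ → WeakDual ℂ (Lp ℂ 2 (volume : Measure ℝ)) := fun n =>
    StrongDual.toWeakDual (D ((hqm n).toLp (q n)))
  have hnorm : ∀ n, ‖(hqm n).toLp (q n)‖ ≤ K := fun n => by
    rw [Lp.norm_toLp]
    exact ENNReal.toReal_le_coe_of_le_coe (hqn n)
  -- Banach-Alaoglu in the dual of L². The limit along a nonprincipal ultrafilter takes the place of
  -- a convergent subsequence.
  have hcomp := WeakDual.isCompact_closedBall (𝕜 := ℂ) (E := Lp ℂ 2 (volume : Measure ℝ)) 0 K
  obtain ⟨ψ, hψ, hlim⟩ := hcomp.ultrafilter_le_nhds ((hyperfilter ℕ).map φ) (by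
    rw [le_principal_iff]
    refine Filter.mem_map.2 (univ_mem' fun n => ?_)
    have : ‖D ((hqm n).toLp (q n))‖ ≤ K := by rw [LinearIsometryEquiv.norm_map]; exact hnorm n
    simpa [φ] using this)
  set g : Lp ℂ 2 (volume : Measure ℝ) := D.symm (WeakDual.toStrongDual ψ) with hg
  have hgn : ‖g‖ ≤ K := by
    rw [hg, LinearIsometryEquiv.norm_map]
    simpa using hψ
  refine ⟨g, ⟨hfl, (Lp.memLp g).locallyIntegrable one_le_two, fun η hη hc => ?_⟩, Lp.memLp g, ?_⟩
  · have hηm : MemLp (fun x => (η x : ℂ)) 2 volume := by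
      refine Continuous.memLp_of_hasCompactSupport ?_ (hc.comp_left rfl : HasCompactSupport (Complex.ofReal ∘ η))
      have := hη.continuous
      fun_prop
    have hev : Tendsto (fun n => φ n (hηm.toLp _)) (hyperfilter ℕ) (𝓝 (ψ (hηm.toLp _))) := by
      have h1 : Tendsto φ (hyperfilter ℕ) (𝓝 ψ) := hlim
      exact ((WeakDual.eval_continuous (hηm.toLp _)).tendsto ψ).comp h1
    have hin : ∀ (G : Lp ℂ 2 (volume : Measure ℝ)), inner ℂ G (hηm.toLp _) =
        conj (∫ x, η x • G x) := fun G => by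
      rw [L2.inner_def, ← integral_conj]
      refine integral_congr_ae ?_
      filter_upwards [hηm.coeFn_toLp] with x hx
      rw [hx]
      simp
    -- Summation by parts: the forward quotient of f is moved to a backward quotient of η. The
    -- conjugation comes from the first slot of the inner product.
    have e1 : ∀ n, φ n (hηm.toLp _) =
        conj (∫ x, (((n : ℝ) + 1) * (η (x - 1 / ((n : ℝ) + 1)) - η x)) • f x) := fun n => by
      have : φ n (hηm.toLp _) = inner ℂ ((hqm n).toLp (q n)) (hηm.toLp _) := rfl
      rw [this, hin]
      congr 1
      have i1 : ∀ t, Integrable (fun x => η (x - t) • f x) := fun t => by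
        refine hfl.integrable_smul_left_of_hasCompactSupport
          (hη.continuous.comp (continuous_id.sub continuous_const)) ?_
        exact hc.comp_homeomorph (Homeomorph.subRight t)
      have i0 : Integrable (fun x => η x • f x) := by simpa using i1 0
      have i2 : ∀ t, Integrable (fun x => η x • f (x + t)) := fun t => by
        simpa using (i1 t).comp_add_right t
      calc ∫ x, η x • ((hqm n).toLp (q n)) x = ∫ x, η x • q n x := by
            refine integral_congr_ae ?_
            filter_upwards [(hqm n).coeFn_toLp] with x hx
            rw [hx]
        _ = ((n : ℝ) + 1) • ((∫ x, η x • f (x + 1 / ((n : ℝ) + 1))) - ∫ x, η x • f x) := by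
            rw [← integral_sub (i2 _) i0, ← integral_smul]
            congr 1; ext x
            simp only [hq, Complex.real_smul]
            ring
        _ = ((n : ℝ) + 1) • ((∫ x, η (x - 1 / ((n : ℝ) + 1)) • f x) - ∫ x, η x • f x) := by
            congr 2
            rw [← integral_add_right_eq_self (μ := volume)
              (fun x => η (x - 1 / ((n : ℝ) + 1)) • f x) (1 / ((n : ℝ) + 1))]
            simp
        _ = _ := by
            rw [← integral_sub (i1 _) i0, ← integral_smul]
            congr 1; ext x
            simp only [Complex.real_smul]
            push_cast
            ring
    have hlim2 : Tendsto (fun n => φ n (hηm.toLp _)) (hyperfilter ℕ)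
        (𝓝 (conj (-∫ x, deriv η x • f x))) := by
      have h2 := (tendsto_integral_difference_quotient hfl hη hc).mono_left Nat.hyperfilter_le_atTop
      simp only [e1]
      exact (Complex.continuous_conj.tendsto _).comp h2
    have hu := tendsto_nhds_unique hev hlim2
    have e2 : ψ (hηm.toLp _) = inner ℂ g (hηm.toLp _) := by
      rw [← InnerProductSpace.toDual_apply_apply (𝕜 := ℂ)]
      change _ = (D (D.symm (WeakDual.toStrongDual ψ))) _
      rw [LinearIsometryEquiv.apply_symm_apply]; rfl
    rw [e2, hin] at hu
    have := (starRingEnd ℂ).injective hu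
    rw [this, neg_neg]
  · rw [← Lp.enorm_def, ← ofReal_norm, ← ENNReal.ofReal_coe_nnreal]
    exact ENNReal.ofReal_le_ofReal hgn

theorem HasWeakDeriv.ae_unique {f g h : ℝ → ℂ} (hg : HasWeakDeriv f g) (hh : HasWeakDeriv f h) :
    g =ᵐ[volume] h := by
  rw [← sub_ae_eq_zero]
  refine ae_eq_zero_of_integral_contDiff_smul_eq_zero (hg.2.1.sub hh.2.1) fun η hη hc => ?_
  have i1 := hg.2.1.integrable_smul_left_of_hasCompactSupport hη.continuous hc
  have i2 := hh.2.1.integrable_smul_left_of_hasCompactSupport hη.continuous hc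
  simp only [Pi.sub_apply, smul_sub]
  rw [integral_sub i1 i2, sub_eq_zero]
  exact neg_injective ((hg.2.2 η hη hc).symm.trans (hh.2.2 η hη hc))

theorem HasWeakDeriv.congr {f f' g g' : ℝ → ℂ} (h : HasWeakDeriv f g) (hf : f =ᵐ[volume] f')
    (hg : g =ᵐ[volume] g') : HasWeakDeriv f' g' := by
  refine ⟨(locallyIntegrable_congr hf).1 h.1, (locallyIntegrable_congr hg).1 h.2.1,
    fun η hη hc => ?_⟩
  have e1 : ∫ x, deriv η x • f x = ∫ x, deriv η x • f' x :=
    integral_congr_ae (hf.mono fun x hx => by simp only [hx])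
  have e2 : ∫ x, η x • g x = ∫ x, η x • g' x :=
    integral_congr_ae (hg.mono fun x hx => by simp only [hx])
  rw [← e1, ← e2]
  exact h.2.2 η hη hc

theorem HasWeakDeriv.sub {f f' g g' : ℝ → ℂ} (h : HasWeakDeriv f g) (h' : HasWeakDeriv f' g') :
    HasWeakDeriv (f - f') (g - g') := by
  refine ⟨h.1.sub h'.1, h.2.1.sub h'.2.1, fun η hη hc => ?_⟩
  have hdc : Continuous (deriv η) := hη.continuous_deriv (by exact_mod_cast le_top)
  have j1 := h.1.integrable_smul_left_of_hasCompactSupport hdc hc.deriv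
  have j2 := h'.1.integrable_smul_left_of_hasCompactSupport hdc hc.deriv
  have i1 := h.2.1.integrable_smul_left_of_hasCompactSupport hη.continuous hc
  have i2 := h'.2.1.integrable_smul_left_of_hasCompactSupport hη.continuous hc
  simp only [Pi.sub_apply, smul_sub]
  rw [integral_sub j1 j2, integral_sub i1 i2, h.2.2 η hη hc, h'.2.2 η hη hc]
  ring

end KaupNewell

namespace KaupNewell

open Filter Topology Set

/-! ### Gronwall's inequality with an integrable weight -/

/-- The weight `exp (2 ∫_{-∞}^x v)`. -/
noncomputable def gronWeight (v : ℝ → ℝ≥0∞) (x : ℝ) : ℝ≥0∞ :=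
  ENNReal.ofReal (Real.exp (2 * (∫⁻ y in Iic x, v y).toReal))

theorem one_le_gronWeight (v : ℝ → ℝ≥0∞) (x : ℝ) : 1 ≤ gronWeight v x := by
  rw [gronWeight, ← ENNReal.ofReal_one]
  exact ENNReal.ofReal_le_ofReal (Real.one_le_exp (by positivity))

theorem gronWeight_le {v : ℝ → ℝ≥0∞} {M : ℝ≥0} (hv : ∫⁻ y, v y ≤ M) (x : ℝ) :
    gronWeight v x ≤ ENNReal.ofReal (Real.exp (2 * M)) := by
  refine ENNReal.ofReal_le_ofReal (Real.exp_le_exp.2 ?_)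
  gcongr
  exact ENNReal.toReal_le_coe_of_le_coe ((setLIntegral_le_lintegral _ _).trans hv)

theorem gronWeight_mono {v : ℝ → ℝ≥0∞} (hv : ∫⁻ y, v y ≠ ⊤) : Monotone (gronWeight v) := by
  intro x y hxy
  refine ENNReal.ofReal_le_ofReal (Real.exp_le_exp.2 ?_)
  gcongr
  exact ((setLIntegral_le_lintegral _ _).trans_lt (lt_top_iff_ne_top.2 hv)).ne

/-- With E = exp(2∫_{-∞}^x w) one has E' = 2wE almost everywhere. Since E is monotone, the integral
of its derivative is at most its increment, and the inequality needs no absolute continuity. -/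
theorem integral_mul_exp_integral_le {w : ℝ → ℝ} (hw : Integrable w) (h0 : ∀ x, 0 ≤ w x) (x : ℝ) :
    Integrable (fun y => w y * Real.exp (2 * ∫ t in Iic y, w t)) ∧
    ∫ y in Iic x, w y * Real.exp (2 * ∫ t in Iic y, w t) ≤
      Real.exp (2 * ∫ t in Iic x, w t) / 2 := by
  set N : ℝ → ℝ := fun y => ∫ t in Iic y, w t with hN
  have hmono : Monotone N := fun a b hab =>
    setIntegral_mono_set hw.integrableOn (Eventually.of_forall h0)
      (Iic_subset_Iic.2 hab).eventuallyLE
  set E : ℝ → ℝ := fun y => Real.exp (2 * N y) with hE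
  have hEmono : Monotone E := fun a b hab =>
    Real.exp_le_exp.2 (mul_le_mul_of_nonneg_left (hmono hab) zero_le_two)
  have hNle : ∀ y, N y ≤ ∫ t, w t := fun y =>
    setIntegral_le_integral hw (Eventually.of_forall h0)
  have hint : Integrable (fun y => w y * E y) := by
    refine hw.mul_bdd (c := Real.exp (2 * ∫ t, w t)) hEmono.measurable.aestronglyMeasurable
      (Eventually.of_forall fun y => ?_)
    rw [Real.norm_of_nonneg (Real.exp_pos _).le]
    exact Real.exp_le_exp.2 (mul_le_mul_of_nonneg_left (hNle y) zero_le_two)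
  refine ⟨hint, ?_⟩
  have hder : ∀ᵐ y, HasDerivAt E (2 * (w y * E y)) y := by
    filter_upwards [LocallyIntegrable.ae_hasDerivAt_integral hw.locallyIntegrable] with y hy
    have h1 : HasDerivAt N (w y) y := by
      have h2 := (hy 0).const_add (∫ t in Iic 0, w t)
      refine h2.congr_of_eventuallyEq (Eventually.of_forall fun s => ?_)
      simp only [hN]
      rw [← intervalIntegral.integral_Iic_sub_Iic hw.integrableOn hw.integrableOn]
      ring
    have := (h1.const_mul 2).exp
    convert this using 1
    simp only [hE]; ring
  have hle : ∀ a ≤ x, ∫ y in a..x, w y * E y ≤ E x / 2 := fun a ha => by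
    -- The integral of the derivative of a monotone function lies between zero and the increment.
    have h1 := (hEmono.monotoneOn (uIcc a x)).intervalIntegral_deriv_mem_uIcc
    rw [uIcc_of_le (sub_nonneg.2 (hEmono ha))] at h1
    have h2 : ∫ y in a..x, deriv E y = ∫ y in a..x, 2 * (w y * E y) :=
      intervalIntegral.integral_congr_ae (hder.mono fun y hy _ => hy.deriv)
    rw [h2, intervalIntegral.integral_const_mul] at h1
    have := h1.2
    have h3 : 0 < E a := Real.exp_pos _
    linarith
  refine le_of_tendsto (intervalIntegral_tendsto_integral_Iic x hint.integrableOn tendsto_id) ?_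
  filter_upwards [eventually_le_atBot x] with a ha using hle a ha

/-- In the supremum norm weighted by `gronWeight`, the Volterra operator with kernel v is a
contraction with factor 1/2. Both Gronwall's inequality and the convergence of the Picard iterates
rest on this. -/
theorem lintegral_mul_gronWeight_le {v : ℝ → ℝ≥0∞} (hm : Measurable v) (hv : ∫⁻ y, v y ≠ ⊤)
    (x : ℝ) : ∫⁻ y in Iic x, v y * gronWeight v y ≤ gronWeight v x / 2 := by
  set w : ℝ → ℝ := fun y => (v y).toReal
  have hw : Integrable w := integrable_toReal_of_lintegral_ne_top hm.aemeasurable hv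
  have hfin : ∀ᵐ y, v y < ⊤ := ae_lt_top hm hv
  have hN : ∀ y, ∫ t in Iic y, w t = (∫⁻ t in Iic y, v t).toReal := fun y =>
    integral_toReal hm.aemeasurable (ae_restrict_of_ae hfin)
  obtain ⟨h1, h2⟩ := integral_mul_exp_integral_le hw (fun _ => ENNReal.toReal_nonneg) x
  simp only [hN] at h1 h2
  have e : ∫⁻ y in Iic x, v y * gronWeight v y =
      ENNReal.ofReal (∫ y in Iic x, w y * Real.exp (2 * (∫⁻ t in Iic y, v t).toReal)) := by
    rw [ofReal_integral_eq_lintegral_ofReal h1.integrableOn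
      (Eventually.of_forall fun y => by positivity)]
    refine lintegral_congr_ae ?_
    filter_upwards [ae_restrict_of_ae hfin] with y hy
    rw [ENNReal.ofReal_mul ENNReal.toReal_nonneg, ENNReal.ofReal_toReal hy.ne, gronWeight]
  rw [e, gronWeight]
  refine (ENNReal.ofReal_le_ofReal h2).trans_eq ?_
  rw [ENNReal.ofReal_div_of_pos two_pos, ENNReal.ofReal_ofNat]

/-- Gronwall's inequality. -/
theorem le_add_of_le_add_lintegral {v r f : ℝ → ℝ≥0∞} (hm : Measurable v) (hv : ∫⁻ y, v y ≠ ⊤)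
    (hf : Measurable f) {C : ℝ≥0∞} (hC : C ≠ ⊤) (hr : ∀ x, r x ≤ C)
    (h : ∀ x, r x ≤ f x + ∫⁻ y in Iic x, v y * r y) (x : ℝ) :
    r x ≤ f x + 2 * gronWeight v x * ∫⁻ y in Iic x, v y * f y := by
  set R : ℝ → ℝ≥0∞ := fun x => ∫⁻ y in Iic x, v y * r y with hR
  have hRC : ∀ x, R x ≤ C * ∫⁻ y, v y := fun x => calc
    R x ≤ ∫⁻ y in Iic x, v y * C := lintegral_mono fun y => by gcongr; exact hr y
    _ ≤ ∫⁻ y, v y * C := setLIntegral_le_lintegral _ _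
    _ = _ := by rw [lintegral_mul_const _ hm, mul_comm]
  refine (h x).trans ?_
  gcongr
  set c := ∫⁻ y in Iic x, v y * f y with hc
  rcases eq_or_ne c ⊤ with hct | hct
  · rw [hct]
    have : 2 * gronWeight v x ≠ 0 :=
      mul_ne_zero two_ne_zero (zero_lt_one.trans_le (one_le_gronWeight v x)).ne'
    simp [ENNReal.mul_top this]
  have hw0 : ∀ t, gronWeight v t ≠ 0 := fun t =>
    (zero_lt_one.trans_le (one_le_gronWeight v t)).ne'
  have hwt : ∀ t, gronWeight v t ≠ ⊤ := fun t => ENNReal.ofReal_ne_top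
  -- The weighted supremum of R over (-∞, x]; the contraction property gives m ≤ c + m/2.
  set m : ℝ≥0∞ := ⨆ t ∈ Iic x, R t / gronWeight v t with hmdef
  -- The a priori bound C serves only here: m must be finite for m/2 to be absorbed. The final
  -- estimate does not involve C.
  have hmt : m ≠ ⊤ := by
    have : m ≤ C * ∫⁻ y, v y := iSup₂_le fun t _ =>
      (ENNReal.div_le_of_le_mul' (by
        calc R t ≤ 1 * R t := by rw [one_mul]
          _ ≤ gronWeight v t * (C * ∫⁻ y, v y) := by
            gcongr
            · exact one_le_gronWeight v t
            · exact hRC t))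
    exact ne_top_of_le_ne_top (ENNReal.mul_ne_top hC hv) this
  have hRm : ∀ t ≤ x, R t ≤ m * gronWeight v t := fun t ht => by
    have : R t / gronWeight v t ≤ m := le_iSup₂ (f := fun t _ => R t / gronWeight v t) t ht
    rwa [ENNReal.div_le_iff (hw0 t) (hwt t)] at this
  have hstep : m ≤ c + m / 2 := iSup₂_le fun t ht => by
    rw [ENNReal.div_le_iff (hw0 t) (hwt t)]
    have ht' : t ≤ x := ht
    calc R t ≤ ∫⁻ y in Iic t, (v y * f y + v y * R y) := by
          refine lintegral_mono fun y => ?_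
          rw [← mul_add]
          gcongr
          exact h y
      _ = (∫⁻ y in Iic t, v y * f y) + ∫⁻ y in Iic t, v y * R y := by
          exact lintegral_add_left (hm.mul hf) _
      _ ≤ c + ∫⁻ y in Iic t, m * (v y * gronWeight v y) := by
          gcongr ?_ + ?_
          · exact lintegral_mono_set (Iic_subset_Iic.2 ht')
          · refine setLIntegral_mono' measurableSet_Iic fun y hy => ?_
            calc v y * R y ≤ v y * (m * gronWeight v y) := by
                  gcongr; exact hRm y (le_trans hy ht')
              _ = _ := by ring
      _ ≤ c * gronWeight v t + m * (gronWeight v t / 2) := by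
          rw [lintegral_const_mul' _ _ hmt]
          gcongr
          · exact le_mul_of_one_le_right' (one_le_gronWeight v t)
          · exact lintegral_mul_gronWeight_le hm hv t
      _ = _ := by rw [ENNReal.div_eq_inv_mul, ENNReal.div_eq_inv_mul]; ring
  have hm2 : m ≤ 2 * c := by
    have h1 : m / 2 ≠ ⊤ := ENNReal.div_ne_top hmt two_ne_zero
    have h2 : m / 2 + m / 2 ≤ c + m / 2 := by rwa [ENNReal.add_halves]
    have h3 : m / 2 ≤ c := (ENNReal.add_le_add_iff_right h1).1 h2
    rwa [ENNReal.div_le_iff two_ne_zero ENNReal.ofNat_ne_top, mul_comm] at h3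
  calc R x ≤ m * gronWeight v x := hRm x le_rfl
    _ ≤ 2 * c * gronWeight v x := by gcongr
    _ = 2 * gronWeight v x * c := by ring

/-! ### The Volterra equation -/

/-- The sum of the absolute values of the two components. -/
noncomputable def absSum (p : ℂ × ℂ) : ℝ≥0∞ := ‖p.1‖ₑ + ‖p.2‖ₑ

theorem absSum_ne_top (p : ℂ × ℂ) : absSum p ≠ ⊤ := by simp [absSum]

theorem absSum_add_le (p q : ℂ × ℂ) : absSum (p + q) ≤ absSum p + absSum q := by
  simp only [absSum, Prod.fst_add, Prod.snd_add]
  calc _ ≤ (‖p.1‖ₑ + ‖q.1‖ₑ) + (‖p.2‖ₑ + ‖q.2‖ₑ) := by gcongr <;> exact enorm_add_le _ _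
    _ = _ := by ring

theorem absSum_neg (p : ℂ × ℂ) : absSum (-p) = absSum p := by simp [absSum]

theorem edist_le_absSum (p q : ℂ × ℂ) : edist p q ≤ absSum (p - q) := by
  rw [Prod.edist_eq, edist_eq_enorm_sub, edist_eq_enorm_sub]
  exact max_le le_self_add le_add_self

theorem absSum_sub_le_edist (p q : ℂ × ℂ) : absSum (p - q) ≤ 2 * edist p q := by
  rw [Prod.edist_eq, edist_eq_enorm_sub, edist_eq_enorm_sub, two_mul]
  exact add_le_add (le_max_left _ _) (le_max_right _ _)

@[fun_prop]
theorem measurable_absSum : Measurable absSum := by unfold absSum; fun_prop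

theorem measurable_integral_Iic {α : Type*} [MeasurableSpace α] {h : α → ℝ → ℂ}
    (hh : Measurable (Function.uncurry h)) {u : α → ℝ} (hu : Measurable u) :
    Measurable fun p => ∫ y in Iic (u p), h p y := by
  have e : (fun p => ∫ y in Iic (u p), h p y) =
      fun p => ∫ y, {q : α × ℝ | q.2 ≤ u q.1}.indicator (Function.uncurry h) (p, y) := by
    ext p
    rw [← integral_indicator measurableSet_Iic]
    rfl
  rw [e]
  have hs : MeasurableSet {q : α × ℝ | q.2 ≤ u q.1} :=
    measurableSet_le measurable_snd (hu.comp measurable_fst)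
  exact (StronglyMeasurable.integral_prod_right
    (f := fun p y => {q : α × ℝ | q.2 ≤ u q.1}.indicator (Function.uncurry h) (p, y))
    (hh.indicator hs).stronglyMeasurable).measurable

/-- The right side of the Volterra system
`p(x) = c₁ + ∫_{-∞}^x a q`, `q(x) = c₂ + ∫_{-∞}^x e(x - y) b(y) p(y) dy`. -/
noncomputable def volt (e a b : ℝ → ℂ) (c : ℂ × ℂ) (f : ℝ → ℂ × ℂ) (x : ℝ) : ℂ × ℂ :=
  (c.1 + ∫ y in Iic x, a y * (f y).2, c.2 + ∫ y in Iic x, e (x - y) * (b y * (f y).1))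

/-- The iterates of the Volterra system, from zero. -/
noncomputable def picard (e a b : ℝ → ℂ) (c : ℂ × ℂ) : ℕ → ℝ → ℂ × ℂ
  | 0 => 0
  | n + 1 => volt e a b c (picard e a b c n)

/-- The bounded solution of the Volterra system. -/
noncomputable def voltSol (e a b : ℝ → ℂ) (c : ℂ × ℂ) (x : ℝ) : ℂ × ℂ :=
  limUnder atTop fun n => picard e a b c n x

/-- The parameter in Z will be the spectral parameter. Joint measurability in it and in x is what
Tonelli's theorem requires for norms in z. -/
theorem measurable_volt {Z : Type*} [MeasurableSpace Z] {e a b : Z → ℝ → ℂ} {c : ℂ × ℂ}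
    {f : Z → ℝ → ℂ × ℂ} (he : Measurable (Function.uncurry e)) (ha : Measurable (Function.uncurry a))
    (hb : Measurable (Function.uncurry b)) (hf : Measurable (Function.uncurry f)) :
    Measurable fun p : Z × ℝ => volt (e p.1) (a p.1) (b p.1) c (f p.1) p.2 := by
  unfold volt
  have h1 : Measurable fun q : (Z × ℝ) × ℝ => (q.1.1, q.2) := by fun_prop
  have h2 : Measurable fun q : (Z × ℝ) × ℝ => (q.1.1, q.1.2 - q.2) := by fun_prop
  refine Measurable.prodMk (measurable_const.add ?_) (measurable_const.add ?_)
  · exact measurable_integral_Iic (h := fun (p : Z × ℝ) y => a p.1 y * (f p.1 y).2)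
      ((ha.comp h1).mul (measurable_snd.comp (hf.comp h1))) measurable_snd
  · exact measurable_integral_Iic
      (h := fun (p : Z × ℝ) y => e p.1 (p.2 - y) * (b p.1 y * (f p.1 y).1))
      ((he.comp h2).mul ((hb.comp h1).mul (measurable_fst.comp (hf.comp h1)))) measurable_snd

theorem measurable_picard {Z : Type*} [MeasurableSpace Z] {e a b : Z → ℝ → ℂ} {c : ℂ × ℂ}
    (he : Measurable (Function.uncurry e)) (ha : Measurable (Function.uncurry a))
    (hb : Measurable (Function.uncurry b)) (n : ℕ) :
    Measurable (Function.uncurry fun z => picard (e z) (a z) (b z) c n) := by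
  induction n with
  | zero => exact measurable_const
  | succ n ih => exact measurable_volt he ha hb ih

theorem measurable_picard' {e a b : ℝ → ℂ} {c : ℂ × ℂ} (he : Measurable e) (ha : Measurable a)
    (hb : Measurable b) (n : ℕ) : Measurable (picard e a b c n) :=
  (measurable_picard (Z := Unit) (e := fun _ => e) (a := fun _ => a) (b := fun _ => b) (c := c)
    (he.comp measurable_snd) (ha.comp measurable_snd) (hb.comp measurable_snd) n).comp
    (measurable_prodMk_left (x := ()))

/-- The assumptions on the kernel of a Volterra system. -/
structure VoltKernel (e a b : ℝ → ℂ) : Prop where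
  meas_e : Measurable e
  meas_a : Measurable a
  meas_b : Measurable b
  le_one : ∀ t, 0 ≤ t → ‖e t‖ₑ ≤ 1
  fin : ∫⁻ y, (‖a y‖ₑ + ‖b y‖ₑ) ≠ ⊤

theorem VoltKernel.integrable_a {e a b : ℝ → ℂ} (k : VoltKernel e a b) : Integrable a :=
  ⟨k.meas_a.aestronglyMeasurable,
    (lintegral_mono fun _ => le_self_add).trans_lt (lt_top_iff_ne_top.2 k.fin)⟩

theorem VoltKernel.integrable_b {e a b : ℝ → ℂ} (k : VoltKernel e a b) : Integrable b :=
  ⟨k.meas_b.aestronglyMeasurable,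
    (lintegral_mono fun _ => le_add_self).trans_lt (lt_top_iff_ne_top.2 k.fin)⟩

theorem VoltKernel.meas_v {e a b : ℝ → ℂ} (k : VoltKernel e a b) :
    Measurable fun y => ‖a y‖ₑ + ‖b y‖ₑ := k.meas_a.enorm.add k.meas_b.enorm

theorem integrable_mul_of_enorm_le {a f : ℝ → ℂ} (ha : Integrable a)
    (hf : AEStronglyMeasurable f volume) {C : ℝ≥0∞} (hC : C ≠ ⊤) (hfC : ∀ᵐ x, ‖f x‖ₑ ≤ C) :
    Integrable fun y => a y * f y :=
  ha.mul_bdd (c := C.toReal) hf (hfC.mono fun x hx => by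
    rw [← toReal_enorm]
    exact ENNReal.toReal_mono hC hx)

/-- Only the values e(x - y) with y ≤ x enter, and these are bounded by 1. The propagator therefore
disappears from the estimate. -/
theorem absSum_volt_sub_le {e a b : ℝ → ℂ} (k : VoltKernel e a b) {c c' : ℂ × ℂ} {f g : ℝ → ℂ × ℂ}
    (hf : Measurable f) (hg : Measurable g) {C : ℝ≥0∞} (hC : C ≠ ⊤)
    (hfC : ∀ x, absSum (f x) ≤ C) (hgC : ∀ x, absSum (g x) ≤ C) (x : ℝ) :
    absSum (volt e a b c f x - volt e a b c' g x) ≤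
      absSum (c - c') + ∫⁻ y in Iic x, (‖a y‖ₑ + ‖b y‖ₑ) * absSum (f y - g y) := by
  have i2 : ∀ {f : ℝ → ℂ × ℂ}, Measurable f → (∀ x, absSum (f x) ≤ C) →
      Integrable fun y => a y * (f y).2 := fun hf hfC =>
    integrable_mul_of_enorm_le k.integrable_a (measurable_snd.comp hf).aestronglyMeasurable hC
      (Eventually.of_forall fun x => le_add_self.trans (hfC x))
  have i1 : ∀ {f : ℝ → ℂ × ℂ}, Measurable f → (∀ x, absSum (f x) ≤ C) →
      IntegrableOn (fun y => e (x - y) * (b y * (f y).1)) (Iic x) := fun hf hfC => by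
    have hi := integrable_mul_of_enorm_le k.integrable_b
      (measurable_fst.comp hf).aestronglyMeasurable hC
      (Eventually.of_forall fun x => le_self_add.trans (hfC x))
    refine hi.integrableOn.bdd_mul (c := 1)
      (k.meas_e.comp (measurable_const.sub measurable_id)).aestronglyMeasurable ?_
    filter_upwards [ae_restrict_mem measurableSet_Iic] with y hy
    have := k.le_one (x - y) (sub_nonneg.2 hy)
    rw [← toReal_enorm]
    simpa using ENNReal.toReal_mono ENNReal.one_ne_top this
  have e1 : volt e a b c f x - volt e a b c' g x = (c - c') +
      (∫ y in Iic x, a y * (f y - g y).2, ∫ y in Iic x, e (x - y) * (b y * (f y - g y).1)) := by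
    ext
    · simp only [volt, Prod.fst_sub, Prod.fst_add, Prod.snd_sub, mul_sub]
      rw [integral_sub (i2 hf hfC).integrableOn (i2 hg hgC).integrableOn]; ring
    · simp only [volt, Prod.fst_sub, Prod.snd_add, Prod.snd_sub, mul_sub]
      rw [integral_sub (i1 hf hfC) (i1 hg hgC)]; ring
  rw [e1]
  refine (absSum_add_le _ _).trans ?_
  gcongr
  have hA : Measurable fun y => ‖a y‖ₑ * ‖(f y - g y).2‖ₑ :=
    k.meas_a.enorm.mul (measurable_snd.comp (hf.sub hg)).enorm
  calc absSum _ ≤ (∫⁻ y in Iic x, ‖a y‖ₑ * ‖(f y - g y).2‖ₑ) +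
        ∫⁻ y in Iic x, ‖b y‖ₑ * ‖(f y - g y).1‖ₑ := by
        refine add_le_add ?_ ?_
        · refine (enorm_integral_le_lintegral_enorm _).trans (lintegral_mono fun y => ?_)
          rw [enorm_mul]
        · refine (enorm_integral_le_lintegral_enorm _).trans ?_
          refine setLIntegral_mono' measurableSet_Iic fun y hy => ?_
          rw [enorm_mul, enorm_mul]
          exact mul_le_of_le_one_left' (k.le_one _ (sub_nonneg.2 hy))
    _ = ∫⁻ y in Iic x, (‖a y‖ₑ * ‖(f y - g y).2‖ₑ + ‖b y‖ₑ * ‖(f y - g y).1‖ₑ) :=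
        (lintegral_add_left hA _).symm
    _ ≤ _ := by
        refine lintegral_mono fun y => ?_
        rw [add_mul, absSum]
        gcongr
        · exact le_add_self
        · exact le_self_add

theorem absSum_volt_le {e a b : ℝ → ℂ} (k : VoltKernel e a b) {c : ℂ × ℂ} {f : ℝ → ℂ × ℂ}
    (hf : Measurable f) {C : ℝ≥0∞} (hC : C ≠ ⊤) (hfC : ∀ x, absSum (f x) ≤ C) (x : ℝ) :
    absSum (volt e a b c f x) ≤
      absSum c + ∫⁻ y in Iic x, (‖a y‖ₑ + ‖b y‖ₑ) * absSum (f y) := by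
  have h := absSum_volt_sub_le k (c := c) (c' := 0) hf (measurable_const (a := (0 : ℂ × ℂ))) hC hfC
    (fun x => by simp [absSum]) x
  have e0 : volt e a b 0 (fun _ => 0) x = 0 := by simp [volt]
  simpa [e0] using h

theorem picard_bounded {e a b : ℝ → ℂ} (k : VoltKernel e a b) (c : ℂ × ℂ) (n : ℕ) :
    ∃ C : ℝ≥0∞, C ≠ ⊤ ∧ ∀ x, absSum (picard e a b c n x) ≤ C := by
  induction n with
  | zero => exact ⟨0, by simp, fun x => by simp [picard, absSum]⟩
  | succ n ih =>
    obtain ⟨C, hC, h⟩ := ih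
    refine ⟨absSum c + (∫⁻ y, (‖a y‖ₑ + ‖b y‖ₑ)) * C,
      ENNReal.add_ne_top.2 ⟨absSum_ne_top c, ENNReal.mul_ne_top k.fin hC⟩, fun x => ?_⟩
    refine (absSum_volt_le k (measurable_picard' k.meas_e k.meas_a k.meas_b n) hC h x).trans ?_
    rw [← lintegral_mul_const _ k.meas_v]
    refine add_le_add_right ?_ _
    refine (setLIntegral_le_lintegral _ _).trans (lintegral_mono fun y => ?_)
    gcongr
    exact h y

/-- Each iteration gains a factor 1/2 by the contraction in the weight `gronWeight`. -/
theorem absSum_picard_succ_sub_le {e a b : ℝ → ℂ} (k : VoltKernel e a b) (c : ℂ × ℂ) (n : ℕ)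
    (x : ℝ) : absSum (picard e a b c (n + 1) x - picard e a b c n x) ≤
      absSum c * gronWeight (fun y => ‖a y‖ₑ + ‖b y‖ₑ) x * 2⁻¹ ^ n := by
  induction n generalizing x with
  | zero =>
    have : picard e a b c 1 x - picard e a b c 0 x = c := by simp [picard, volt]
    rw [zero_add, this, pow_zero, mul_one]
    exact le_mul_of_one_le_right' (one_le_gronWeight _ x)
  | succ n ih =>
    obtain ⟨C, hC, h⟩ := picard_bounded k c n
    obtain ⟨C', hC', h'⟩ := picard_bounded k c (n + 1)
    have hm := measurable_picard' (c := c) k.meas_e k.meas_a k.meas_b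
    refine (absSum_volt_sub_le k (hm (n + 1)) (hm n) (C := C + C')
      (ENNReal.add_ne_top.2 ⟨hC, hC'⟩) (fun x => (h' x).trans le_add_self)
      (fun x => (h x).trans le_self_add) x).trans ?_
    have h0 : absSum (c - c) = 0 := by simp [absSum]
    rw [h0, zero_add]
    calc _ ≤ ∫⁻ y in Iic x, absSum c * 2⁻¹ ^ n *
            ((‖a y‖ₑ + ‖b y‖ₑ) * gronWeight (fun y => ‖a y‖ₑ + ‖b y‖ₑ) y) := by
          refine lintegral_mono fun y => ?_
          calc _ ≤ (‖a y‖ₑ + ‖b y‖ₑ) *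
                (absSum c * gronWeight (fun y => ‖a y‖ₑ + ‖b y‖ₑ) y * 2⁻¹ ^ n) := by
                gcongr; exact ih y
            _ = _ := by ring
      _ ≤ absSum c * 2⁻¹ ^ n * (gronWeight (fun y => ‖a y‖ₑ + ‖b y‖ₑ) x / 2) := by
          rw [lintegral_const_mul' _ _ (ENNReal.mul_ne_top (absSum_ne_top c)
            (ENNReal.pow_ne_top (by simp)))]
          gcongr
          exact lintegral_mul_gronWeight_le k.meas_v k.fin x
      _ = _ := by rw [ENNReal.div_eq_inv_mul, pow_succ]; ring

theorem tendsto_picard {e a b : ℝ → ℂ} (k : VoltKernel e a b) (c : ℂ × ℂ) (x : ℝ) :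
    Tendsto (fun n => picard e a b c n x) atTop (𝓝 (voltSol e a b c x)) := by
  refine (cauchySeq_of_edist_le_geometric 2⁻¹
    (absSum c * gronWeight (fun y => ‖a y‖ₑ + ‖b y‖ₑ) x) (by simp)
    (ENNReal.mul_ne_top (absSum_ne_top c) ENNReal.ofReal_ne_top) fun n => ?_).tendsto_limUnder
  rw [edist_comm]
  exact (edist_le_absSum _ _).trans (absSum_picard_succ_sub_le k c n x)

theorem edist_picard_voltSol_le {e a b : ℝ → ℂ} (k : VoltKernel e a b) (c : ℂ × ℂ) (n : ℕ)
    (x : ℝ) : edist (picard e a b c n x) (voltSol e a b c x) ≤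
      2 * (absSum c * gronWeight (fun y => ‖a y‖ₑ + ‖b y‖ₑ) x) * 2⁻¹ ^ n := by
  have := edist_le_of_edist_le_geometric_of_tendsto 2⁻¹
    (absSum c * gronWeight (fun y => ‖a y‖ₑ + ‖b y‖ₑ) x)
    (f := fun n => picard e a b c n x) (fun n => by
      rw [edist_comm]
      exact (edist_le_absSum _ _).trans (absSum_picard_succ_sub_le k c n x)) (tendsto_picard k c x) n
  refine this.trans_eq ?_
  rw [ENNReal.one_sub_inv_two, ENNReal.div_eq_inv_mul, inv_inv]; ring

theorem measurable_voltSol {Z : Type*} [MeasurableSpace Z] {e a b : Z → ℝ → ℂ} (c : ℂ × ℂ)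
    (he : Measurable (Function.uncurry e)) (ha : Measurable (Function.uncurry a))
    (hb : Measurable (Function.uncurry b)) (k : ∀ z, VoltKernel (e z) (a z) (b z)) :
    Measurable (Function.uncurry fun z => voltSol (e z) (a z) (b z) c) :=
  measurable_of_tendsto_metrizable (fun n => measurable_picard he ha hb n)
    (tendsto_pi_nhds.2 fun p => tendsto_picard (k p.1) c p.2)

theorem measurable_voltSol' {e a b : ℝ → ℂ} (k : VoltKernel e a b) (c : ℂ × ℂ) :
    Measurable (voltSol e a b c) :=
  measurable_of_tendsto_metrizable (fun n => measurable_picard' k.meas_e k.meas_a k.meas_b n)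
    (tendsto_pi_nhds.2 fun x => tendsto_picard k c x)

theorem absSum_voltSol_le {e a b : ℝ → ℂ} (k : VoltKernel e a b) (c : ℂ × ℂ) (x : ℝ) :
    absSum (voltSol e a b c x) ≤
      4 * absSum c * gronWeight (fun y => ‖a y‖ₑ + ‖b y‖ₑ) x := by
  -- The zeroth iterate vanishes, so its distance to the solution is the size of the solution. The
  -- constant 4 combines the sum of the geometric series with the passage from the maximum to the
  -- sum of components.
  have h := edist_picard_voltSol_le k c 0 x
  have h2 := absSum_sub_le_edist (voltSol e a b c x) (picard e a b c 0 x)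
  rw [edist_comm] at h2
  simp only [picard, Pi.zero_apply, sub_zero, pow_zero, mul_one] at h h2
  refine h2.trans ((mul_le_mul_right h 2).trans_eq ?_)
  ring

theorem absSum_voltSol_le' {e a b : ℝ → ℂ} (k : VoltKernel e a b) (c : ℂ × ℂ) {M : ℝ≥0}
    (hM : ∫⁻ y, (‖a y‖ₑ + ‖b y‖ₑ) ≤ M) (x : ℝ) :
    absSum (voltSol e a b c x) ≤ 4 * absSum c * ENNReal.ofReal (Real.exp (2 * M)) :=
  (absSum_voltSol_le k c x).trans (by gcongr; exact gronWeight_le hM x)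

theorem exists_absSum_voltSol_le {e a b : ℝ → ℂ} (k : VoltKernel e a b) (c : ℂ × ℂ) :
    ∃ C : ℝ≥0∞, C ≠ ⊤ ∧ ∀ x, absSum (voltSol e a b c x) ≤ C := by
  lift ∫⁻ y, (‖a y‖ₑ + ‖b y‖ₑ) to ℝ≥0 using k.fin with M hM
  exact ⟨_, ENNReal.mul_ne_top (ENNReal.mul_ne_top (by simp) (absSum_ne_top c))
    ENNReal.ofReal_ne_top, absSum_voltSol_le' k c hM.symm.le⟩

/-- The Volterra operator is continuous along the iterates: by monotonicity of the weight, their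
convergence is uniform on (-∞, x]. -/
theorem volt_voltSol {e a b : ℝ → ℂ} (k : VoltKernel e a b) (c : ℂ × ℂ) :
    volt e a b c (voltSol e a b c) = voltSol e a b c := by
  ext1 x
  set v : ℝ → ℝ≥0∞ := fun y => ‖a y‖ₑ + ‖b y‖ₑ with hv
  obtain ⟨C, hC, hb⟩ := exists_absSum_voltSol_le k c
  set K : ℝ≥0∞ := 4 * absSum c * gronWeight v x * ∫⁻ y, v y with hK
  have hKt : K ≠ ⊤ := ENNReal.mul_ne_top (ENNReal.mul_ne_top
    (ENNReal.mul_ne_top (by simp) (absSum_ne_top c)) ENNReal.ofReal_ne_top) k.fin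
  have h1 : Tendsto (fun n => picard e a b c (n + 1) x) atTop
      (𝓝 (volt e a b c (voltSol e a b c) x)) := by
    rw [tendsto_iff_edist_tendsto_0]
    have h0 : Tendsto (fun n : ℕ => K * 2⁻¹ ^ n) atTop (𝓝 0) := by
      have := ENNReal.Tendsto.const_mul (a := K)
        (ENNReal.tendsto_pow_atTop_nhds_zero_of_lt_one (r := 2⁻¹) (by simp)) (Or.inr hKt)
      simpa using this
    refine tendsto_of_tendsto_of_tendsto_of_le_of_le tendsto_const_nhds h0 (fun _ => zero_le)
      fun n => ?_
    obtain ⟨C', hC', hb'⟩ := picard_bounded k c n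
    refine (edist_le_absSum _ _).trans ((absSum_volt_sub_le k
      (measurable_picard' k.meas_e k.meas_a k.meas_b n) (measurable_voltSol' k c) (C := C + C')
      (ENNReal.add_ne_top.2 ⟨hC, hC'⟩) (fun x => (hb' x).trans le_add_self)
      (fun x => (hb x).trans le_self_add) x).trans ?_)
    have h0 : absSum (c - c) = 0 := by simp [absSum]
    rw [h0, zero_add]
    calc _ ≤ ∫⁻ y in Iic x, (4 * absSum c * gronWeight v x * 2⁻¹ ^ n) * v y := by
          refine setLIntegral_mono' measurableSet_Iic fun y hy => ?_
          rw [mul_comm]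
          gcongr
          calc _ ≤ 2 * edist (picard e a b c n y) (voltSol e a b c y) := absSum_sub_le_edist _ _
            _ ≤ 2 * (2 * (absSum c * gronWeight v y) * 2⁻¹ ^ n) := by
                gcongr; exact edist_picard_voltSol_le k c n y
            _ ≤ 2 * (2 * (absSum c * gronWeight v x) * 2⁻¹ ^ n) := by
                gcongr; exact gronWeight_mono k.fin hy
            _ = _ := by ring
      _ ≤ ∫⁻ y, (4 * absSum c * gronWeight v x * 2⁻¹ ^ n) * v y := setLIntegral_le_lintegral _ _
      _ = _ := by rw [lintegral_const_mul _ k.meas_v, hK]; ring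
  exact tendsto_nhds_unique h1 ((tendsto_add_atTop_iff_nat 1).2 (tendsto_picard k c x))

/-- Uniqueness of bounded solutions of the Volterra system. -/
theorem eq_voltSol {e a b : ℝ → ℂ} (k : VoltKernel e a b) {c : ℂ × ℂ} {f : ℝ → ℂ × ℂ}
    (hf : Measurable f) {C : ℝ≥0∞} (hC : C ≠ ⊤) (hfC : ∀ x, absSum (f x) ≤ C)
    (h : ∀ x, f x = volt e a b c f x) : f = voltSol e a b c := by
  obtain ⟨C', hC', hb⟩ := exists_absSum_voltSol_le k c
  have hm := measurable_voltSol' k c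
  have hCC : C + C' ≠ ⊤ := ENNReal.add_ne_top.2 ⟨hC, hC'⟩
  have key := le_add_of_le_add_lintegral (r := fun x => absSum (f x - voltSol e a b c x))
    (f := fun _ => 0) k.meas_v k.fin measurable_const hCC (fun x => by
      rw [sub_eq_add_neg]
      refine (absSum_add_le _ _).trans ?_
      rw [absSum_neg]
      exact add_le_add (hfC x) (hb x)) (fun x => by
      have := absSum_volt_sub_le k (c := c) (c' := c) hf hm hCC
        (fun x => (hfC x).trans le_self_add) (fun x => (hb x).trans le_add_self) x
      rw [← h x, volt_voltSol k c] at this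
      simpa [absSum] using this)
  ext1 x
  have := key x
  have h0 : absSum (f x - voltSol e a b c x) = 0 := by simpa using this
  have h1 := (edist_le_absSum (f x) (voltSol e a b c x)).trans h0.le
  exact edist_le_zero.1 h1

/-! ### Oscillatory Volterra systems: square integrability in the spectral parameter -/

/-- The phase `exp (2 i s z y)`. -/
noncomputable def phase (s z y : ℝ) : ℂ := Complex.exp (2 * Complex.I * (s * z) * y)

theorem norm_phase (s z y : ℝ) : ‖phase s z y‖ = 1 := by
  rw [phase, Complex.norm_exp]
  simp

theorem enorm_phase (s z y : ℝ) : ‖phase s z y‖ₑ = 1 := by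
  rw [← ofReal_norm, norm_phase]; simp

@[fun_prop]
theorem measurable_phase {α : Type*} [MeasurableSpace α] (s : ℝ) {z y : α → ℝ} (hz : Measurable z)
    (hy : Measurable y) : Measurable fun p => phase s (z p) (y p) := by
  unfold phase; fun_prop

/-- Fatou's lemma. It carries bounds to the limit x → +∞, and later from difference quotients to a
multiplication by z. -/
theorem eLpNorm_two_le_of_tendsto {α : Type*} [MeasurableSpace α] {μ : Measure α}
    {G : ℕ → α → ℝ≥0∞} {g : α → ℝ≥0∞} (hG : ∀ n, Measurable (G n))
    (h : ∀ z, Tendsto (fun n => G n z) atTop (𝓝 (g z))) {ρ : ℝ≥0∞}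
    (hρ : ∀ n, eLpNorm (G n) 2 μ ≤ ρ) : eLpNorm g 2 μ ≤ ρ := by
  simp only [eLpNorm_two_le_iff, enorm_eq_self] at hρ ⊢
  calc ∫⁻ z, g z ^ 2 ∂μ = ∫⁻ z, liminf (fun n => G n z ^ 2) atTop ∂μ := by
        congr 1; ext z
        exact (((ENNReal.continuous_pow 2).tendsto _).comp (h z)).liminf_eq.symm
    _ ≤ liminf (fun n => ∫⁻ z, G n z ^ 2 ∂μ) atTop :=
        lintegral_liminf_le fun n => (hG n).pow_const 2
    _ ≤ ρ ^ 2 := liminf_le_of_le (by isBoundedDefault) fun b hb => by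
        obtain ⟨n, hn⟩ := hb.exists
        exact hn.trans (hρ n)

/-- Gronwall's inequality holds for each z, and Minkowski's inequality then takes the L² norm in z
inside the x-integral. This needs v to be independent of z. -/
theorem eLpNorm_gronwall {r F : ℝ → ℝ → ℝ≥0∞} {v : ℝ → ℝ≥0∞} (hv : Measurable v) {M : ℝ≥0}
    (hM : ∫⁻ y, v y ≤ M) (hF : Measurable (Function.uncurry F)) {C : ℝ≥0∞} (hC : C ≠ ⊤)
    (hr : ∀ z x, r z x ≤ C) (h : ∀ z x, r z x ≤ F z x + ∫⁻ y in Iic x, v y * r z y) {ρ : ℝ≥0∞}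
    (hρ : ∀ x, eLpNorm (fun z => F z x) 2 volume ≤ ρ) (x : ℝ) :
    eLpNorm (fun z => r z x) 2 volume ≤ ρ * (1 + 2 * ENNReal.ofReal (Real.exp (2 * M)) * M) := by
  have hvt : ∫⁻ y, v y ≠ ⊤ := ne_top_of_le_ne_top ENNReal.coe_ne_top hM
  have hFx : ∀ x, Measurable fun z => F z x := fun x => hF.comp measurable_prodMk_right
  have hFz : ∀ z, Measurable (F z) := fun z => hF.comp measurable_prodMk_left
  set W := ENNReal.ofReal (Real.exp (2 * M))
  have hint : Measurable fun z => ∫⁻ y in Iic x, v y * F z y :=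
    Measurable.lintegral_prod_right' (f := fun p : ℝ × ℝ => v p.2 * F p.1 p.2)
      ((hv.comp measurable_snd).mul hF)
  calc eLpNorm (fun z => r z x) 2 volume
      ≤ eLpNorm ((fun z => F z x) + fun z => 2 * W * ∫⁻ y in Iic x, v y * F z y) 2 volume := by
        refine eLpNorm_mono_enorm fun z => ?_
        simp only [enorm_eq_self, Pi.add_apply]
        refine (le_add_of_le_add_lintegral hv hvt (hFz z) hC (hr z) (h z) x).trans ?_
        gcongr
        exact gronWeight_le hM x
    _ ≤ eLpNorm (fun z => F z x) 2 volume +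
        eLpNorm (fun z => 2 * W * ∫⁻ y in Iic x, v y * F z y) 2 volume :=
        eLpNorm_add_le (hFx x).aestronglyMeasurable
          (hint.const_mul _).aestronglyMeasurable one_le_two
    _ ≤ ρ + ρ * ∫⁻ y in Iic x, 2 * W * v y := by
        gcongr
        · exact hρ x
        · refine le_of_eq_of_le ?_ (eLpNorm_lintegral_mul_le (μ := volume)
            (ν := volume.restrict (Iic x)) (hv.const_mul (2 * W)) hF hρ)
          congr 1; ext z
          simp only [mul_assoc]
          have e1 : Measurable fun y => v y * F z y := hv.mul (hFz z)
          rw [lintegral_const_mul _ (e1.const_mul W), lintegral_const_mul _ e1]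
    _ ≤ ρ + ρ * (2 * W * M) := by
        rw [lintegral_const_mul _ hv]
        gcongr
        exact (setLIntegral_le_lintegral _ _).trans hM
    _ = _ := by ring

/-- Fubini on the triangle t ≤ y ≤ x. The outer factor is left with integrals of F alone over
intervals, to which Plancherel applies when F oscillates. -/
theorem integral_Iic_mul_integral_Iic {F m : ℝ → ℂ} (hF : Integrable F) (hm : Integrable m)
    (x : ℝ) : ∫ y in Iic x, F y * ∫ t in Iic y, m t = ∫ t in Iic x, m t * ∫ y in Icc t x, F y := by
  set S : Set (ℝ × ℝ) := {q | q.1 ≤ x ∧ q.2 ≤ q.1}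
  have hS : MeasurableSet S := (measurableSet_le measurable_fst measurable_const).inter
    (measurableSet_le measurable_snd measurable_fst)
  have hi : Integrable (S.indicator fun q : ℝ × ℝ => F q.1 * m q.2) (volume.prod volume) :=
    (hF.mul_prod hm).indicator hS
  have h := integral_integral_swap (f := fun y t => S.indicator (fun q => F q.1 * m q.2) (y, t)) hi
  have e1 : ∀ y, ∫ t, S.indicator (fun q : ℝ × ℝ => F q.1 * m q.2) (y, t) =
      (Iic x).indicator (fun y => F y * ∫ t in Iic y, m t) y := fun y => by
    by_cases hy : y ≤ x
    · rw [indicator_of_mem (show y ∈ Iic x from hy), ← integral_const_mul,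
        ← integral_indicator measurableSet_Iic]
      congr 1; ext t
      simp [S, indicator, hy]
    · simp [S, indicator, hy]
  have e2 : ∀ t, ∫ y, S.indicator (fun q : ℝ × ℝ => F q.1 * m q.2) (y, t) =
      (Iic x).indicator (fun t => m t * ∫ y in Icc t x, F y) t := fun t => by
    by_cases ht : t ≤ x
    · rw [indicator_of_mem (show t ∈ Iic x from ht), ← integral_const_mul,
        ← integral_indicator measurableSet_Icc]
      congr 1; ext y
      simp [S, indicator, and_comm, mul_comm]
    · rw [indicator_of_notMem (show t ∉ Iic x from ht)]
      refine integral_eq_zero_of_ae (Eventually.of_forall fun y => ?_)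
      have : ¬(y ≤ x ∧ t ≤ y) := fun h => ht (h.2.trans h.1)
      simp [S, indicator, this]
  simp only [e1, e2] at h
  rwa [integral_indicator measurableSet_Iic, integral_indicator measurableSet_Iic] at h

theorem integrable_mul_phase {f : ℝ → ℂ} (hf : Integrable f) (s z : ℝ) :
    Integrable fun y => f y * phase s z y :=
  hf.mul_bdd (c := 1) (by fun_prop) (Eventually.of_forall fun y => (norm_phase s z y).le)

theorem eLpNorm_setIntegral_mul_phase_le {f : ℝ → ℂ} (h1 : Integrable f)
    {s : ℝ} (hs : |s| = 1) {S : Set ℝ} (hS : MeasurableSet S) :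
    eLpNorm (fun z : ℝ => ∫ y in S, f y * phase s z y) 2 volume ≤ 2 * eLpNorm f 2 volume := by
  refine le_trans (le_of_eq ?_) ((eLpNorm_integral_mul_exp_le (h1.indicator hS) hs).trans ?_)
  · congr 1; ext z
    rw [← integral_indicator hS]
    congr 1; ext y
    by_cases hy : y ∈ S <;> simp [hy, phase]
  · gcongr
    exact eLpNorm_indicator_le _

/-- An oscillatory integral against a function of bounded variation, in `L²` of the frequency. -/
theorem eLpNorm_oscillatory_le {f : ℝ → ℂ} (hf : Measurable f) (h1 : Integrable f) {s : ℝ}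
    (hs : |s| = 1) (c : ℂ) {m : ℝ → ℝ → ℂ} (hm : Measurable (Function.uncurry m)) {g : ℝ → ℝ≥0∞}
    (hg : Measurable g) (hgt : ∫⁻ y, g y ≠ ⊤) (hmg : ∀ z y, ‖m z y‖ₑ ≤ g y) (x : ℝ) :
    eLpNorm (fun z => ∫ y in Iic x, f y * phase s z y * (c + ∫ t in Iic y, m z t)) 2 volume ≤
      2 * eLpNorm f 2 volume * (‖c‖ₑ + ∫⁻ y, g y) := by
  have hmz : ∀ z, Measurable (m z) := fun z => hm.comp measurable_prodMk_left
  have hmi : ∀ z, Integrable (m z) := fun z => ⟨(hmz z).aestronglyMeasurable,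
    (lintegral_mono (hmg z)).trans_lt (lt_top_iff_ne_top.2 hgt)⟩
  have hF := fun z => integrable_mul_phase h1 s z
  -- By Plancherel, Φ(·, t) has L² norm at most 2‖f‖, uniformly in t.
  set Φ : ℝ → ℝ → ℂ := fun z t => ∫ y in Icc t x, f y * phase s z y
  have hΦ : Measurable (Function.uncurry Φ) := by
    have e : Function.uncurry Φ = fun p : ℝ × ℝ =>
        ∫ y in Iic x, {q : (ℝ × ℝ) × ℝ | q.1.2 ≤ q.2}.indicator
          (fun q => f q.2 * phase s q.1.1 q.2) (p, y) := by
      ext p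
      have : ∀ y, {q : (ℝ × ℝ) × ℝ | q.1.2 ≤ q.2}.indicator
          (fun q => f q.2 * phase s q.1.1 q.2) (p, y) =
          (Ici p.2).indicator (fun y => f y * phase s p.1 y) y := fun y => by
        simp [indicator]
      simp only [this]
      rw [setIntegral_indicator measurableSet_Ici, Iic_inter_Ici]
      rfl
    rw [e]
    refine measurable_integral_Iic (h := fun p y => {q : (ℝ × ℝ) × ℝ | q.1.2 ≤ q.2}.indicator
          (fun q => f q.2 * phase s q.1.1 q.2) (p, y)) ?_ measurable_const
    refine Measurable.indicator (f := fun q : (ℝ × ℝ) × ℝ => f q.2 * phase s q.1.1 q.2) ?_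
      (measurableSet_le (by fun_prop) (by fun_prop))
    fun_prop
  -- The constant c gives a truncated Fourier transform of f. The remaining term becomes, after
  -- exchange of the integrals, a superposition of the Φ(·, t) with densities dominated by g, which
  -- Minkowski's inequality handles.
  have e : (fun z => ∫ y in Iic x, f y * phase s z y * (c + ∫ t in Iic y, m z t)) =
      (c • fun z => ∫ y in Iic x, f y * phase s z y) + fun z => ∫ t in Iic x, m z t * Φ z t := by
    ext z
    simp only [Pi.add_apply, Pi.smul_apply, smul_eq_mul]
    rw [← integral_Iic_mul_integral_Iic (hF z) (hmi z), ← integral_const_mul, ← integral_add]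
    · congr 1; ext y; ring
    · exact ((hF z).const_mul c).integrableOn
    · refine Integrable.integrableOn (integrable_mul_of_enorm_le (hF z) ?_ hgt
        (Eventually.of_forall fun y => ?_))
      · exact (measurable_integral_Iic (h := fun _ : ℝ => m z) ((hmz z).comp measurable_snd)
          measurable_id).aestronglyMeasurable
      · exact (enorm_integral_le_lintegral_enorm _).trans
          ((setLIntegral_le_lintegral _ _).trans (lintegral_mono (hmg z)))
  have hm1 : Measurable fun z => ∫ y in Iic x, f y * phase s z y :=
    measurable_integral_Iic (h := fun z y => f y * phase s z y)
      (by simp only [Function.uncurry_def]; fun_prop) measurable_const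
  have hm2 : Measurable fun z => ∫ t in Iic x, m z t * Φ z t :=
    measurable_integral_Iic (h := fun z t => m z t * Φ z t) (hm.mul hΦ) measurable_const
  rw [e]
  refine (eLpNorm_add_le (hm1.const_smul c).aestronglyMeasurable hm2.aestronglyMeasurable
    one_le_two).trans ?_
  rw [mul_add, eLpNorm_const_smul, mul_comm _ ‖c‖ₑ]
  gcongr
  · exact eLpNorm_setIntegral_mul_phase_le h1 hs measurableSet_Iic
  · calc _ ≤ eLpNorm (fun z => ∫⁻ t in Iic x, g t * ‖Φ z t‖ₑ) 2 volume := by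
          refine eLpNorm_mono_enorm fun z => ?_
          rw [enorm_eq_self]
          refine (enorm_integral_le_lintegral_enorm _).trans (lintegral_mono fun t => ?_)
          rw [enorm_mul]
          gcongr
          exact hmg z t
      _ ≤ 2 * eLpNorm f 2 volume * ∫⁻ t in Iic x, g t := by
          refine eLpNorm_lintegral_mul_le hg hΦ.enorm fun t => ?_
          rw [eLpNorm_enorm]
          exact eLpNorm_setIntegral_mul_phase_le h1 hs measurableSet_Icc
      _ ≤ _ := by gcongr; exact Measure.restrict_le_self

/-- A pair of measurable coefficients with `‖a‖_{L¹} + ‖b‖_{L¹} ≤ M`. -/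
structure IsPotential (M : ℝ≥0) (a b : ℝ → ℂ) : Prop where
  meas_a : Measurable a
  meas_b : Measurable b
  le : ∫⁻ y, (‖a y‖ₑ + ‖b y‖ₑ) ≤ M

/-- For real z the phases have modulus one and can be absorbed into the coefficients without
changing their mass. The propagator is then trivial, and all bounds are uniform in z. -/
theorem IsPotential.kernel {M : ℝ≥0} {a b : ℝ → ℂ} (p : IsPotential M a b) (z : ℝ) :
    VoltKernel (fun _ => 1) (fun y => a y * phase 1 z y) (fun y => b y * phase (-1) z y) where
  meas_e := measurable_const
  meas_a := p.meas_a.mul (by fun_prop)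
  meas_b := p.meas_b.mul (by fun_prop)
  le_one _ _ := by simp
  fin := by
    simp only [enorm_mul, enorm_phase, mul_one]
    exact ne_top_of_le_ne_top ENNReal.coe_ne_top p.le

theorem IsPotential.meas_v {M : ℝ≥0} {a b : ℝ → ℂ} (p : IsPotential M a b) :
    Measurable fun y => ‖a y‖ₑ + ‖b y‖ₑ := p.meas_a.enorm.add p.meas_b.enorm

theorem IsPotential.integrable_a {M : ℝ≥0} {a b : ℝ → ℂ} (p : IsPotential M a b) : Integrable a :=
  ⟨p.meas_a.aestronglyMeasurable,
    (lintegral_mono fun _ => le_self_add).trans_lt (p.le.trans_lt ENNReal.coe_lt_top)⟩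

theorem IsPotential.integrable_b {M : ℝ≥0} {a b : ℝ → ℂ} (p : IsPotential M a b) : Integrable b :=
  ⟨p.meas_b.aestronglyMeasurable,
    (lintegral_mono fun _ => le_add_self).trans_lt (p.le.trans_lt ENNReal.coe_lt_top)⟩

/-- The solution of `P' = a e^{2izx} σ`, `σ' = b e^{-2izx} P` with limit `(1, 0)` at `-∞`. -/
noncomputable def jost (a b : ℝ → ℂ) (z : ℝ) : ℝ → ℂ × ℂ :=
  voltSol (fun _ => 1) (fun y => a y * phase 1 z y) (fun y => b y * phase (-1) z y) (1, 0)

/-- A bound for the solutions of systems of mass `M`. -/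
noncomputable def jostBound (M : ℝ≥0) : ℝ≥0∞ := 4 * ENNReal.ofReal (Real.exp (2 * M))

theorem jostBound_ne_top (M : ℝ≥0) : jostBound M ≠ ⊤ := by simp [jostBound, ENNReal.mul_eq_top]

/-! ### Zakharov-Shabat systems: bounds and oscillatory sources -/

section

variable {M : ℝ≥0} {a b : ℝ → ℂ}

theorem IsPotential.absSum_jost_le (p : IsPotential M a b) (z x : ℝ) :
    absSum (jost a b z x) ≤ jostBound M := by
  refine (absSum_voltSol_le' (p.kernel z) (1, 0) (M := M) ?_ x).trans_eq ?_
  · simp only [enorm_mul, enorm_phase, mul_one]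
    exact p.le
  · simp [absSum, jostBound]

theorem IsPotential.measurable_jost (p : IsPotential M a b) :
    Measurable (Function.uncurry (jost a b)) := by
  have ha := p.meas_a
  have hb := p.meas_b
  exact measurable_voltSol (e := fun _ _ => 1) (a := fun z y => a y * phase 1 z y)
    (b := fun z y => b y * phase (-1) z y) (1, 0) (by simp only [Function.uncurry_def]; fun_prop)
    (by simp only [Function.uncurry_def]; fun_prop)
    (by simp only [Function.uncurry_def]; fun_prop) p.kernel

theorem IsPotential.measurable_jost_left (p : IsPotential M a b) (z : ℝ) :
    Measurable (jost a b z) := measurable_voltSol' (p.kernel z) (1, 0)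

theorem IsPotential.volt_jost (p : IsPotential M a b) (z x : ℝ) :
    jost a b z x = volt (fun _ => 1) (fun y => a y * phase 1 z y) (fun y => b y * phase (-1) z y)
      (1, 0) (jost a b z) x :=
  (congrFun (volt_voltSol (p.kernel z) (1, 0)) x).symm

theorem IsPotential.jost_fst (p : IsPotential M a b) (z x : ℝ) :
    (jost a b z x).1 = 1 + ∫ y in Iic x, a y * phase 1 z y * (jost a b z y).2 := by
  rw [p.volt_jost z x, volt]

theorem IsPotential.jost_snd (p : IsPotential M a b) (z x : ℝ) :
    (jost a b z x).2 = 0 + ∫ y in Iic x, b y * phase (-1) z y * (jost a b z y).1 := by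
  rw [p.volt_jost z x, volt]
  simp only [one_mul]

theorem integrable_mul_phase_mul {f g : ℝ → ℂ} (hf : Integrable f) (hg : Measurable g) {C : ℝ≥0∞}
    (hC : C ≠ ⊤) (h : ∀ y, ‖g y‖ₑ ≤ C) (s z : ℝ) : Integrable fun y => f y * phase s z y * g y :=
  integrable_mul_of_enorm_le (integrable_mul_phase hf s z) hg.aestronglyMeasurable hC
    (Eventually.of_forall h)

theorem enorm_fst_le_absSum (p : ℂ × ℂ) : ‖p.1‖ₑ ≤ absSum p := le_self_add

theorem enorm_snd_le_absSum (p : ℂ × ℂ) : ‖p.2‖ₑ ≤ absSum p := le_add_self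

/-- The source of the system for differences. -/
noncomputable def source (a b : ℝ → ℂ) (Y : ℝ → ℝ → ℂ × ℂ) (z x : ℝ) : ℂ × ℂ :=
  (∫ y in Iic x, a y * phase 1 z y * (Y z y).2, ∫ y in Iic x, b y * phase (-1) z y * (Y z y).1)

theorem measurable_source (ha : Measurable a) (hb : Measurable b) {Y : ℝ → ℝ → ℂ × ℂ}
    (hY : Measurable (Function.uncurry Y)) : Measurable (Function.uncurry (source a b Y)) := by
  have h1 : Measurable fun q : (ℝ × ℝ) × ℝ => Y q.1.1 q.2 :=
    hY.comp (g := Function.uncurry Y) (f := fun q : (ℝ × ℝ) × ℝ => (q.1.1, q.2)) (by fun_prop)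
  refine Measurable.prodMk ?_ ?_
  · exact measurable_integral_Iic
      (h := fun (p : ℝ × ℝ) y => a y * phase 1 p.1 y * (Y p.1 y).2)
      (by simp only [Function.uncurry_def]; fun_prop) measurable_snd
  · exact measurable_integral_Iic
      (h := fun (p : ℝ × ℝ) y => b y * phase (-1) p.1 y * (Y p.1 y).1)
      (by simp only [Function.uncurry_def]; fun_prop) measurable_snd

theorem absSum_source_le (Y : ℝ → ℝ → ℂ × ℂ) (z x : ℝ) :
    absSum (source a b Y z x) ≤ (∫⁻ y in Iic x, ‖a y‖ₑ * absSum (Y z y)) +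
      ∫⁻ y in Iic x, ‖b y‖ₑ * absSum (Y z y) := by
  refine add_le_add ?_ ?_
  · refine (enorm_integral_le_lintegral_enorm _).trans (lintegral_mono fun y => ?_)
    rw [enorm_mul, enorm_mul, enorm_phase, mul_one]
    gcongr
    exact enorm_snd_le_absSum _
  · refine (enorm_integral_le_lintegral_enorm _).trans (lintegral_mono fun y => ?_)
    rw [enorm_mul, enorm_mul, enorm_phase, mul_one]
    gcongr
    exact enorm_fst_le_absSum _

theorem absSum_source_le' (ha : Measurable a) {Y : ℝ → ℝ → ℂ × ℂ}
    (hY : Measurable (Function.uncurry Y)) (z x : ℝ) :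
    absSum (source a b Y z x) ≤ ∫⁻ y in Iic x, (‖a y‖ₑ + ‖b y‖ₑ) * absSum (Y z y) := by
  refine (absSum_source_le Y z x).trans_eq ?_
  have hm : Measurable fun y => ‖a y‖ₑ * absSum (Y z y) :=
    ha.enorm.mul (measurable_absSum.comp (hY.comp measurable_prodMk_left))
  rw [← lintegral_add_left hm]
  simp only [add_mul]

/-- The source in `L²` of the spectral parameter, for a uniformly bounded factor. -/
theorem eLpNorm_source_le_of_eLpNorm_le (ha : Measurable a) (hb : Measurable b)
    {Y : ℝ → ℝ → ℂ × ℂ} (hY : Measurable (Function.uncurry Y)) {ρ : ℝ≥0∞}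
    (h : ∀ x, eLpNorm (fun z => absSum (Y z x)) 2 volume ≤ ρ) (x : ℝ) :
    eLpNorm (fun z => absSum (source a b Y z x)) 2 volume ≤ ρ * ∫⁻ y, (‖a y‖ₑ + ‖b y‖ₑ) := by
  calc _ ≤ eLpNorm (fun z => ∫⁻ y in Iic x, (‖a y‖ₑ + ‖b y‖ₑ) * absSum (Y z y)) 2 volume :=
        eLpNorm_mono_enorm fun z => by
          rw [enorm_eq_self, enorm_eq_self]
          exact absSum_source_le' ha hY z x
    _ ≤ ρ * ∫⁻ y in Iic x, (‖a y‖ₑ + ‖b y‖ₑ) :=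
        eLpNorm_lintegral_mul_le (φ := fun z y => absSum (Y z y)) (ha.enorm.add hb.enorm)
          (measurable_absSum.comp hY) h
    _ ≤ _ := by gcongr; exact Measure.restrict_le_self

/-- The source in `L²` of the spectral parameter, for a factor of bounded variation. -/
theorem eLpNorm_source_le_of_variation (ha : Measurable a) (hb : Measurable b)
    (ha1 : Integrable a) (hb1 : Integrable b) {Y : ℝ → ℝ → ℂ × ℂ} {c : ℂ × ℂ}
    {m₁ m₂ : ℝ → ℝ → ℂ} (hm₁ : Measurable (Function.uncurry m₁))
    (hm₂ : Measurable (Function.uncurry m₂)) {g : ℝ → ℝ≥0∞} (hg : Measurable g)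
    (hgt : ∫⁻ y, g y ≠ ⊤) (h₁ : ∀ z y, ‖m₁ z y‖ₑ ≤ g y) (h₂ : ∀ z y, ‖m₂ z y‖ₑ ≤ g y)
    (hY₁ : ∀ z x, (Y z x).1 = c.1 + ∫ y in Iic x, m₁ z y)
    (hY₂ : ∀ z x, (Y z x).2 = c.2 + ∫ y in Iic x, m₂ z y) (x : ℝ) :
    eLpNorm (fun z => absSum (source a b Y z x)) 2 volume ≤
      2 * (eLpNorm a 2 volume + eLpNorm b 2 volume) * (absSum c + ∫⁻ y, g y) := by
  have hI : ∀ {m : ℝ → ℝ → ℂ}, Measurable (Function.uncurry m) →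
      Measurable fun q : ℝ × ℝ => ∫ t in Iic q.2, m q.1 t := fun {m} hm =>
    measurable_integral_Iic (h := fun (q : ℝ × ℝ) t => m q.1 t)
      (hm.comp (f := fun r : (ℝ × ℝ) × ℝ => (r.1.1, r.2)) (by fun_prop)) measurable_snd
  have hs : ∀ {m : ℝ → ℝ → ℂ} (s : ℝ) (c : ℂ) {f : ℝ → ℂ}, Measurable (Function.uncurry m) →
      Measurable f → Measurable fun z => ∫ y in Iic x, f y * phase s z y *
        (c + ∫ t in Iic y, m z t) := fun {m} s c {f} hm hf =>
    measurable_integral_Iic (h := fun z y => f y * phase s z y * (c + ∫ t in Iic y, m z t))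
      (by have := hI hm; simp only [Function.uncurry_def]; fun_prop) measurable_const
  have k1 := eLpNorm_oscillatory_le ha ha1 (s := 1) (by simp) c.2 hm₂ hg hgt h₂ x
  have k2 := eLpNorm_oscillatory_le hb hb1 (s := -1) (by simp) c.1 hm₁ hg hgt h₁ x
  have e : (fun z => absSum (source a b Y z x)) =
      (fun z => ‖∫ y in Iic x, a y * phase 1 z y * (c.2 + ∫ t in Iic y, m₂ z t)‖ₑ) +
      fun z => ‖∫ y in Iic x, b y * phase (-1) z y * (c.1 + ∫ t in Iic y, m₁ z t)‖ₑ := by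
    ext z
    simp only [absSum, source, Pi.add_apply, hY₁, hY₂]
  rw [e]
  refine (eLpNorm_add_le (hs 1 c.2 hm₂ ha).enorm.aestronglyMeasurable
    (hs (-1) c.1 hm₁ hb).enorm.aestronglyMeasurable one_le_two).trans ?_
  rw [eLpNorm_enorm, eLpNorm_enorm]
  calc _ ≤ 2 * eLpNorm a 2 volume * (‖c.2‖ₑ + ∫⁻ y, g y) +
        2 * eLpNorm b 2 volume * (‖c.1‖ₑ + ∫⁻ y, g y) := add_le_add k1 k2
    _ ≤ 2 * eLpNorm a 2 volume * (absSum c + ∫⁻ y, g y) +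
        2 * eLpNorm b 2 volume * (absSum c + ∫⁻ y, g y) := by
        gcongr
        · exact enorm_snd_le_absSum c
        · exact enorm_fst_le_absSum c
    _ = _ := by ring

end

/-- The constant in Gronwall's inequality for systems of mass `M`. -/
noncomputable def gronConst (M : ℝ≥0) : ℝ≥0∞ := 1 + 2 * ENNReal.ofReal (Real.exp (2 * M)) * M

theorem gronConst_ne_top (M : ℝ≥0) : gronConst M ≠ ⊤ := by
  simp [gronConst, ENNReal.mul_eq_top]

/-- The constant of the `L²` Lipschitz estimate for systems of mass `M`. -/
noncomputable def lipConst (M : ℝ≥0) : ℝ≥0∞ := 2 * (1 + M * jostBound M) * gronConst M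

theorem lipConst_ne_top (M : ℝ≥0) : lipConst M ≠ ⊤ :=
  ENNReal.mul_ne_top (ENNReal.mul_ne_top (by simp) (ENNReal.add_ne_top.2
    ⟨by simp, ENNReal.mul_ne_top (by simp) (jostBound_ne_top M)⟩)) (gronConst_ne_top M)

/-! ### Lipschitz dependence of the solutions on the coefficients -/

section

variable {M : ℝ≥0} {a b a' b' : ℝ → ℂ}

theorem source_add_left (ha : Integrable a) (hb : Integrable b) (ha' : Integrable a')
    (hb' : Integrable b') {Y : ℝ → ℝ → ℂ × ℂ} (hY : Measurable (Function.uncurry Y)) {C : ℝ≥0∞}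
    (hC : C ≠ ⊤) (h : ∀ z x, absSum (Y z x) ≤ C) (z x : ℝ) :
    source (a + a') (b + b') Y z x = source a b Y z x + source a' b' Y z x := by
  have m1 : Measurable fun y => (Y z y).1 := measurable_fst.comp (hY.comp measurable_prodMk_left)
  have m2 : Measurable fun y => (Y z y).2 := measurable_snd.comp (hY.comp measurable_prodMk_left)
  have b1 : ∀ y, ‖(Y z y).1‖ₑ ≤ C := fun y => (enorm_fst_le_absSum _).trans (h z y)
  have b2 : ∀ y, ‖(Y z y).2‖ₑ ≤ C := fun y => (enorm_snd_le_absSum _).trans (h z y)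
  ext
  · simp only [source, Prod.fst_add]
    rw [← integral_add (integrable_mul_phase_mul ha m2 hC b2 1 z).integrableOn
      (integrable_mul_phase_mul ha' m2 hC b2 1 z).integrableOn]
    simp only [Pi.add_apply, add_mul]
  · simp only [source, Prod.snd_add]
    rw [← integral_add (integrable_mul_phase_mul hb m1 hC b1 (-1) z).integrableOn
      (integrable_mul_phase_mul hb' m1 hC b1 (-1) z).integrableOn]
    simp only [Pi.add_apply, add_mul]

theorem source_sub_right (ha : Integrable a) (hb : Integrable b) {Y Y' : ℝ → ℝ → ℂ × ℂ}
    (hY : Measurable (Function.uncurry Y)) (hY' : Measurable (Function.uncurry Y')) {C : ℝ≥0∞}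
    (hC : C ≠ ⊤) (h : ∀ z x, absSum (Y z x) ≤ C) (h' : ∀ z x, absSum (Y' z x) ≤ C) (z x : ℝ) :
    source a b (Y - Y') z x = source a b Y z x - source a b Y' z x := by
  have m1 : ∀ {Y : ℝ → ℝ → ℂ × ℂ}, Measurable (Function.uncurry Y) →
      Measurable fun y => (Y z y).1 := fun hY =>
    measurable_fst.comp (hY.comp measurable_prodMk_left)
  have m2 : ∀ {Y : ℝ → ℝ → ℂ × ℂ}, Measurable (Function.uncurry Y) →
      Measurable fun y => (Y z y).2 := fun hY =>
    measurable_snd.comp (hY.comp measurable_prodMk_left)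
  have b1 : ∀ {Y : ℝ → ℝ → ℂ × ℂ}, (∀ z x, absSum (Y z x) ≤ C) → ∀ y, ‖(Y z y).1‖ₑ ≤ C :=
    fun h y => (enorm_fst_le_absSum _).trans (h z y)
  have b2 : ∀ {Y : ℝ → ℝ → ℂ × ℂ}, (∀ z x, absSum (Y z x) ≤ C) → ∀ y, ‖(Y z y).2‖ₑ ≤ C :=
    fun h y => (enorm_snd_le_absSum _).trans (h z y)
  ext
  · simp only [source, Prod.fst_sub]
    rw [← integral_sub (integrable_mul_phase_mul ha (m2 hY) hC (b2 h) 1 z).integrableOn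
      (integrable_mul_phase_mul ha (m2 hY') hC (b2 h') 1 z).integrableOn]
    simp only [Pi.sub_apply, Prod.snd_sub, mul_sub]
  · simp only [source, Prod.snd_sub]
    rw [← integral_sub (integrable_mul_phase_mul hb (m1 hY) hC (b1 h) (-1) z).integrableOn
      (integrable_mul_phase_mul hb (m1 hY') hC (b1 h') (-1) z).integrableOn]
    simp only [Pi.sub_apply, Prod.fst_sub, mul_sub]

theorem IsPotential.jost_eq (p : IsPotential M a b) (z x : ℝ) :
    jost a b z x = (1, 0) + source a b (jost a b) z x := by
  ext
  · rw [p.jost_fst]; rfl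
  · rw [p.jost_snd]; rfl

/-- The difference solves a Volterra equation with coefficients a', b', driven by the difference of
the coefficients applied to the first solution. Gronwall's inequality thus reduces every estimate to
one of the source. -/
theorem IsPotential.jost_sub (p : IsPotential M a b) (p' : IsPotential M a' b') (z x : ℝ) :
    jost a b z x - jost a' b' z x = source (a - a') (b - b') (jost a b) z x +
      source a' b' (jost a b - jost a' b') z x := by
  have h1 := source_add_left (p.integrable_a.sub p'.integrable_a)
    (p.integrable_b.sub p'.integrable_b) p'.integrable_a p'.integrable_b p.measurable_jost
    (jostBound_ne_top M) p.absSum_jost_le z x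
  rw [sub_add_cancel, sub_add_cancel] at h1
  rw [source_sub_right p'.integrable_a p'.integrable_b p.measurable_jost p'.measurable_jost
    (jostBound_ne_top M) p.absSum_jost_le p'.absSum_jost_le, p.jost_eq z x, p'.jost_eq z x, h1]
  abel

theorem absSum_sub_le (p q : ℂ × ℂ) : absSum (p - q) ≤ absSum p + absSum q := by
  rw [sub_eq_add_neg, ← absSum_neg q]
  exact absSum_add_le _ _

theorem measurable_sub_uncurry {Y Y' : ℝ → ℝ → ℂ × ℂ} (hY : Measurable (Function.uncurry Y))
    (hY' : Measurable (Function.uncurry Y')) : Measurable (Function.uncurry (Y - Y')) :=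
  hY.sub hY'

theorem IsPotential.absSum_jost_sub_le_bound (p : IsPotential M a b) (p' : IsPotential M a' b')
    (z x : ℝ) : absSum (jost a b z x - jost a' b' z x) ≤ jostBound M + jostBound M :=
  (absSum_sub_le _ _).trans (add_le_add (p.absSum_jost_le z x) (p'.absSum_jost_le z x))

/-- The solutions depend on the coefficients in `L¹` in a uniformly Lipschitz way. -/
theorem IsPotential.absSum_jost_sub_le (p : IsPotential M a b) (p' : IsPotential M a' b')
    (z x : ℝ) : absSum (jost a b z x - jost a' b' z x) ≤
      gronConst M * jostBound M * ∫⁻ y, (‖a y - a' y‖ₑ + ‖b y - b' y‖ₑ) := by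
  set D := ∫⁻ y, (‖a y - a' y‖ₑ + ‖b y - b' y‖ₑ)
  have hJ := measurable_sub_uncurry p.measurable_jost p'.measurable_jost
  have hmv : Measurable fun y => ‖a y - a' y‖ₑ + ‖b y - b' y‖ₑ :=
    (p.meas_a.sub p'.meas_a).enorm.add (p.meas_b.sub p'.meas_b).enorm
  have hF : ∀ x, absSum (source (a - a') (b - b') (jost a b) z x) ≤ jostBound M * D := fun x =>
    calc _ ≤ _ := absSum_source_le' (p.meas_a.sub p'.meas_a) p.measurable_jost z x
      _ ≤ ∫⁻ y, (‖a y - a' y‖ₑ + ‖b y - b' y‖ₑ) * jostBound M := by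
          refine (setLIntegral_le_lintegral _ _).trans (lintegral_mono fun y => ?_)
          simp only [Pi.sub_apply]
          gcongr
          exact p.absSum_jost_le z y
      _ = _ := by rw [lintegral_mul_const _ hmv, mul_comm]
  have hvt : ∫⁻ y, (‖a' y‖ₑ + ‖b' y‖ₑ) ≠ ⊤ := ne_top_of_le_ne_top ENNReal.coe_ne_top p'.le
  refine (le_add_of_le_add_lintegral (r := fun x => absSum (jost a b z x - jost a' b' z x))
    (f := fun _ => jostBound M * D) p'.meas_v hvt measurable_const
    (ENNReal.add_ne_top.2 ⟨jostBound_ne_top M, jostBound_ne_top M⟩)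
    (p.absSum_jost_sub_le_bound p' z) (fun x => ?_) x).trans ?_
  · rw [p.jost_sub p' z x]
    exact (absSum_add_le _ _).trans (add_le_add (hF x) (absSum_source_le' p'.meas_a hJ z x))
  · rw [lintegral_mul_const _ p'.meas_v]
    calc _ ≤ jostBound M * D + 2 * ENNReal.ofReal (Real.exp (2 * M)) * (M * (jostBound M * D)) := by
          gcongr
          · exact gronWeight_le p'.le x
          · exact (setLIntegral_le_lintegral _ _).trans p'.le
      _ = _ := by rw [gronConst]; ring

theorem eLpNorm_add_le_two {f g : ℝ → ℝ≥0∞} (hf : Measurable f) (hg : Measurable g) :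
    eLpNorm (fun z => f z + g z) 2 volume ≤ eLpNorm f 2 volume + eLpNorm g 2 volume :=
  eLpNorm_add_le hf.aestronglyMeasurable hg.aestronglyMeasurable one_le_two

theorem enorm_mul_phase_mul_le (c : ℂ) (s z y : ℝ) {w : ℂ} {C : ℝ≥0∞} (h : ‖w‖ₑ ≤ C) :
    ‖c * phase s z y * w‖ₑ ≤ ‖c‖ₑ * C := by
  rw [enorm_mul, enorm_mul, enorm_phase, mul_one]
  gcongr

theorem IsPotential.measurable_fst_density (p : IsPotential M a b) :
    Measurable (Function.uncurry fun z y => a y * phase 1 z y * (jost a b z y).2) := by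
  have h := measurable_snd.comp p.measurable_jost
  have ha := p.meas_a
  simp only [Function.uncurry_def, Function.comp_def] at h ⊢
  fun_prop

theorem IsPotential.measurable_snd_density (p : IsPotential M a b) :
    Measurable (Function.uncurry fun z y => b y * phase (-1) z y * (jost a b z y).1) := by
  have h := measurable_fst.comp p.measurable_jost
  have hb := p.meas_b
  simp only [Function.uncurry_def, Function.comp_def] at h ⊢
  fun_prop

theorem IsPotential.integrable_fst_density (p : IsPotential M a b) (z : ℝ) :
    Integrable fun y => a y * phase 1 z y * (jost a b z y).2 :=
  integrable_mul_phase_mul p.integrable_a (measurable_snd.comp (p.measurable_jost_left z))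
    (jostBound_ne_top M) (fun y => (enorm_snd_le_absSum _).trans (p.absSum_jost_le z y)) 1 z

theorem IsPotential.integrable_snd_density (p : IsPotential M a b) (z : ℝ) :
    Integrable fun y => b y * phase (-1) z y * (jost a b z y).1 :=
  integrable_mul_phase_mul p.integrable_b (measurable_fst.comp (p.measurable_jost_left z))
    (jostBound_ne_top M) (fun y => (enorm_fst_le_absSum _).trans (p.absSum_jost_le z y)) (-1) z

/-- The Jost solution starts from (1, 0), so no L² bound in z is to be expected of the solution
itself. But its variation in x is bounded by M times its supremum bound, uniformly in z, and the
square integrability is taken from f and g. -/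
theorem IsPotential.eLpNorm_source_jost_le (p : IsPotential M a b) {f g : ℝ → ℂ}
    (hf : Measurable f) (hg : Measurable g) (hf1 : Integrable f) (hg1 : Integrable g) (x : ℝ) :
    eLpNorm (fun z => absSum (source f g (jost a b) z x)) 2 volume ≤
      2 * (1 + M * jostBound M) * (eLpNorm f 2 volume + eLpNorm g 2 volume) := by
  have hgt : ∫⁻ y, (‖a y‖ₑ + ‖b y‖ₑ) * jostBound M ≤ M * jostBound M := by
    rw [lintegral_mul_const _ p.meas_v]
    gcongr
    exact p.le
  refine (eLpNorm_source_le_of_variation hf hg hf1 hg1 (c := (1, 0)) p.measurable_fst_density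
    p.measurable_snd_density (p.meas_v.mul_const (jostBound M))
    (ne_top_of_le_ne_top (ENNReal.mul_ne_top (by simp) (jostBound_ne_top M)) hgt)
    (fun z y => ?_) (fun z y => ?_) p.jost_fst p.jost_snd x).trans ?_
  · exact (enorm_mul_phase_mul_le _ _ _ _ ((enorm_snd_le_absSum _).trans
      (p.absSum_jost_le z y))).trans (by gcongr; exact le_self_add)
  · exact (enorm_mul_phase_mul_le _ _ _ _ ((enorm_fst_le_absSum _).trans
      (p.absSum_jost_le z y))).trans (by gcongr; exact le_add_self)
  · have : absSum ((1 : ℂ), (0 : ℂ)) = 1 := by simp [absSum]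
    rw [this]
    calc _ ≤ 2 * (eLpNorm f 2 volume + eLpNorm g 2 volume) * (1 + M * jostBound M) := by gcongr
      _ = _ := by ring

/-- Lipschitz dependence of the solutions, in `L²` of the spectral parameter, on the coefficients
in `L²`. -/
theorem IsPotential.eLpNorm_jost_sub_le (p : IsPotential M a b) (p' : IsPotential M a' b')
    (x : ℝ) : eLpNorm (fun z => absSum (jost a b z x - jost a' b' z x)) 2 volume ≤
      lipConst M * (eLpNorm (a - a') 2 volume + eLpNorm (b - b') 2 volume) := by
  have hJ := measurable_sub_uncurry p.measurable_jost p'.measurable_jost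
  have hs := measurable_source (p.meas_a.sub p'.meas_a) (p.meas_b.sub p'.meas_b) p.measurable_jost
  refine (eLpNorm_gronwall (r := fun z x => absSum (jost a b z x - jost a' b' z x))
    (F := fun z x => absSum (source (a - a') (b - b') (jost a b) z x)) p'.meas_v p'.le
    (measurable_absSum.comp hs)
    (ENNReal.add_ne_top.2 ⟨jostBound_ne_top M, jostBound_ne_top M⟩)
    (p.absSum_jost_sub_le_bound p') (fun z x => ?_)
    (p.eLpNorm_source_jost_le (p.meas_a.sub p'.meas_a) (p.meas_b.sub p'.meas_b)
      (p.integrable_a.sub p'.integrable_a) (p.integrable_b.sub p'.integrable_b)) x).trans_eq ?_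
  · rw [p.jost_sub p' z x]
    exact (absSum_add_le _ _).trans (add_le_add le_rfl (absSum_source_le' p'.meas_a hJ z x))
  · rw [lipConst, gronConst]; ring

end

/-! ### Second differences of four solutions -/

section

variable {M : ℝ≥0} {a₁ b₁ a₂ b₂ a₃ b₃ a₄ b₄ : ℝ → ℂ}

/-- The difference of two solutions starts from zero and its variation in x is of the order of the
L¹ distance of the coefficients. The result is a product: the L² norm of f and g times that
distance. -/
theorem IsPotential.eLpNorm_source_jost_sub_le (p₁ : IsPotential M a₁ b₁)
    (p₃ : IsPotential M a₃ b₃) {f g : ℝ → ℂ} (hf : Measurable f) (hg : Measurable g)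
    (hf1 : Integrable f) (hg1 : Integrable g) (x : ℝ) :
    eLpNorm (fun z => absSum (source f g (jost a₁ b₁ - jost a₃ b₃) z x)) 2 volume ≤
      2 * (eLpNorm f 2 volume + eLpNorm g 2 volume) * ((jostBound M + M * (gronConst M * jostBound M)) *
        ∫⁻ y, (‖a₁ y - a₃ y‖ₑ + ‖b₁ y - b₃ y‖ₑ)) := by
  set D := ∫⁻ y, (‖a₁ y - a₃ y‖ₑ + ‖b₁ y - b₃ y‖ₑ) with hD
  have hmv : Measurable fun y => ‖a₁ y - a₃ y‖ₑ + ‖b₁ y - b₃ y‖ₑ :=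
    (p₁.meas_a.sub p₃.meas_a).enorm.add (p₁.meas_b.sub p₃.meas_b).enorm
  have hDt : D ≠ ⊤ := by
    have : D ≤ (∫⁻ y, (‖a₁ y‖ₑ + ‖b₁ y‖ₑ)) + ∫⁻ y, (‖a₃ y‖ₑ + ‖b₃ y‖ₑ) := by
      rw [← lintegral_add_left p₁.meas_v]
      refine lintegral_mono fun y => ?_
      calc _ ≤ (‖a₁ y‖ₑ + ‖a₃ y‖ₑ) + (‖b₁ y‖ₑ + ‖b₃ y‖ₑ) := by
            gcongr <;> exact enorm_sub_le
        _ = _ := by ring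
    exact ne_top_of_le_ne_top (ENNReal.add_ne_top.2
      ⟨ne_top_of_le_ne_top ENNReal.coe_ne_top p₁.le, ne_top_of_le_ne_top ENNReal.coe_ne_top p₃.le⟩)
      this
  set G := gronConst M * jostBound M * D with hG
  have hGt : G ≠ ⊤ :=
    ENNReal.mul_ne_top (ENNReal.mul_ne_top (gronConst_ne_top M) (jostBound_ne_top M)) hDt
  have hint : ∫⁻ y, ((‖a₁ y - a₃ y‖ₑ + ‖b₁ y - b₃ y‖ₑ) * jostBound M + (‖a₃ y‖ₑ + ‖b₃ y‖ₑ) * G) ≤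
      (jostBound M + M * (gronConst M * jostBound M)) * D := by
    rw [lintegral_add_left (hmv.mul_const _), lintegral_mul_const _ hmv,
      lintegral_mul_const _ p₃.meas_v]
    calc _ ≤ D * jostBound M + M * G := by gcongr; exact p₃.le
      _ = _ := by rw [hG]; ring
  -- The density of the difference changes through the coefficient or through the solution; the
  -- latter change is at most G.
  have hsplit : ∀ (f f' : ℝ → ℂ) (s z y : ℝ) (w w' : ℂ), f y * phase s z y * w - f' y * phase s z y * w'
      = (f y - f' y) * phase s z y * w + f' y * phase s z y * (w - w') := fun _ _ _ _ _ _ _ => by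
    ring
  have hJ1 : ∀ z y, absSum (jost a₁ b₁ z y) ≤ jostBound M := p₁.absSum_jost_le
  have hJ13 : ∀ z y, absSum (jost a₁ b₁ z y - jost a₃ b₃ z y) ≤ G := p₁.absSum_jost_sub_le p₃
  refine (eLpNorm_source_le_of_variation hf hg hf1 hg1 (c := (0, 0))
    (Y := jost a₁ b₁ - jost a₃ b₃)
    (g := fun y => (‖a₁ y - a₃ y‖ₑ + ‖b₁ y - b₃ y‖ₑ) * jostBound M + (‖a₃ y‖ₑ + ‖b₃ y‖ₑ) * G)
    (p₁.measurable_fst_density.sub p₃.measurable_fst_density :)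
    (p₁.measurable_snd_density.sub p₃.measurable_snd_density :)
    ((hmv.mul_const (jostBound M)).add (p₃.meas_v.mul_const G))
    (ne_top_of_le_ne_top (ENNReal.mul_ne_top (ENNReal.add_ne_top.2 ⟨jostBound_ne_top M,
      ENNReal.mul_ne_top (by simp) (ENNReal.mul_ne_top (gronConst_ne_top M) (jostBound_ne_top M))⟩)
      hDt) hint)
    (m₁ := fun z y => a₁ y * phase 1 z y * (jost a₁ b₁ z y).2 -
      a₃ y * phase 1 z y * (jost a₃ b₃ z y).2)
    (m₂ := fun z y => b₁ y * phase (-1) z y * (jost a₁ b₁ z y).1 -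
      b₃ y * phase (-1) z y * (jost a₃ b₃ z y).1)
    (fun z y => ?_) (fun z y => ?_) (fun z x => ?_) (fun z x => ?_) x).trans ?_
  · rw [hsplit a₁ a₃]
    refine (enorm_add_le _ _).trans (add_le_add ?_ ?_)
    · refine (enorm_mul_phase_mul_le _ _ _ _ ((enorm_snd_le_absSum _).trans (hJ1 z y))).trans ?_
      gcongr
      exact le_self_add
    · refine (enorm_mul_phase_mul_le _ _ _ _ ((enorm_snd_le_absSum (_ - _)).trans
        (hJ13 z y))).trans ?_
      gcongr
      exact le_self_add
  · rw [hsplit b₁ b₃]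
    refine (enorm_add_le _ _).trans (add_le_add ?_ ?_)
    · refine (enorm_mul_phase_mul_le _ _ _ _ ((enorm_fst_le_absSum _).trans (hJ1 z y))).trans ?_
      gcongr
      exact le_add_self
    · refine (enorm_mul_phase_mul_le _ _ _ _ ((enorm_fst_le_absSum (_ - _)).trans
        (hJ13 z y))).trans ?_
      gcongr
      exact le_add_self
  · simp only [Pi.sub_apply, Prod.fst_sub]
    rw [integral_sub (p₁.integrable_fst_density z).integrableOn
      (p₃.integrable_fst_density z).integrableOn, p₁.jost_fst, p₃.jost_fst]
    ring
  · simp only [Pi.sub_apply, Prod.snd_sub]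
    rw [integral_sub (p₁.integrable_snd_density z).integrableOn
      (p₃.integrable_snd_density z).integrableOn, p₁.jost_snd, p₃.jost_snd]
    ring
  · have : absSum ((0 : ℂ), (0 : ℂ)) = 0 := by simp [absSum]
    rw [this, zero_add]
    gcongr

/-- Expanding bilinearly, every source contains either the second difference of the coefficients or
a product of two first differences, one between the pairs (1,2), (3,4) and one between (1,3), (2,4).
In the applications the former are small with a shift and the latter with the distance of two
potentials. -/
theorem IsPotential.jost_second_difference (p₁ : IsPotential M a₁ b₁) (p₂ : IsPotential M a₂ b₂)
    (p₃ : IsPotential M a₃ b₃) (p₄ : IsPotential M a₄ b₄) (z x : ℝ) :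
    (jost a₁ b₁ - jost a₂ b₂ - (jost a₃ b₃ - jost a₄ b₄)) z x =
      (source (a₁ - a₂ - (a₃ - a₄)) (b₁ - b₂ - (b₃ - b₄)) (jost a₁ b₁) z x +
        source (a₃ - a₄) (b₃ - b₄) (jost a₁ b₁ - jost a₃ b₃) z x +
        source (a₂ - a₄) (b₂ - b₄) (jost a₁ b₁ - jost a₂ b₂) z x) +
      source a₄ b₄ (jost a₁ b₁ - jost a₂ b₂ - (jost a₃ b₃ - jost a₄ b₄)) z x := by
  have hB := jostBound_ne_top M
  have hBB : jostBound M + jostBound M ≠ ⊤ := ENNReal.add_ne_top.2 ⟨hB, hB⟩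
  have h12 := measurable_sub_uncurry p₁.measurable_jost p₂.measurable_jost
  have h34 := measurable_sub_uncurry p₃.measurable_jost p₄.measurable_jost
  have ia := p₁.integrable_a.sub p₂.integrable_a
  have ib := p₁.integrable_b.sub p₂.integrable_b
  have ia' := p₃.integrable_a.sub p₄.integrable_a
  have ib' := p₃.integrable_b.sub p₄.integrable_b
  have e1 := source_add_left (ia.sub ia') (ib.sub ib') ia' ib' p₁.measurable_jost hB
    p₁.absSum_jost_le z x
  rw [sub_add_cancel, sub_add_cancel] at e1
  have e2 := source_sub_right ia' ib' p₁.measurable_jost p₃.measurable_jost hB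
    p₁.absSum_jost_le p₃.absSum_jost_le z x
  have e3 := source_add_left (p₂.integrable_a.sub p₄.integrable_a)
    (p₂.integrable_b.sub p₄.integrable_b) p₄.integrable_a p₄.integrable_b h12 hBB
    (p₁.absSum_jost_sub_le_bound p₂) z x
  rw [sub_add_cancel, sub_add_cancel] at e3
  have e4 := source_sub_right p₄.integrable_a p₄.integrable_b h12 h34 hBB
    (p₁.absSum_jost_sub_le_bound p₂) (p₃.absSum_jost_sub_le_bound p₄) z x
  have d12 := p₁.jost_sub p₂ z x
  have d34 := p₃.jost_sub p₄ z x
  simp only [Pi.sub_apply] at d12 d34 ⊢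
  rw [d12, d34, e1, e2, e3, e4]
  abel

/-- The constant in the estimate of second differences of solutions of systems of mass `M`. -/
noncomputable def secondConst (M : ℝ≥0) : ℝ≥0∞ :=
  (2 * (1 + M * jostBound M) + 2 * (jostBound M + M * (gronConst M * jostBound M)) + lipConst M) *
    gronConst M

theorem secondConst_ne_top (M : ℝ≥0) : secondConst M ≠ ⊤ := by
  have h1 := jostBound_ne_top M
  have h2 := gronConst_ne_top M
  have h3 := lipConst_ne_top M
  simp [secondConst, ENNReal.mul_eq_top, h1, h2, h3]

/-- The first two sources have their L² factor in the coefficients and a factor of bounded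
variation, so Plancherel applies. In the third the solutions differ in L² of z already, and
Minkowski's inequality suffices with the coefficients in L¹. -/
theorem IsPotential.eLpNorm_jost_second_difference_le (p₁ : IsPotential M a₁ b₁)
    (p₂ : IsPotential M a₂ b₂) (p₃ : IsPotential M a₃ b₃) (p₄ : IsPotential M a₄ b₄) (x : ℝ) :
    eLpNorm (fun z => absSum ((jost a₁ b₁ - jost a₂ b₂ - (jost a₃ b₃ - jost a₄ b₄)) z x)) 2 volume ≤
      secondConst M *
      ((eLpNorm (a₁ - a₂ - (a₃ - a₄)) 2 volume + eLpNorm (b₁ - b₂ - (b₃ - b₄)) 2 volume) +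
        (eLpNorm (a₃ - a₄) 2 volume + eLpNorm (b₃ - b₄) 2 volume) *
          (∫⁻ y, (‖a₁ y - a₃ y‖ₑ + ‖b₁ y - b₃ y‖ₑ)) +
        (eLpNorm (a₁ - a₂) 2 volume + eLpNorm (b₁ - b₂) 2 volume) *
          ∫⁻ y, (‖a₂ y - a₄ y‖ₑ + ‖b₂ y - b₄ y‖ₑ)) := by
  have hB := jostBound_ne_top M
  have h12 := measurable_sub_uncurry p₁.measurable_jost p₂.measurable_jost
  have h13 := measurable_sub_uncurry p₁.measurable_jost p₃.measurable_jost
  have h34 := measurable_sub_uncurry p₃.measurable_jost p₄.measurable_jost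
  have hE := measurable_sub_uncurry h12 h34
  have m12 := p₁.meas_a.sub p₂.meas_a
  have n12 := p₁.meas_b.sub p₂.meas_b
  have m34 := p₃.meas_a.sub p₄.meas_a
  have n34 := p₃.meas_b.sub p₄.meas_b
  have m24 := p₂.meas_a.sub p₄.meas_a
  have n24 := p₂.meas_b.sub p₄.meas_b
  have ia := p₁.integrable_a.sub p₂.integrable_a
  have ib := p₁.integrable_b.sub p₂.integrable_b
  have ia' := p₃.integrable_a.sub p₄.integrable_a
  have ib' := p₃.integrable_b.sub p₄.integrable_b
  set S1 := source (a₁ - a₂ - (a₃ - a₄)) (b₁ - b₂ - (b₃ - b₄)) (jost a₁ b₁)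
  set S2 := source (a₃ - a₄) (b₃ - b₄) (jost a₁ b₁ - jost a₃ b₃)
  set S3 := source (a₂ - a₄) (b₂ - b₄) (jost a₁ b₁ - jost a₂ b₂)
  have s1 : Measurable (Function.uncurry S1) :=
    measurable_source (m12.sub m34) (n12.sub n34) p₁.measurable_jost
  have s2 : Measurable (Function.uncurry S2) := measurable_source m34 n34 h13
  have s3 : Measurable (Function.uncurry S3) := measurable_source m24 n24 h12
  have t1 := measurable_absSum.comp s1
  have t2 := measurable_absSum.comp s2
  have t3 := measurable_absSum.comp s3
  refine (eLpNorm_gronwall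
    (r := fun z x => absSum ((jost a₁ b₁ - jost a₂ b₂ - (jost a₃ b₃ - jost a₄ b₄)) z x))
    (F := fun z x => absSum (S1 z x) + absSum (S2 z x) + absSum (S3 z x)) p₄.meas_v p₄.le
    ((t1.add t2).add t3)
    (C := (jostBound M + jostBound M) + (jostBound M + jostBound M)) (by simp [hB])
    (fun z x => (absSum_sub_le _ _).trans (add_le_add (p₁.absSum_jost_sub_le_bound p₂ z x)
      (p₃.absSum_jost_sub_le_bound p₄ z x)))
    (fun z x => ?_) (ρ := 2 * (1 + M * jostBound M) *
      (eLpNorm (a₁ - a₂ - (a₃ - a₄)) 2 volume + eLpNorm (b₁ - b₂ - (b₃ - b₄)) 2 volume) +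
      2 * (eLpNorm (a₃ - a₄) 2 volume + eLpNorm (b₃ - b₄) 2 volume) *
        ((jostBound M + M * (gronConst M * jostBound M)) *
          ∫⁻ y, (‖a₁ y - a₃ y‖ₑ + ‖b₁ y - b₃ y‖ₑ)) +
      lipConst M * (eLpNorm (a₁ - a₂) 2 volume + eLpNorm (b₁ - b₂) 2 volume) *
        ∫⁻ y, (‖a₂ y - a₄ y‖ₑ + ‖b₂ y - b₄ y‖ₑ)) (fun x => ?_) x).trans ?_
  · have e := p₁.jost_second_difference p₂ p₃ p₄ z x
    calc _ = absSum (S1 z x + S2 z x + S3 z x +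
          source a₄ b₄ (jost a₁ b₁ - jost a₂ b₂ - (jost a₃ b₃ - jost a₄ b₄)) z x) := by rw [e]
      _ ≤ absSum (S1 z x) + absSum (S2 z x) + absSum (S3 z x) + _ :=
          (absSum_add_le _ _).trans (add_le_add ((absSum_add_le _ _).trans
            (add_le_add (absSum_add_le _ _) le_rfl)) (absSum_source_le' p₄.meas_a hE z x))
  · have hx : ∀ {g : ℝ × ℝ → ℝ≥0∞}, Measurable g → Measurable fun z => g (z, x) :=
      fun hg => hg.comp measurable_prodMk_right
    refine (eLpNorm_add_le_two ((hx t1).add (hx t2)) (hx t3)).trans (add_le_add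
      ((eLpNorm_add_le_two (hx t1) (hx t2)).trans (add_le_add ?_ ?_)) ?_)
    · exact p₁.eLpNorm_source_jost_le (m12.sub m34) (n12.sub n34) (ia.sub ia') (ib.sub ib') x
    · exact p₁.eLpNorm_source_jost_sub_le p₃ m34 n34 ia' ib' x
    · exact eLpNorm_source_le_of_eLpNorm_le m24 n24 h12 (p₁.eLpNorm_jost_sub_le p₂) x
  · rw [secondConst, ← gronConst]
    set n1 := eLpNorm (a₁ - a₂ - (a₃ - a₄)) 2 volume + eLpNorm (b₁ - b₂ - (b₃ - b₄)) 2 volume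
    set X := (eLpNorm (a₃ - a₄) 2 volume + eLpNorm (b₃ - b₄) 2 volume) *
          (∫⁻ y, (‖a₁ y - a₃ y‖ₑ + ‖b₁ y - b₃ y‖ₑ)) with hX
    set Z := (eLpNorm (a₁ - a₂) 2 volume + eLpNorm (b₁ - b₂) 2 volume) *
          ∫⁻ y, (‖a₂ y - a₄ y‖ₑ + ‖b₂ y - b₄ y‖ₑ) with hZ
    set k1 := 2 * (1 + M * jostBound M)
    set k2 := jostBound M + M * (gronConst M * jostBound M)
    set k3 := lipConst M
    have key : k1 * n1 + 2 * k2 * X + k3 * Z ≤ (k1 + 2 * k2 + k3) * (n1 + X + Z) := by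
      rw [mul_add (_ + _) (n1 + X) Z, mul_add (_ + _) n1 X]
      exact add_le_add (add_le_add (mul_le_mul_left (le_self_add.trans le_self_add) _)
        (mul_le_mul_left (le_add_self.trans le_self_add) _)) (mul_le_mul_left le_add_self _)
    calc _ = (k1 * n1 + 2 * k2 * X + k3 * Z) * gronConst M := by rw [hX, hZ, gronConst]; ring
      _ ≤ (k1 + 2 * k2 + k3) * (n1 + X + Z) * gronConst M := by gcongr
      _ = _ := by ring

end

/-! ### Limits at infinity -/

section

variable {M : ℝ≥0} {a b a' b' : ℝ → ℂ}

/-- The limit of the solution at `+∞`. -/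
noncomputable def jostInf (a b : ℝ → ℂ) (z : ℝ) : ℂ × ℂ :=
  (1 + ∫ y, a y * phase 1 z y * (jost a b z y).2, ∫ y, b y * phase (-1) z y * (jost a b z y).1)

theorem tendsto_integral_Iic_atTop {f : ℝ → ℂ} (hf : Integrable f) :
    Tendsto (fun x => ∫ y in Iic x, f y) atTop (𝓝 (∫ y, f y)) := by
  exact (aecover_Iic (μ := (volume : Measure ℝ)) (b := fun x : ℝ => x)
    tendsto_id).integral_tendsto_of_countably_generated hf

theorem measurable_section {α : Type*} [MeasurableSpace α] {Y : ℝ → ℝ → α}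
    (hY : Measurable (Function.uncurry Y)) (x : ℝ) : Measurable fun z => Y z x :=
  hY.comp (measurable_prodMk_right (y := x))

theorem IsPotential.tendsto_jost (p : IsPotential M a b) (z : ℝ) :
    Tendsto (jost a b z) atTop (𝓝 (jostInf a b z)) := by
  have h1 := (tendsto_integral_Iic_atTop (p.integrable_fst_density z)).const_add 1
  have h2 := tendsto_integral_Iic_atTop (p.integrable_snd_density z)
  refine (h1.prodMk_nhds h2).congr fun x => ?_
  rw [p.jost_eq z x]
  ext <;> simp [source]

theorem IsPotential.measurable_jostInf (p : IsPotential M a b) : Measurable (jostInf a b) := by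
  refine measurable_of_tendsto_metrizable (f := fun (n : ℕ) z => jost a b z n) (fun n => ?_)
    (tendsto_pi_nhds.2 fun z => (p.tendsto_jost z).comp tendsto_natCast_atTop_atTop)
  exact measurable_section p.measurable_jost n

theorem continuous_absSum : Continuous absSum := by
  unfold absSum; fun_prop

theorem IsPotential.eLpNorm_jostInf_sub_le (p : IsPotential M a b) (p' : IsPotential M a' b') :
    eLpNorm (fun z => absSum (jostInf a b z - jostInf a' b' z)) 2 volume ≤
      lipConst M * (eLpNorm (a - a') 2 volume + eLpNorm (b - b') 2 volume) := by
  refine eLpNorm_two_le_of_tendsto (G := fun n z => absSum (jost a b z n - jost a' b' z n))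
    (fun n => ?_) (fun z => ?_) (fun n => p.eLpNorm_jost_sub_le p' n)
  · exact measurable_absSum.comp ((measurable_section p.measurable_jost n).sub
      (measurable_section p'.measurable_jost n))
  · exact (continuous_absSum.tendsto _).comp (((p.tendsto_jost z).comp
      tendsto_natCast_atTop_atTop).sub ((p'.tendsto_jost z).comp tendsto_natCast_atTop_atTop))

theorem IsPotential.eLpNorm_jostInf_second_difference_le {a₁ b₁ a₂ b₂ a₃ b₃ a₄ b₄ : ℝ → ℂ}
    (p₁ : IsPotential M a₁ b₁)
    (p₂ : IsPotential M a₂ b₂) (p₃ : IsPotential M a₃ b₃) (p₄ : IsPotential M a₄ b₄) :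
    eLpNorm (fun z => absSum (jostInf a₁ b₁ z - jostInf a₂ b₂ z -
      (jostInf a₃ b₃ z - jostInf a₄ b₄ z))) 2 volume ≤
      secondConst M *
      ((eLpNorm (a₁ - a₂ - (a₃ - a₄)) 2 volume + eLpNorm (b₁ - b₂ - (b₃ - b₄)) 2 volume) +
        (eLpNorm (a₃ - a₄) 2 volume + eLpNorm (b₃ - b₄) 2 volume) *
          (∫⁻ y, (‖a₁ y - a₃ y‖ₑ + ‖b₁ y - b₃ y‖ₑ)) +
        (eLpNorm (a₁ - a₂) 2 volume + eLpNorm (b₁ - b₂) 2 volume) *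
          ∫⁻ y, (‖a₂ y - a₄ y‖ₑ + ‖b₂ y - b₄ y‖ₑ)) := by
  have hm : ∀ {a b : ℝ → ℂ}, IsPotential M a b → ∀ n : ℕ, Measurable fun z => jost a b z n :=
    fun p n => measurable_section p.measurable_jost n
  have ht : ∀ {a b : ℝ → ℂ}, IsPotential M a b → ∀ z,
      Tendsto (fun n : ℕ => jost a b z n) atTop (𝓝 (jostInf a b z)) :=
    fun p z => (p.tendsto_jost z).comp tendsto_natCast_atTop_atTop
  refine eLpNorm_two_le_of_tendsto (G := fun n z => absSum
    ((jost a₁ b₁ - jost a₂ b₂ - (jost a₃ b₃ - jost a₄ b₄)) z n))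
    (fun n => ?_) (fun z => ?_) (fun n => p₁.eLpNorm_jost_second_difference_le p₂ p₃ p₄ n)
  · exact measurable_absSum.comp (((hm p₁ n).sub (hm p₂ n)).sub ((hm p₃ n).sub (hm p₄ n)))
  · exact (continuous_absSum.tendsto _).comp
      (((ht p₁ z).sub (ht p₂ z)).sub ((ht p₃ z).sub (ht p₄ z)))

end

/-! ### The weighted space -/

theorem enorm_weighted (f : ℝ → ℂ) (x : ℝ) :
    ‖weighted f x‖ₑ = ENNReal.ofReal (Real.sqrt (1 + x ^ 2)) * ‖f x‖ₑ := by
  rw [weighted, enorm_mul, ← ofReal_norm, Complex.norm_real,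
    Real.norm_of_nonneg (Real.sqrt_nonneg _)]

theorem enorm_le_enorm_weighted (f : ℝ → ℂ) (x : ℝ) : ‖f x‖ₑ ≤ ‖weighted f x‖ₑ := by
  rw [enorm_weighted]
  refine le_mul_of_one_le_left' ?_
  rw [← ENNReal.ofReal_one]
  exact ENNReal.ofReal_le_ofReal (Real.one_le_sqrt.2 (by nlinarith [sq_nonneg x]))

theorem eLpNorm_le_normL21 (f : ℝ → ℂ) : eLpNorm f 2 volume ≤ normL21 f :=
  eLpNorm_mono_enorm (enorm_le_enorm_weighted f)

theorem abs_mul_enorm_le_enorm_weighted (f : ℝ → ℂ) (x : ℝ) : ‖x‖ₑ * ‖f x‖ₑ ≤ ‖weighted f x‖ₑ := by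
  rw [enorm_weighted, ← ofReal_norm]
  gcongr
  exact Real.abs_le_sqrt (by linarith)

/-- Cauchy-Schwarz against the reciprocal weight, with ∫(1+x²)⁻¹ dx = π ≤ 4 = 2². -/
theorem lintegral_enorm_le_normL21 {f : ℝ → ℂ} (hf : AEStronglyMeasurable f volume) :
    ∫⁻ x, ‖f x‖ₑ ≤ 2 * normL21 f := by
  have hw : AEMeasurable (fun x => ‖weighted f x‖ₑ) volume := by
    refine AEMeasurable.enorm (AEMeasurable.mul ?_ hf.aemeasurable)
    exact Measurable.aemeasurable (by fun_prop)
  have hwm : Measurable fun x : ℝ => ENNReal.ofReal (Real.sqrt (1 + x ^ 2))⁻¹ := by fun_prop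
  have hpos : ∀ x : ℝ, 0 < Real.sqrt (1 + x ^ 2) := fun x => Real.sqrt_pos.2 (by positivity)
  have e : ∀ x, ‖f x‖ₑ = ENNReal.ofReal (Real.sqrt (1 + x ^ 2))⁻¹ * ‖weighted f x‖ₑ := fun x => by
    rw [enorm_weighted, ← mul_assoc, ← ENNReal.ofReal_mul (inv_nonneg.2 (hpos x).le),
      inv_mul_cancel₀ (hpos x).ne', ENNReal.ofReal_one, one_mul]
  have h1 : ∫⁻ x : ℝ, ENNReal.ofReal (Real.sqrt (1 + x ^ 2))⁻¹ ^ 2 ≤ 4 := by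
    have : ∀ x : ℝ, ENNReal.ofReal (Real.sqrt (1 + x ^ 2))⁻¹ ^ 2 = ENNReal.ofReal (1 + x ^ 2)⁻¹ :=
      fun x => by
        rw [← ENNReal.ofReal_pow (inv_nonneg.2 (hpos x).le), inv_pow, Real.sq_sqrt (by positivity)]
    simp only [this]
    rw [← ofReal_integral_eq_lintegral_ofReal integrable_inv_one_add_sq
      (Eventually.of_forall fun x => by positivity), integral_univ_inv_one_add_sq]
    calc ENNReal.ofReal Real.pi ≤ ENNReal.ofReal 4 := ENNReal.ofReal_le_ofReal Real.pi_le_four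
      _ = 4 := by simp
  have h2 : ∫⁻ x, ‖weighted f x‖ₑ ^ 2 = normL21 f ^ 2 := by rw [normL21, eLpNorm_two_sq]
  refine (ENNReal.pow_right_strictMono two_ne_zero).le_iff_le.1 ?_
  simp only [e]
  calc _ ≤ _ := lintegral_mul_sq_le hwm.aemeasurable hw
    _ ≤ 4 * normL21 f ^ 2 := by rw [h2]; gcongr
    _ = _ := by ring

theorem norm_phase_sub_one_le (s h y : ℝ) : ‖phase s h y - 1‖ ≤ 2 * (|s| * |h| * |y|) := by
  have e : phase s h y = Complex.exp (Complex.I * ((2 * (s * h * y) : ℝ) : ℂ)) := by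
    rw [phase]; congr 1; push_cast; ring
  rw [e]
  refine (Real.norm_exp_I_mul_ofReal_sub_one_le).trans_eq ?_
  rw [Real.norm_eq_abs, abs_mul, abs_mul, abs_mul, abs_two]

/-- Multiplication with a phase. -/
noncomputable def twist (s h : ℝ) (f : ℝ → ℂ) : ℝ → ℂ := fun y => f y * phase s h y

/-- |e^{2ishy} - 1| ≤ 2|h||y|, and the weight of L^{2,1} pays for the factor |y|. -/
theorem eLpNorm_twist_sub_le {s : ℝ} (hs : |s| = 1) (h : ℝ) (f : ℝ → ℂ) :
    eLpNorm (twist s h f - f) 2 volume ≤ 2 * ‖h‖ₑ * normL21 f := by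
  have e : eLpNorm ((2 * h : ℝ) • weighted f) 2 volume = 2 * ‖h‖ₑ * normL21 f := by
    rw [eLpNorm_const_smul, enorm_mul, normL21]
    congr 2
    rw [← ofReal_norm]; simp
  rw [← e]
  refine eLpNorm_mono_enorm fun y => ?_
  rw [Pi.smul_apply, enorm_smul]
  have h1 : (twist s h f - f) y = (phase s h y - 1) * f y := by
    simp only [twist, Pi.sub_apply]; ring
  have h2 : ‖phase s h y - 1‖ₑ ≤ ‖2 * h‖ₑ * ‖y‖ₑ := by
    rw [← ofReal_norm, ← ofReal_norm, ← ofReal_norm, ← ENNReal.ofReal_mul (norm_nonneg _)]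
    refine ENNReal.ofReal_le_ofReal ((norm_phase_sub_one_le s h y).trans_eq ?_)
    rw [hs, Real.norm_eq_abs, Real.norm_eq_abs, abs_mul, abs_two]; ring
  rw [h1, enorm_mul]
  calc _ ≤ ‖2 * h‖ₑ * ‖y‖ₑ * ‖f y‖ₑ := by gcongr
    _ = ‖2 * h‖ₑ * (‖y‖ₑ * ‖f y‖ₑ) := by ring
    _ ≤ _ := by gcongr; exact abs_mul_enorm_le_enorm_weighted f y

theorem phase_add (s z h y : ℝ) : phase s (z + h) y = phase s h y * phase s z y := by
  rw [phase, phase, phase, ← Complex.exp_add]; congr 1; push_cast; ring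

theorem enorm_twist (s h : ℝ) (f : ℝ → ℂ) (y : ℝ) : ‖twist s h f y‖ₑ = ‖f y‖ₑ := by
  rw [twist, enorm_mul, enorm_phase, mul_one]

theorem twist_sub (s h : ℝ) (f g : ℝ → ℂ) : twist s h (f - g) = twist s h f - twist s h g := by
  ext y; simp only [twist, Pi.sub_apply]; ring

/-! ### Shifts of the spectral parameter -/

section

variable {M : ℝ≥0} {a b a' b' : ℝ → ℂ}

theorem IsPotential.twist (p : IsPotential M a b) (h : ℝ) :
    IsPotential M (twist 1 h a) (twist (-1) h b) where
  meas_a := p.meas_a.mul (by fun_prop)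
  meas_b := p.meas_b.mul (by fun_prop)
  le := by simp only [enorm_twist]; exact p.le

/-- The phase is multiplicative in z. Regularity in z is thereby reduced to dependence on the
coefficients. -/
theorem jost_shift (a b : ℝ → ℂ) (z h : ℝ) :
    jost a b (z + h) = jost (twist 1 h a) (twist (-1) h b) z := by
  unfold jost
  simp only [phase_add, twist, mul_assoc]

theorem jostInf_shift (a b : ℝ → ℂ) (z h : ℝ) :
    jostInf a b (z + h) = jostInf (twist 1 h a) (twist (-1) h b) z := by
  unfold jostInf
  simp only [jost_shift]
  simp only [phase_add, twist, mul_assoc]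

/-- A measurable function that is bounded by `K` in `L²` and Lipschitz continuous with constant
`K` in `L²` under translations. -/
structure H1Bound (K : ℝ≥0∞) (f : ℝ → ℂ) : Prop where
  meas : Measurable f
  le : eLpNorm f 2 volume ≤ K
  shift : ∀ h : ℝ, eLpNorm (fun z => f (z + h) - f z) 2 volume ≤ K * ‖h‖ₑ

theorem eLpNorm_fst_le (f : ℝ → ℂ × ℂ) :
    eLpNorm (fun z => (f z).1) 2 volume ≤ eLpNorm (fun z => absSum (f z)) 2 volume :=
  eLpNorm_mono_enorm fun z => by rw [enorm_eq_self]; exact enorm_fst_le_absSum _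

theorem eLpNorm_snd_le (f : ℝ → ℂ × ℂ) :
    eLpNorm (fun z => (f z).2) 2 volume ≤ eLpNorm (fun z => absSum (f z)) 2 volume :=
  eLpNorm_mono_enorm fun z => by rw [enorm_eq_self]; exact enorm_snd_le_absSum _

/-- The constant of the `H¹` estimate for the limits at infinity. -/
noncomputable def h1Const (R : ℝ≥0) : ℝ≥0∞ :=
  lipConst (2 * R) + secondConst (2 * R) * (2 + 8 * R)

theorem h1Const_ne_top (R : ℝ≥0) : h1Const R ≠ ⊤ := by
  have h1 := lipConst_ne_top (2 * R)
  have h2 := secondConst_ne_top (2 * R)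
  have h3 : (8 : ℝ≥0∞) * R ≠ ⊤ := ENNReal.mul_ne_top (by simp) (by simp)
  simp [h1Const, ENNReal.mul_eq_top, h1, h2, h3]

theorem isPotential_of_normL21_le (ha : Measurable a) (hb : Measurable b) {R : ℝ≥0}
    (h : normL21 a + normL21 b ≤ R) : IsPotential (2 * R) a b where
  meas_a := ha
  meas_b := hb
  le := by
    rw [lintegral_add_left ha.enorm]
    calc _ ≤ 2 * normL21 a + 2 * normL21 b :=
          add_le_add (lintegral_enorm_le_normL21 ha.aestronglyMeasurable)
            (lintegral_enorm_le_normL21 hb.aestronglyMeasurable)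
      _ = 2 * (normL21 a + normL21 b) := by ring
      _ ≤ _ := by push_cast; gcongr

theorem lintegral_sub_le_normL21 (ha : Measurable a) (hb : Measurable b) (ha' : Measurable a')
    (hb' : Measurable b') : ∫⁻ y, (‖a y - a' y‖ₑ + ‖b y - b' y‖ₑ) ≤
      2 * (normL21 (a - a') + normL21 (b - b')) := by
  refine (lintegral_add_left (ha.sub ha').enorm _).trans_le ?_
  rw [mul_add]
  exact add_le_add (lintegral_enorm_le_normL21 (ha.sub ha').aestronglyMeasurable)
    (lintegral_enorm_le_normL21 (hb.sub hb').aestronglyMeasurable)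

/-- The second difference estimate for the coefficients (a, b) and (a', b'), each with its twisted
version. Twisting does not change absolute values, so the distance between the two twisted pairs is
that of the original ones. -/
theorem eLpNorm_jostInf_shift_le (ha : Measurable a) (hb : Measurable b) (ha' : Measurable a')
    (hb' : Measurable b') {R : ℝ≥0} (h : normL21 a + normL21 b ≤ R)
    (h' : normL21 a' + normL21 b' ≤ R) (t : ℝ) :
    eLpNorm (fun z => absSum (jostInf a b (z + t) - jostInf a b z -
      (jostInf a' b' (z + t) - jostInf a' b' z))) 2 volume ≤
      secondConst (2 * R) * (2 + 8 * R) * (normL21 (a - a') + normL21 (b - b')) * ‖t‖ₑ := by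
  have p := isPotential_of_normL21_le ha hb h
  have p' := isPotential_of_normL21_le ha' hb' h'
  simp only [jostInf_shift]
  refine ((p.twist t).eLpNorm_jostInf_second_difference_le p (p'.twist t) p').trans ?_
  set D := normL21 (a - a') + normL21 (b - b') with hD
  have e1 : ∀ (s : ℝ) (f g : ℝ → ℂ), twist s t f - f - (twist s t g - g) =
      twist s t (f - g) - (f - g) := fun s f g => by rw [twist_sub]; abel
  have e2 : ∀ (s : ℝ) (f g : ℝ → ℂ) (y : ℝ), ‖twist s t f y - twist s t g y‖ₑ = ‖f y - g y‖ₑ :=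
    fun s f g y => by
      rw [← Pi.sub_apply, ← twist_sub, enorm_twist, Pi.sub_apply]
  simp only [e1, e2]
  have hI : ∫⁻ y, (‖a y - a' y‖ₑ + ‖b y - b' y‖ₑ) ≤ 2 * D := lintegral_sub_le_normL21 ha hb ha' hb'
  have k : ∀ f g : ℝ → ℂ, eLpNorm (twist 1 t f - f) 2 volume +
      eLpNorm (twist (-1) t g - g) 2 volume ≤ 2 * ‖t‖ₑ * (normL21 f + normL21 g) := fun f g => by
    rw [mul_add]
    exact add_le_add (eLpNorm_twist_sub_le (by simp) t f) (eLpNorm_twist_sub_le (by simp) t g)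
  -- The twisted second difference costs 2|t|D. Each product of first differences costs 2|t|R in L²
  -- times 2D in L¹; together this is 2 + 8R.
  calc _ ≤ secondConst (2 * R) * (2 * ‖t‖ₑ * D + 2 * ‖t‖ₑ * R * (2 * D) + 2 * ‖t‖ₑ * R * (2 * D)) := by
        gcongr
        · exact k _ _
        · exact (k _ _).trans (by gcongr)
        · exact (k _ _).trans (by gcongr)
    _ = _ := by ring

theorem h1Bound_jostInf (ha : Measurable a) (hb : Measurable b) (ha' : Measurable a')
    (hb' : Measurable b') {R : ℝ≥0} (h : normL21 a + normL21 b ≤ R)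
    (h' : normL21 a' + normL21 b' ≤ R) :
    H1Bound (h1Const R * (normL21 (a - a') + normL21 (b - b')))
      (fun z => (jostInf a b z).1 - (jostInf a' b' z).1) ∧
    H1Bound (h1Const R * (normL21 (a - a') + normL21 (b - b')))
      (fun z => (jostInf a b z).2 - (jostInf a' b' z).2) := by
  have p := isPotential_of_normL21_le ha hb h
  have p' := isPotential_of_normL21_le ha' hb' h'
  have hl : eLpNorm (fun z => absSum (jostInf a b z - jostInf a' b' z)) 2 volume ≤
      h1Const R * (normL21 (a - a') + normL21 (b - b')) := by
    refine (p.eLpNorm_jostInf_sub_le p').trans (mul_le_mul' le_self_add ?_)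
    exact add_le_add (eLpNorm_le_normL21 _) (eLpNorm_le_normL21 _)
  have hs : ∀ t : ℝ, eLpNorm (fun z => absSum (jostInf a b (z + t) - jostInf a b z -
      (jostInf a' b' (z + t) - jostInf a' b' z))) 2 volume ≤
      h1Const R * (normL21 (a - a') + normL21 (b - b')) * ‖t‖ₑ := fun t =>
    (eLpNorm_jostInf_shift_le ha hb ha' hb' h h' t).trans (by gcongr; exact le_add_self)
  have m1 := p.measurable_jostInf.fst.sub p'.measurable_jostInf.fst
  have m2 := p.measurable_jostInf.snd.sub p'.measurable_jostInf.snd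
  have l1 := (eLpNorm_fst_le fun z => jostInf a b z - jostInf a' b' z).trans hl
  have l2 := (eLpNorm_snd_le fun z => jostInf a b z - jostInf a' b' z).trans hl
  have s1 := fun t => (eLpNorm_fst_le fun z => jostInf a b (z + t) - jostInf a b z -
    (jostInf a' b' (z + t) - jostInf a' b' z)).trans (hs t)
  have s2 := fun t => (eLpNorm_snd_le fun z => jostInf a b (z + t) - jostInf a b z -
    (jostInf a' b' (z + t) - jostInf a' b' z)).trans (hs t)
  simp only [Prod.fst_sub, Prod.snd_sub] at l1 l2 s1 s2
  refine ⟨⟨m1, l1, fun t => ?_⟩, ⟨m2, l2, fun t => ?_⟩⟩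
  · refine le_of_eq_of_le ?_ (s1 t)
    congr 1; ext z; ring
  · refine le_of_eq_of_le ?_ (s2 t)
    congr 1; ext z; ring

/-! ### Translations of the potential -/

theorem IsPotential.translate (p : IsPotential M a b) (t : ℝ) :
    IsPotential M (fun y => a (y + t)) (fun y => b (y + t)) where
  meas_a := p.meas_a.comp (measurable_id.add_const t)
  meas_b := p.meas_b.comp (measurable_id.add_const t)
  le := by
    rw [lintegral_add_right_eq_self (fun y => ‖a y‖ₑ + ‖b y‖ₑ) t]
    exact p.le

theorem integral_Iic_comp_add_right (f : ℝ → ℂ) (x t : ℝ) :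
    ∫ y in Iic x, f (y + t) = ∫ y in Iic (x + t), f y := by
  have h := (measurePreserving_add_right (volume : Measure ℝ) t).setIntegral_preimage_emb
    (measurableEmbedding_addRight t) f (Iic (x + t))
  rw [← h]
  congr 2
  ext y; simp

theorem phase_add_right (s z y t : ℝ) : phase s z (y + t) = phase s z t * phase s z y := by
  rw [phase, phase, phase, ← Complex.exp_add]; congr 1; push_cast; ring

theorem phase_mul_phase_neg (z t : ℝ) : phase 1 z t * phase (-1) z t = 1 := by
  rw [phase, phase, ← Complex.exp_add, ← Complex.exp_zero]; congr 1; push_cast; ring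

/-- Translating the coefficients by t changes the phases by the constant e^{±2izt}. Multiplying the
second component by e^{2izt} repairs this, and uniqueness of the bounded solution identifies the two
sides. -/
theorem IsPotential.jost_translate (p : IsPotential M a b) (z t : ℝ) :
    (fun x => ((jost a b z (x + t)).1, phase 1 z t * (jost a b z (x + t)).2)) =
      jost (fun y => a (y + t)) (fun y => b (y + t)) z := by
  have hB : ∀ x, absSum ((jost a b z (x + t)).1, phase 1 z t * (jost a b z (x + t)).2) ≤
      jostBound M := fun x => by
    refine le_of_eq_of_le ?_ (p.absSum_jost_le z (x + t))
    simp only [absSum, enorm_mul, enorm_phase, one_mul]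
  have hm := (p.measurable_jost_left z).comp (measurable_id.add_const t)
  refine eq_voltSol ((p.translate t).kernel z)
    ((measurable_fst.comp hm).prodMk (measurable_const.mul (measurable_snd.comp hm)))
    (jostBound_ne_top M) hB fun x => ?_
  ext
  · simp only [volt]
    rw [p.jost_fst, ← integral_Iic_comp_add_right]
    congr 2; ext y
    rw [phase_add_right]; ring
  · simp only [volt]
    rw [p.jost_snd, ← integral_Iic_comp_add_right, zero_add, zero_add, ← integral_const_mul]
    congr 1; ext y
    rw [phase_add_right]
    linear_combination (b (y + t) * phase (-1) z y * (jost a b z (y + t)).1) * phase_mul_phase_neg z t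

/-- This exchanges translation of the coefficients for multiplication in z, hence smoothness for
decay. -/
theorem IsPotential.jostInf_translate (p : IsPotential M a b) (z t : ℝ) :
    jostInf (fun y => a (y + t)) (fun y => b (y + t)) z =
      ((jostInf a b z).1, phase 1 z t * (jostInf a b z).2) := by
  have h1 := (p.translate t).tendsto_jost z
  rw [← p.jost_translate z t] at h1
  have h2 := (p.tendsto_jost z).comp (tendsto_atTop_add_const_right atTop t tendsto_id)
  have h3 := ((continuous_fst.tendsto _).comp h2).prodMk_nhds
    (((continuous_snd.tendsto _).comp h2).const_mul (phase 1 z t))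
  exact tendsto_nhds_unique h1 h3

theorem tendsto_phase_slope (z : ℝ) :
    Tendsto (fun n : ℕ => (((n : ℂ) + 1) * (phase 1 z (1 / ((n : ℝ) + 1)) - 1))) atTop
      (𝓝 (2 * Complex.I * z)) := by
  have hd : HasDerivAt (fun t : ℝ => phase 1 z t) (2 * Complex.I * z) 0 := by
    have h1 : HasDerivAt (fun t : ℝ => 2 * Complex.I * ((1 : ℝ) * z) * (t : ℂ))
        (2 * Complex.I * ((1 : ℝ) * z) * 1) 0 :=
      (Complex.ofRealCLM.hasDerivAt (x := (0 : ℝ))).const_mul _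
    have := h1.cexp
    simpa [phase] using this
  have h1 := hd.tendsto_slope_zero
  have h2 : Tendsto (fun n : ℕ => 1 / ((n : ℝ) + 1)) atTop (𝓝[≠] 0) :=
    tendsto_nhdsWithin_iff.2 ⟨tendsto_one_div_add_atTop_nhds_zero_nat (𝕜 := ℝ),
      Eventually.of_forall fun n => by simp; positivity⟩
  refine (h1.comp h2).congr fun n => ?_
  have h0 : phase 1 z 0 = 1 := by simp [phase]
  simp only [Function.comp, zero_add, h0, one_div, inv_inv, Complex.real_smul]
  push_cast
  ring

/-- Smoothness of the coefficients yields decay of the limit at infinity in the spectral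
parameter. -/
theorem eLpNorm_mul_jostInf_snd_sub_le (ha : Measurable a) (hb : Measurable b)
    (ha' : Measurable a') (hb' : Measurable b') {R S : ℝ≥0} {E : ℝ≥0∞}
    (h : normL21 a + normL21 b ≤ R) (h' : normL21 a' + normL21 b' ≤ R)
    (hS : ∀ t : ℝ, eLpNorm ((fun y => a (y + t)) - a) 2 volume +
      eLpNorm ((fun y => b (y + t)) - b) 2 volume ≤ S * ‖t‖ₑ)
    (hS' : ∀ t : ℝ, eLpNorm ((fun y => a' (y + t)) - a') 2 volume +
      eLpNorm ((fun y => b' (y + t)) - b') 2 volume ≤ S * ‖t‖ₑ)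
    (hE : ∀ t : ℝ, eLpNorm ((fun y => (a - a') (y + t)) - (a - a')) 2 volume +
      eLpNorm ((fun y => (b - b') (y + t)) - (b - b')) 2 volume ≤ E * ‖t‖ₑ) :
    eLpNorm (fun z : ℝ => (z : ℂ) * ((jostInf a b z).2 - (jostInf a' b' z).2)) 2 volume ≤
      secondConst (2 * R) * (E + 4 * S * (normL21 (a - a') + normL21 (b - b'))) := by
  have p := isPotential_of_normL21_le ha hb h
  have p' := isPotential_of_normL21_le ha' hb' h'
  set D := normL21 (a - a') + normL21 (b - b')
  have hI : ∫⁻ y, (‖a y - a' y‖ₑ + ‖b y - b' y‖ₑ) ≤ 2 * D := lintegral_sub_le_normL21 ha hb ha' hb'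
  -- The left side is the second component of a second difference, taken over the two pairs of
  -- coefficients and their translates. Hence it is of order |t|.
  have key : ∀ t : ℝ, eLpNorm (fun z => (phase 1 z t - 1) *
      ((jostInf a b z).2 - (jostInf a' b' z).2)) 2 volume ≤
      secondConst (2 * R) * (E + 4 * S * D) * ‖t‖ₑ := fun t => by
    have h2 := (p.translate t).eLpNorm_jostInf_second_difference_le p (p'.translate t) p'
    have e0 : (fun z => (phase 1 z t - 1) * ((jostInf a b z).2 - (jostInf a' b' z).2)) =
        fun z => (jostInf (fun y => a (y + t)) (fun y => b (y + t)) z - jostInf a b z -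
          (jostInf (fun y => a' (y + t)) (fun y => b' (y + t)) z - jostInf a' b' z)).2 := by
      ext z
      rw [p.jostInf_translate, p'.jostInf_translate]
      simp only [Prod.snd_sub]; ring
    rw [e0]
    refine (eLpNorm_snd_le _).trans (h2.trans ?_)
    have e1 : ∀ f g : ℝ → ℂ, ((fun y => f (y + t)) - f) - ((fun y => g (y + t)) - g) =
        (fun y => (f - g) (y + t)) - (f - g) := fun f g => by
      ext y; simp only [Pi.sub_apply]; ring
    have e2 : ∫⁻ y, (‖a (y + t) - a' (y + t)‖ₑ + ‖b (y + t) - b' (y + t)‖ₑ) =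
        ∫⁻ y, (‖a y - a' y‖ₑ + ‖b y - b' y‖ₑ) :=
      lintegral_add_right_eq_self (fun y => ‖a y - a' y‖ₑ + ‖b y - b' y‖ₑ) t
    simp only [e1, e2]
    calc _ ≤ secondConst (2 * R) * (E * ‖t‖ₑ + S * ‖t‖ₑ * (2 * D) + S * ‖t‖ₑ * (2 * D)) := by
          gcongr
          · exact hE t
          · exact hS' t
          · exact hS t
      _ = _ := by ring
  have hm := measurable_snd.comp (p.measurable_jostInf.sub p'.measurable_jostInf)
  have hm' : Measurable fun z => (jostInf a b z).2 - (jostInf a' b' z).2 := hm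
  set B : ℝ → ℂ := fun z => (jostInf a b z).2 - (jostInf a' b' z).2 with hB
  -- Divide by t = 1/(n+1) and let n → ∞: the quotient (e^{2izt} - 1)/t tends to 2iz, and Fatou's
  -- lemma keeps the bound.
  have hlim : eLpNorm (fun z : ℝ => ‖2 * Complex.I * z * B z‖ₑ) 2 volume ≤
      secondConst (2 * R) * (E + 4 * S * D) := by
    refine eLpNorm_two_le_of_tendsto
      (G := fun n z => ‖((n : ℂ) + 1) * (phase 1 z (1 / ((n : ℝ) + 1)) - 1) * B z‖ₑ)
      (fun n => ?_) (fun z => ?_) (fun n => ?_)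
    · have hp : Measurable fun z => phase 1 z (1 / ((n : ℝ) + 1)) := by fun_prop
      exact ((measurable_const.mul (hp.sub_const 1)).mul hm').enorm
    · exact (continuous_enorm.tendsto _).comp ((tendsto_phase_slope z).mul_const (B z))
    · have e3 : (fun z => ((n : ℂ) + 1) * (phase 1 z (1 / ((n : ℝ) + 1)) - 1) * B z) =
          ((n : ℂ) + 1) • fun z => (phase 1 z (1 / ((n : ℝ) + 1)) - 1) * B z := by
        ext z; simp only [Pi.smul_apply, smul_eq_mul]; ring
      rw [eLpNorm_enorm, e3, eLpNorm_const_smul]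
      calc _ ≤ ‖(n : ℂ) + 1‖ₑ * (secondConst (2 * R) * (E + 4 * S * D) * ‖1 / ((n : ℝ) + 1)‖ₑ) := by
            gcongr; exact key _
        _ = secondConst (2 * R) * (E + 4 * S * D) * (‖(n : ℂ) + 1‖ₑ * ‖1 / ((n : ℝ) + 1)‖ₑ) := by
            ring
        _ = _ := by
            have hn : (0 : ℝ) < (n : ℝ) + 1 := by positivity
            have : ‖(n : ℂ) + 1‖ₑ = ‖(n : ℝ) + 1‖ₑ := by
              rw [← ofReal_norm, ← ofReal_norm, ← Complex.norm_real]; push_cast; rfl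
            rw [this, ← enorm_mul, mul_one_div_cancel hn.ne']; simp
  -- The factor |2i| ≥ 1 is discarded.
  refine le_trans (eLpNorm_mono_enorm fun z => ?_) hlim
  rw [enorm_enorm, mul_assoc, enorm_mul (2 * Complex.I)]
  refine le_mul_of_one_le_left' ?_
  rw [← ofReal_norm, ← ENNReal.ofReal_one]
  exact ENNReal.ofReal_le_ofReal (by simp)

end

/-! ### Locally absolutely continuous functions -/

/-- `F` is locally absolutely continuous with derivative `f`. -/
structure LocAC (F f : ℝ → ℂ) : Prop where
  locInt : LocallyIntegrable f volume
  sub_eq : ∀ x y : ℝ, F y - F x = ∫ t in x..y, f t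

namespace LocAC

variable {F G f g : ℝ → ℂ}

theorem intervalIntegrable (h : LocAC F f) (x y : ℝ) : IntervalIntegrable f volume x y :=
  (h.locInt.integrableOn_isCompact isCompact_uIcc).intervalIntegrable

theorem eq_add (h : LocAC F f) (x y : ℝ) : F y = F x + ∫ t in x..y, f t := by
  rw [← h.sub_eq]; ring

theorem ae_hasDerivAt (h : LocAC F f) : ∀ᵐ x, HasDerivAt F (f x) x := by
  filter_upwards [LocallyIntegrable.ae_hasDerivAt_integral h.locInt] with x hx
  refine ((hx 0).const_add (F 0)).congr_of_eventuallyEq (Eventually.of_forall fun y => ?_)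
  exact h.eq_add 0 y

theorem continuous (h : LocAC F f) : Continuous F := by
  have : F = fun y => F 0 + ∫ t in (0 : ℝ)..y, f t := funext (h.eq_add 0)
  rw [this]
  exact continuous_const.add (intervalIntegral.continuous_primitive h.intervalIntegrable 0)

theorem absolutelyContinuousOnInterval_const {E : Type*} [NormedAddCommGroup E] (c : E) (a b : ℝ) :
    AbsolutelyContinuousOnInterval (fun _ : ℝ => c) a b :=
  ((LipschitzWith.const c).lipschitzOnWith (s := uIcc a b)).absolutelyContinuousOnInterval

/-- The real and the imaginary part of the primitive are treated separately and then recombined. -/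
theorem absolutelyContinuousOnInterval (h : LocAC F f) (a b : ℝ) :
    AbsolutelyContinuousOnInterval F a b := by
  have hre : IntervalIntegrable (fun x => (f x).re) volume a b :=
    ⟨(h.intervalIntegrable a b).1.re, (h.intervalIntegrable a b).2.re⟩
  have him : IntervalIntegrable (fun x => (f x).im) volume a b :=
    ⟨(h.intervalIntegrable a b).1.im, (h.intervalIntegrable a b).2.im⟩
  have h1 := (hre.absolutelyContinuousOnInterval_intervalIntegral (c := a) (by simp)).smul
    (absolutelyContinuousOnInterval_const (1 : ℂ) a b)
  have h2 := (him.absolutelyContinuousOnInterval_intervalIntegral (c := a) (by simp)).smul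
    (absolutelyContinuousOnInterval_const Complex.I a b)
  have h3 := (absolutelyContinuousOnInterval_const (F a) a b).add (h1.add h2)
  refine cast (congrArg (fun H => AbsolutelyContinuousOnInterval H a b) (funext fun x => ?_)) h3
  have hi := h.intervalIntegrable a x
  have e := h.eq_add a x
  have e2 : ∫ t in a..x, f t = ((∫ t in a..x, (f t).re : ℝ) : ℂ) +
      ((∫ t in a..x, (f t).im : ℝ) : ℂ) * Complex.I := by
    rw [← intervalIntegral.integral_ofReal, ← intervalIntegral.integral_ofReal,
      ← intervalIntegral.integral_mul_const, ← intervalIntegral.integral_add]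
    · simp
    · exact ⟨hi.1.re.ofReal, hi.2.re.ofReal⟩
    · exact IntervalIntegrable.mul_const ⟨hi.1.im.ofReal, hi.2.im.ofReal⟩ _
  rw [e, e2]
  simp

/-- The difference of F and the primitive of f is absolutely continuous with zero derivative almost
everywhere, hence constant. The product rule below follows from this. -/
theorem of_absolutelyContinuous (hf : LocallyIntegrable f volume)
    (hF : ∀ a b, AbsolutelyContinuousOnInterval F a b) (hd : ∀ᵐ x, HasDerivAt F (f x) x) :
    LocAC F f := by
  refine ⟨hf, fun x y => ?_⟩
  set P : ℝ → ℂ := fun s => ∫ t in x..s, f t with hP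
  have hPl : LocAC P f := ⟨hf, fun s t => by
    simp only [hP]
    rw [intervalIntegral.integral_interval_sub_left] <;>
      exact (hf.integrableOn_isCompact isCompact_uIcc).intervalIntegrable⟩
  obtain ⟨C, hC⟩ := ((hF x y).sub (hPl.absolutelyContinuousOnInterval x y)).const_of_ae_hasDerivAt_zero
    (by
      filter_upwards [hd, hPl.ae_hasDerivAt] with s h1 h2 _
      simpa using h1.sub h2)
  have e1 := hC x (by simp)
  have e2 := hC y (by simp)
  simp only [Pi.sub_apply, hP, intervalIntegral.integral_same, sub_zero] at e1 e2
  rw [e1, ← e2]; ring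

theorem mul (hF : LocAC F f) (hG : LocAC G g) :
    LocAC (fun x => F x * G x) (fun x => f x * G x + F x * g x) := by
  refine of_absolutelyContinuous ?_ (fun a b => ?_) ?_
  · exact (hF.locInt.mul_continuous hG.continuous).add
      (hG.locInt.continuous_mul hF.continuous)
  · exact (hF.absolutelyContinuousOnInterval a b).smul (hG.absolutelyContinuousOnInterval a b)
  · filter_upwards [hF.ae_hasDerivAt, hG.ae_hasDerivAt] with x h1 h2 using h1.mul h2

theorem of_hasDerivAt (hf : Continuous f) (h : ∀ x, HasDerivAt F (f x) x) : LocAC F f :=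
  ⟨hf.locallyIntegrable, fun x y =>
    (intervalIntegral.integral_eq_sub_of_hasDerivAt (fun t _ => h t)
      (hf.intervalIntegrable x y)).symm⟩

theorem add (hF : LocAC F f) (hG : LocAC G g) : LocAC (fun x => F x + G x) (fun x => f x + g x) :=
  ⟨hF.locInt.add hG.locInt, fun x y => by
    rw [intervalIntegral.integral_add (hF.intervalIntegrable x y) (hG.intervalIntegrable x y),
      ← hF.sub_eq, ← hG.sub_eq]; ring⟩

theorem const_mul (c : ℂ) (hF : LocAC F f) : LocAC (fun x => c * F x) (fun x => c * f x) :=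
  ⟨hF.locInt.smul c, fun x y => by
    rw [intervalIntegral.integral_const_mul, ← hF.sub_eq]; ring⟩

theorem sub (hF : LocAC F f) (hG : LocAC G g) : LocAC (fun x => F x - G x) (fun x => f x - g x) :=
  ⟨hF.locInt.sub hG.locInt, fun x y => by
    rw [intervalIntegral.integral_sub (hF.intervalIntegrable x y) (hG.intervalIntegrable x y),
      ← hF.sub_eq, ← hG.sub_eq]; ring⟩

theorem conj_comp (hF : LocAC F f) : LocAC (fun x => conj (F x)) (fun x => conj (f x)) := by
  refine ⟨?_, fun x y => ?_⟩
  · intro x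
    obtain ⟨s, hs, h⟩ := hF.locInt x
    exact ⟨s, hs, Complex.conjCLE.toContinuousLinearMap.integrable_comp h⟩
  · rw [← map_sub, hF.sub_eq]
    simp only [intervalIntegral, map_sub, integral_conj]

theorem congr_deriv (hF : LocAC F f) (h : ∀ x, f x = g x) : LocAC F g := funext h ▸ hF

theorem congr_ae (hF : LocAC F f) (h : f =ᵐ[volume] g) : LocAC F g :=
  ⟨(locallyIntegrable_congr h).1 hF.locInt, fun x y => by
    rw [hF.sub_eq]; exact intervalIntegral.integral_congr_ae (h.mono fun t ht _ => ht)⟩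

theorem of_integral_Iic (hf : Integrable f) (c : ℂ) (h : ∀ x, F x = c + ∫ t in Iic x, f t) :
    LocAC F f :=
  ⟨hf.locallyIntegrable, fun x y => by
    rw [h, h, ← intervalIntegral.integral_Iic_sub_Iic hf.integrableOn hf.integrableOn]; ring⟩

theorem eq_integral_Iic (hF : LocAC F f) (hf : Integrable f) {c : ℂ}
    (h : Tendsto F atBot (𝓝 c)) (x : ℝ) : F x = c + ∫ t in Iic x, f t := by
  have h1 := intervalIntegral_tendsto_integral_Iic x hf.integrableOn tendsto_id
  have h2 : Tendsto (fun y => F x - F y) atBot (𝓝 (F x - c)) := tendsto_const_nhds.sub h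
  have := tendsto_nhds_unique (h2.congr fun y => hF.sub_eq y x) h1
  rw [← this]; ring

theorem exists_tendsto_atBot (hF : LocAC F f) (hf : Integrable f) :
    ∃ c, Tendsto F atBot (𝓝 c) := by
  refine ⟨F 0 - ∫ t in Iic 0, f t, ?_⟩
  have h1 := intervalIntegral_tendsto_integral_Iic 0 hf.integrableOn tendsto_id
  refine (h1.const_sub (F 0)).congr fun y => ?_
  rw [id_eq, ← hF.sub_eq]; ring

theorem exists_tendsto_atTop (hF : LocAC F f) (hf : Integrable f) :
    ∃ c, Tendsto F atTop (𝓝 c) := by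
  refine ⟨F 0 + ∫ t in Ioi 0, f t, ?_⟩
  have h1 := intervalIntegral_tendsto_integral_Ioi 0 hf.integrableOn tendsto_id
  exact (h1.const_add (F 0)).congr fun y => (hF.eq_add 0 y).symm

/-- An integrable derivative forces a limit, and a nonzero limit would contradict the integrability
of F near -∞. -/
theorem tendsto_zero_atBot (hF : LocAC F f) (hf : Integrable f) (hi : Integrable F) :
    Tendsto F atBot (𝓝 0) := by
  obtain ⟨c, hc⟩ := hF.exists_tendsto_atBot hf
  by_contra hne
  have hc0 : c ≠ 0 := by rintro rfl; exact hne hc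
  have hev : ∀ᶠ x in atBot, ‖c‖ / 2 < ‖F x‖ :=
    hc.norm.eventually (lt_mem_nhds (half_lt_self (norm_pos_iff.2 hc0)))
  obtain ⟨R, hR⟩ := eventually_atBot.1 hev
  have h1 : IntegrableOn (fun _ : ℝ => ‖c‖ / 2) (Iic R) := by
    refine Integrable.mono' hi.norm.integrableOn (by fun_prop) ?_
    filter_upwards [ae_restrict_mem measurableSet_Iic] with x hx
    rw [Real.norm_of_nonneg (by positivity)]
    exact (hR x hx).le
  rw [integrableOn_const_iff] at h1
  simp [hc0] at h1

theorem tendsto_zero_atTop (hF : LocAC F f) (hf : Integrable f) (hi : Integrable F) :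
    Tendsto F atTop (𝓝 0) := by
  obtain ⟨c, hc⟩ := hF.exists_tendsto_atTop hf
  by_contra hne
  have hc0 : c ≠ 0 := by rintro rfl; exact hne hc
  have hev : ∀ᶠ x in atTop, ‖c‖ / 2 < ‖F x‖ :=
    hc.norm.eventually (lt_mem_nhds (half_lt_self (norm_pos_iff.2 hc0)))
  obtain ⟨R, hR⟩ := eventually_atTop.1 hev
  have h1 : IntegrableOn (fun _ : ℝ => ‖c‖ / 2) (Ici R) := by
    refine Integrable.mono' hi.norm.integrableOn (by fun_prop) ?_
    filter_upwards [ae_restrict_mem measurableSet_Ici] with x hx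
    rw [Real.norm_of_nonneg (by positivity)]
    exact (hR x hx).le
  rw [integrableOn_const_iff] at h1
  simp [hc0] at h1

/-- Translates of a locally absolutely continuous function with derivative in `L²`. -/
theorem eLpNorm_translate_sub_le (hF : LocAC F f) (hf : Measurable f) (t : ℝ) :
    eLpNorm ((fun y => F (y + t)) - F) 2 volume ≤ eLpNorm f 2 volume * ‖t‖ₑ := by
  have hm : Measurable (Function.uncurry fun y s : ℝ => ‖f (s + y)‖ₑ) := by
    simp only [Function.uncurry_def]; fun_prop
  -- F(y+t) - F(y) is the integral of f(s+y) over s between 0 and t. Minkowski's inequality and the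
  -- translation invariance of the norm give the factor |t|.
  calc eLpNorm ((fun y => F (y + t)) - F) 2 volume
      ≤ eLpNorm (fun y => ∫⁻ s in uIoc 0 t, 1 * ‖f (s + y)‖ₑ) 2 volume := by
        refine eLpNorm_mono_enorm fun y => ?_
        have e : ((fun y => F (y + t)) - F) y = ∫ s in (0 : ℝ)..t, f (s + y) := by
          rw [intervalIntegral.integral_comp_add_right, zero_add, ← hF.sub_eq, add_comm t y]
          rfl
        rw [enorm_eq_self, e, ← ofReal_norm, intervalIntegral.norm_intervalIntegral_eq, ofReal_norm]
        simp only [one_mul]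
        exact enorm_integral_le_lintegral_enorm _
    _ ≤ eLpNorm f 2 volume * ∫⁻ s in uIoc 0 t, 1 := by
        refine eLpNorm_lintegral_mul_le measurable_const hm fun s => ?_
        rw [eLpNorm_enorm]
        refine le_of_eq ?_
        simp only [add_comm s]
        exact eLpNorm_comp_measurePreserving hf.aestronglyMeasurable
          (measurePreserving_add_right volume s)
    _ = _ := by
        rw [setLIntegral_one, uIoc, Real.volume_Ioc, ← ofReal_norm, Real.norm_eq_abs,
          max_sub_min_eq_abs, sub_zero]

end LocAC

/-! ### Functions with weak derivatives -/

theorem LocAC.of_contDiff {η : ℝ → ℝ} (hη : ContDiff ℝ ∞ η) :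
    LocAC (fun x => (η x : ℂ)) (fun x => ((deriv η x : ℝ) : ℂ)) := by
  refine LocAC.of_hasDerivAt ?_ fun x => ?_
  · have := hη.continuous_deriv (by exact_mod_cast le_top)
    fun_prop
  · exact ((hη.differentiable (by simp)) x).hasDerivAt.ofReal_comp

/-- Integrate the derivative of ηF over an interval that contains the support of η in its interior.
-/
theorem LocAC.hasWeakDeriv {F f : ℝ → ℂ} (h : LocAC F f) : HasWeakDeriv F f := by
  refine ⟨h.continuous.locallyIntegrable, h.locInt, fun η hη hc => ?_⟩
  have hp := (LocAC.of_contDiff hη).mul h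
  obtain ⟨R, hR⟩ := hc.isCompact.isBounded.subset_closedBall 0
  have hzero : ∀ x, R < |x| → η x = 0 := fun x hx => by
    by_contra h
    have := hR (subset_tsupport _ h)
    simp at this; linarith
  have hdzero : ∀ x, R < |x| → deriv η x = 0 := fun x hx => by
    by_contra h
    have := hR (support_deriv_subset h)
    simp at this; linarith
  set S := |R| + 1
  have hRS : R < S := (le_abs_self R).trans_lt (by simp [S])
  have hS : 0 < S := by positivity
  have hdc : Continuous (deriv η) := hη.continuous_deriv (by exact_mod_cast le_top)
  have j1 := h.continuous.locallyIntegrable.integrable_smul_left_of_hasCompactSupport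
    (μ := volume) hdc hc.deriv
  have j2 := h.locInt.integrable_smul_left_of_hasCompactSupport hη.continuous hc
  have e := hp.sub_eq (-S) S
  rw [hzero S (by rwa [abs_of_pos hS]), hzero (-S) (by rwa [abs_neg, abs_of_pos hS])] at e
  rw [intervalIntegral.integral_eq_integral_of_support_subset, integral_add] at e
  · simp only [Complex.real_smul]
    simp only [Complex.ofReal_zero, zero_mul, sub_self] at e
    exact eq_neg_of_add_eq_zero_left e.symm
  · exact j1
  · exact j2
  · intro x hx
    by_contra hn
    have hx2 : R < |x| := by
      by_contra h2
      have := abs_le.1 (not_lt.1 h2)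
      exact hn ⟨by linarith, by linarith⟩
    exact hx (by simp [hzero x hx2, hdzero x hx2])

/-- Du Bois-Reymond's argument: a test function minus its integral times a fixed bump has mean zero,
hence is the derivative of a test function. Testing against w therefore sees only the constant ∫ρw.
-/
theorem exists_ae_eq_const_of_hasWeakDeriv_zero {w : ℝ → ℂ} (h : HasWeakDeriv w 0) :
    ∃ c : ℂ, w =ᵐ[volume] fun _ => c := by
  let b : ContDiffBump (0 : ℝ) := ⟨1, 2, one_pos, one_lt_two⟩
  set ρ : ℝ → ℝ := b.normed volume with hρ
  have hρs : ContDiff ℝ ∞ ρ := b.contDiff_normed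
  have hρc : HasCompactSupport ρ := b.hasCompactSupport_normed
  have hρ1 : ∫ x, ρ x = 1 := b.integral_normed
  have hρi : Integrable ρ := b.integrable_normed
  set c : ℂ := ∫ x, ρ x • w x with hc
  refine ⟨c, ?_⟩
  rw [← sub_ae_eq_zero]
  refine ae_eq_zero_of_integral_contDiff_smul_eq_zero
    (h.1.sub continuous_const.locallyIntegrable) fun φ hφ hφc => ?_
  have hφi : Integrable φ := hφ.continuous.integrable_of_hasCompactSupport hφc
  set m := ∫ x, φ x with hm
  set ψ : ℝ → ℝ := fun x => φ x - m * ρ x with hψ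
  have hψs : ContDiff ℝ ∞ ψ := hφ.sub (contDiff_const.mul hρs)
  have hψc : HasCompactSupport ψ := hφc.sub (hρc.mul_left (f := fun _ => m))
  have hψi : Integrable ψ := hψs.continuous.integrable_of_hasCompactSupport hψc
  have hψ0 : ∫ x, ψ x = 0 := by
    simp only [hψ]
    rw [integral_sub hφi (hρi.const_mul m), integral_const_mul, hρ1, ← hm]; ring
  set η : ℝ → ℝ := fun x => ∫ t in Iic x, ψ t with hη
  have hηd : ∀ x, HasDerivAt η (ψ x) x := fun x => by
    have h1 := intervalIntegral.integral_hasDerivAt_right (hψs.continuous.intervalIntegrable 0 x)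
      (hψs.continuous.stronglyMeasurableAtFilter _ _) hψs.continuous.continuousAt
    refine (h1.const_add (∫ t in Iic 0, ψ t)).congr_of_eventuallyEq
      (Eventually.of_forall fun y => ?_)
    simp only [hη]
    rw [← intervalIntegral.integral_Iic_sub_Iic hψi.integrableOn hψi.integrableOn]; ring
  have hderiv : deriv η = ψ := funext fun x => (hηd x).deriv
  have hηs : ContDiff ℝ ∞ η :=
    contDiff_infty_iff_deriv.2 ⟨fun x => (hηd x).differentiableAt, hderiv ▸ hψs⟩
  -- To the left of the support of ψ the primitive is an integral of zero; to the right it is the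
  -- full integral of ψ, which vanishes.
  have hηc : HasCompactSupport η := by
    obtain ⟨R, hR⟩ := hψc.isCompact.isBounded.subset_closedBall 0
    have hzero : ∀ x, R < |x| → ψ x = 0 := fun x hx => by
      by_contra h
      have := hR (subset_tsupport _ h)
      simp at this; linarith
    refine HasCompactSupport.of_support_subset_isCompact (isCompact_Icc (a := -|R|) (b := |R|)) ?_
    intro x hx
    by_contra hn
    apply hx
    rw [mem_Icc, not_and_or, not_le, not_le] at hn
    rcases hn with hn | hn
    · change ∫ t in Iic x, ψ t = 0
      refine setIntegral_eq_zero_of_forall_eq_zero fun t ht => hzero t ?_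
      have ht' : t ≤ x := ht
      have : |t| = -t := abs_of_neg (by linarith [abs_nonneg R])
      rw [this]; linarith [le_abs_self R]
    · have h2 : η x = ∫ t, ψ t := by
        change ∫ t in Iic x, ψ t = _
        rw [← integral_indicator measurableSet_Iic]
        congr 1; ext t
        by_cases ht : t ≤ x
        · simp [ht]
        · have h3 : R < |t| := (le_abs_self R).trans_lt ((hn.trans (not_le.1 ht)).trans_le (le_abs_self t))
          simp [ht, hzero t h3]
      rw [h2, hψ0]
  have key := h.2.2 η hηs hηc
  rw [hderiv] at key
  simp only [Pi.zero_apply, smul_zero, integral_zero, neg_zero] at key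
  have i1 := h.1.integrable_smul_left_of_hasCompactSupport hφ.continuous hφc
  have i2 := h.1.integrable_smul_left_of_hasCompactSupport hρs.continuous hρc
  have e1 : ∫ x, ψ x • w x = (∫ x, φ x • w x) - m • c := by
    have e := integral_sub i1 (i2.smul m)
    simp only [Pi.smul_apply] at e
    rw [hc, ← integral_smul, ← e]
    congr 1; ext x
    simp only [hψ, sub_smul, mul_smul]
  have e2 : ∫ x, φ x • (w x - c) = (∫ x, φ x • w x) - m • c := by
    rw [hm, ← integral_smul_const, ← integral_sub i1 (hφi.smul_const c)]
    congr 1; ext x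
    simp only [smul_sub]
  change ∫ x, φ x • (w x - c) = 0
  rw [e2, ← e1, key]

/-- A function with a weak derivative has a locally absolutely continuous representative. -/
theorem HasWeakDeriv.exists_locAC {f g : ℝ → ℂ} (h : HasWeakDeriv f g) :
    ∃ F, LocAC F g ∧ f =ᵐ[volume] F := by
  set P : ℝ → ℂ := fun s => ∫ t in (0 : ℝ)..s, g t with hP
  have hPl : LocAC P g := ⟨h.2.1, fun s t => by
    simp only [hP]
    rw [intervalIntegral.integral_interval_sub_left] <;>
      exact (h.2.1.integrableOn_isCompact isCompact_uIcc).intervalIntegrable⟩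
  have hw := h.sub hPl.hasWeakDeriv
  rw [sub_self] at hw
  obtain ⟨c, hc⟩ := exists_ae_eq_const_of_hasWeakDeriv_zero hw
  refine ⟨fun x => c + P x, ⟨h.2.1, fun x y => ?_⟩, ?_⟩
  · rw [← hPl.sub_eq]; ring
  · filter_upwards [hc] with x hx
    rw [← hx]; simp

/-! ### Solutions of the integral equations -/

/-- Integration over the sets `S x` with weight `s`. -/
structure Direction (s : ℂ) (S : ℝ → Set ℝ) : Prop where
  cont : ∀ f : ℝ → ℂ, Integrable f → Continuous fun x => ∫ y in S x, f y

theorem continuous_integral_Iic {f : ℝ → ℂ} (hf : Integrable f) :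
    Continuous fun x => ∫ y in Iic x, f y :=
  (LocAC.of_integral_Iic hf 0 fun _ => (zero_add _).symm).continuous

theorem integral_Ioi_eq_sub {f : ℝ → ℂ} (hf : Integrable f) (x : ℝ) :
    ∫ y in Ioi x, f y = (∫ y, f y) - ∫ y in Iic x, f y := by
  rw [← compl_Iic, setIntegral_compl measurableSet_Iic hf]

theorem direction_Iic : Direction 1 Iic :=
  ⟨fun _ hf => continuous_integral_Iic hf⟩

theorem direction_Ioi : Direction (-1) Ioi :=
  ⟨fun _ hf => by
    simp only [integral_Ioi_eq_sub hf]
    exact continuous_const.sub (continuous_integral_Iic hf)⟩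

/-- A bounded solution of the integral equation `Y = c + s ∫_S (A Y₂, B Y₁)`. -/
structure IsSol (s : ℂ) (S : ℝ → Set ℝ) (A B : ℝ → ℂ) (c : ℂ × ℂ) (Y : ℝ → ℂ × ℂ) : Prop where
  meas : Measurable Y
  bdd : ∃ C : ℝ≥0∞, C ≠ ⊤ ∧ ∀ x, absSum (Y x) ≤ C
  fst : ∀ x, (Y x).1 = c.1 + s * ∫ y in S x, A y * (Y y).2
  snd : ∀ x, (Y x).2 = c.2 + s * ∫ y in S x, B y * (Y y).1

section

variable {s : ℂ} {S : ℝ → Set ℝ} {A B : ℝ → ℂ} {c c' : ℂ × ℂ} {Y Y' : ℝ → ℂ × ℂ}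

theorem IsSol.integrable_fst (h : IsSol s S A B c Y) (hA : Integrable A) :
    Integrable fun y => A y * (Y y).2 := by
  obtain ⟨C, hC, hb⟩ := h.bdd
  exact integrable_mul_of_enorm_le hA h.meas.snd.aestronglyMeasurable hC
    (Eventually.of_forall fun x => (enorm_snd_le_absSum _).trans (hb x))

theorem IsSol.integrable_snd (h : IsSol s S A B c Y) (hB : Integrable B) :
    Integrable fun y => B y * (Y y).1 := by
  obtain ⟨C, hC, hb⟩ := h.bdd
  exact integrable_mul_of_enorm_le hB h.meas.fst.aestronglyMeasurable hC
    (Eventually.of_forall fun x => (enorm_fst_le_absSum _).trans (hb x))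

theorem enorm_add_mul_setIntegral_le (c s : ℂ) (f : ℝ → ℂ) (T : Set ℝ) :
    ‖c + s * ∫ y in T, f y‖ₑ ≤ ‖c‖ₑ + ‖s‖ₑ * ∫⁻ y, ‖f y‖ₑ := by
  refine (enorm_add_le _ _).trans ?_
  rw [enorm_mul]
  gcongr
  exact (enorm_integral_le_lintegral_enorm _).trans (setLIntegral_le_lintegral _ _)

/-- The integral equation holds at every point, so integrability of the densities already makes Y
continuous and bounded everywhere. This is the passage from essentially bounded solutions to
`IsSol`. -/
theorem IsSol.of_eq (d : Direction s S) (iA : Integrable fun y => A y * (Y y).2)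
    (iB : Integrable fun y => B y * (Y y).1)
    (h1 : ∀ x, (Y x).1 = c.1 + s * ∫ y in S x, A y * (Y y).2)
    (h2 : ∀ x, (Y x).2 = c.2 + s * ∫ y in S x, B y * (Y y).1) : IsSol s S A B c Y := by
  refine ⟨Measurable.prodMk (f := fun x => (Y x).1) (g := fun x => (Y x).2) ?_ ?_,
    ⟨(‖c.1‖ₑ + ‖s‖ₑ * ∫⁻ y, ‖A y * (Y y).2‖ₑ) + (‖c.2‖ₑ + ‖s‖ₑ * ∫⁻ y, ‖B y * (Y y).1‖ₑ), ?_,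
      fun x => ?_⟩, h1, h2⟩
  · rw [funext h1]
    exact (continuous_const.add (continuous_const.mul (d.cont _ iA))).measurable
  · rw [funext h2]
    exact (continuous_const.add (continuous_const.mul (d.cont _ iB))).measurable
  · have e1 := iA.2.ne
    have e2 := iB.2.ne
    simp only [ne_eq, ENNReal.add_eq_top, enorm_ne_top, ENNReal.mul_eq_top, e1, e2]
    simp
  · unfold absSum
    nth_rw 1 [h1 x]
    nth_rw 1 [h2 x]
    exact add_le_add (enorm_add_mul_setIntegral_le _ _ _ _) (enorm_add_mul_setIntegral_le _ _ _ _)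

theorem IsSol.smul_add_smul (hA : Integrable A) (hB : Integrable B) (h : IsSol s S A B c Y)
    (h' : IsSol s S A B c' Y') (d : Direction s S) (r r' : ℂ) :
    IsSol s S A B (r • c + r' • c') (fun x => r • Y x + r' • Y' x) := by
  have e1 : ∀ y, A y * (r • Y y + r' • Y' y).2 = r * (A y * (Y y).2) + r' * (A y * (Y' y).2) :=
    fun y => by simp; ring
  have e2 : ∀ y, B y * (r • Y y + r' • Y' y).1 = r * (B y * (Y y).1) + r' * (B y * (Y' y).1) :=
    fun y => by simp; ring
  have i1 := (h.integrable_fst hA).const_mul r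
  have i1' := (h'.integrable_fst hA).const_mul r'
  have i2 := (h.integrable_snd hB).const_mul r
  have i2' := (h'.integrable_snd hB).const_mul r'
  refine IsSol.of_eq d ?_ ?_ (fun x => ?_) (fun x => ?_)
  · simp only [e1]; exact i1.add i1'
  · simp only [e2]; exact i2.add i2'
  · simp only [e1]
    rw [integral_add i1.integrableOn i1'.integrableOn, integral_const_mul, integral_const_mul]
    simp only [Prod.fst_add, Prod.smul_fst, smul_eq_mul]
    rw [h.fst x, h'.fst x]; ring
  · simp only [e2]
    rw [integral_add i2.integrableOn i2'.integrableOn, integral_const_mul, integral_const_mul]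
    simp only [Prod.snd_add, Prod.smul_snd, smul_eq_mul]
    rw [h.snd x, h'.snd x]; ring

theorem isSol_Iic_iff : IsSol 1 Iic A B c Y ↔ Measurable Y ∧
    (∃ C : ℝ≥0∞, C ≠ ⊤ ∧ ∀ x, absSum (Y x) ≤ C) ∧ ∀ x, Y x = volt (fun _ => 1) A B c Y x := by
  constructor
  · rintro ⟨h1, h2, h3, h4⟩
    refine ⟨h1, h2, fun x => Prod.ext ?_ ?_⟩
    · rw [h3 x]; simp [volt]
    · rw [h4 x]; simp [volt]
  · rintro ⟨h1, h2, h3⟩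
    refine ⟨h1, h2, fun x => ?_, fun x => ?_⟩
    · conv_lhs => rw [h3 x]
      simp [volt]
    · conv_lhs => rw [h3 x]
      simp [volt]

theorem voltKernel_one (hA : Measurable A) (hB : Measurable B) (iA : Integrable A)
    (iB : Integrable B) : VoltKernel (fun _ => 1) A B :=
  ⟨measurable_const, hA, hB, fun _ _ => by simp, by
    rw [lintegral_add_left hA.enorm]
    exact ENNReal.add_ne_top.2 ⟨iA.2.ne, iB.2.ne⟩⟩

theorem isSol_Iic_voltSol (hA : Measurable A) (hB : Measurable B) (iA : Integrable A)
    (iB : Integrable B) : IsSol 1 Iic A B c (voltSol (fun _ => 1) A B c) := by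
  have k := voltKernel_one hA hB iA iB
  exact isSol_Iic_iff.2 ⟨measurable_voltSol' k c, exists_absSum_voltSol_le k c,
    fun x => (congrFun (volt_voltSol k c) x).symm⟩

theorem IsSol.eq_of_Iic (hA : Measurable A) (hB : Measurable B) (iA : Integrable A)
    (iB : Integrable B) (h : IsSol 1 Iic A B c Y) (h' : IsSol 1 Iic A B c Y') : Y = Y' := by
  have k := voltKernel_one hA hB iA iB
  obtain ⟨m, ⟨C, hC, hb⟩, e⟩ := isSol_Iic_iff.1 h
  obtain ⟨m', ⟨C', hC', hb'⟩, e'⟩ := isSol_Iic_iff.1 h'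
  rw [eq_voltSol k m hC hb e, eq_voltSol k m' hC' hb' e']

theorem setIntegral_Ioi_neg (f : ℝ → ℂ) (x : ℝ) :
    ∫ y in Ioi (-x), f y = ∫ y in Iic x, f (-y) := by
  have h := (Measure.measurePreserving_neg (volume : Measure ℝ)).setIntegral_preimage_emb
    (Homeomorph.neg ℝ).measurableEmbedding f (Ioi (-x))
  rw [← h, integral_Iic_eq_integral_Iio]
  congr 2
  ext y; simp

/-- The reflection x → -x turns normalization at +∞ into normalization at -∞ and changes the sign of
the coefficients. Existence and uniqueness from +∞ follow. -/
theorem isSol_Ioi_iff : IsSol (-1) Ioi A B c Y ↔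
    IsSol 1 Iic (fun y => -A (-y)) (fun y => -B (-y)) c (fun x => Y (-x)) := by
  have e : ∀ F : ℝ → ℂ, ∀ x, (1 : ℂ) * ∫ y in Iic x, -F (-y) = -1 * ∫ y in Ioi (-x), F y :=
    fun F x => by rw [setIntegral_Ioi_neg, integral_neg]; ring
  constructor
  · rintro ⟨h1, ⟨C, hC, h2⟩, h3, h4⟩
    refine ⟨h1.comp measurable_neg, ⟨C, hC, fun x => h2 _⟩, fun x => ?_, fun x => ?_⟩
    · simp only [neg_mul _ (Prod.snd _), e fun y => A y * (Y y).2]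
      rw [h3 (-x)]
    · simp only [neg_mul _ (Prod.fst _), e fun y => B y * (Y y).1]
      rw [h4 (-x)]
  · rintro ⟨h1, ⟨C, hC, h2⟩, h3, h4⟩
    have hm := h1.comp measurable_neg
    simp only [Function.comp_def, neg_neg] at hm
    refine ⟨hm, ⟨C, hC, fun x => by simpa using h2 (-x)⟩, fun x => ?_, fun x => ?_⟩
    · have := h3 (-x)
      simp only [neg_mul _ (Prod.snd _), e fun y => A y * (Y y).2, neg_neg] at this
      exact this
    · have := h4 (-x)
      simp only [neg_mul _ (Prod.fst _), e fun y => B y * (Y y).1, neg_neg] at this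
      exact this

theorem exists_isSol_Ioi (hA : Measurable A) (hB : Measurable B) (iA : Integrable A)
    (iB : Integrable B) (c : ℂ × ℂ) : ∃ Y, IsSol (-1) Ioi A B c Y := by
  have h := isSol_Iic_voltSol (c := c) (hA.comp measurable_neg).neg (hB.comp measurable_neg).neg
    iA.comp_neg.neg iB.comp_neg.neg
  refine ⟨fun x => voltSol (fun _ => 1) (fun y => -A (-y)) (fun y => -B (-y)) c (-x), ?_⟩
  rw [isSol_Ioi_iff]
  simp only [neg_neg]
  exact h

theorem IsSol.eq_of_Ioi (hA : Measurable A) (hB : Measurable B) (iA : Integrable A)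
    (iB : Integrable B) (h : IsSol (-1) Ioi A B c Y) (h' : IsSol (-1) Ioi A B c Y') : Y = Y' := by
  have := (isSol_Ioi_iff.1 h).eq_of_Iic (hA.comp measurable_neg).neg (hB.comp measurable_neg).neg
    iA.comp_neg.neg iB.comp_neg.neg (isSol_Ioi_iff.1 h')
  ext1 x
  simpa using congrFun this (-x)

/-- A solution normalized at -∞ solves the equation from +∞ with its own limit there as data. The
scattering coefficients are read off from this limit. -/
theorem IsSol.to_Ioi (iA : Integrable A) (iB : Integrable B) (h : IsSol 1 Iic A B c Y) :
    IsSol (-1) Ioi A B (c.1 + ∫ y, A y * (Y y).2, c.2 + ∫ y, B y * (Y y).1) Y := by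
  refine ⟨h.meas, h.bdd, fun x => ?_, fun x => ?_⟩
  · rw [integral_Ioi_eq_sub (h.integrable_fst iA), h.fst x]; ring
  · rw [integral_Ioi_eq_sub (h.integrable_snd iB), h.snd x]; ring

theorem IsSol.tendsto_atTop (iA : Integrable A) (iB : Integrable B)
    (h : IsSol (-1) Ioi A B c Y) : Tendsto Y atTop (𝓝 c) := by
  have key : ∀ {f : ℝ → ℂ}, Integrable f → ∀ c : ℂ,
      Tendsto (fun x => c + -1 * ∫ y in Ioi x, f y) atTop (𝓝 c) := fun {f} hf c => by
    have h1 := (tendsto_integral_Iic_atTop hf).const_sub (∫ y, f y)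
    rw [sub_self] at h1
    simpa [integral_Ioi_eq_sub hf] using (h1.const_mul (-1)).const_add c
  have h1 := key (h.integrable_fst iA) c.1
  have h2 := key (h.integrable_snd iB) c.2
  refine (h1.prodMk_nhds h2).congr fun x => ?_
  exact Prod.ext (h.fst x).symm (h.snd x).symm

end

/-! ### The Jost functions -/

/-- Removal of the phase from the first kind of Jost functions. -/
noncomputable def toFst (z : ℝ) (Y : ℝ → ℂ × ℂ) (x : ℝ) : Fin 2 → ℂ :=
  ![(Y x).1, phase 1 z x * (Y x).2]

/-- Removal of the phase from the second kind of Jost functions. -/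
noncomputable def toSnd (z : ℝ) (Y : ℝ → ℂ × ℂ) (x : ℝ) : Fin 2 → ℂ :=
  ![phase (-1) z x * (Y x).1, (Y x).2]

theorem phase_neg_mul_phase (z t : ℝ) : phase (-1) z t * phase 1 z t = 1 := by
  rw [mul_comm, phase_mul_phase_neg]

theorem exists_eq_toFst (z : ℝ) (φ : ℝ → Fin 2 → ℂ) : ∃ Y, φ = toFst z Y := by
  refine ⟨fun x => (φ x 0, phase (-1) z x * φ x 1), ?_⟩
  ext x i
  fin_cases i
  · simp [toFst]
  · simp [toFst, ← mul_assoc, phase_mul_phase_neg]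

theorem exists_eq_toSnd (z : ℝ) (φ : ℝ → Fin 2 → ℂ) : ∃ Y, φ = toSnd z Y := by
  refine ⟨fun x => (phase 1 z x * φ x 0, φ x 1), ?_⟩
  ext x i
  fin_cases i
  · simp [toSnd, ← mul_assoc, phase_neg_mul_phase]
  · simp [toSnd]

section

variable {s : ℂ} {S : ℝ → Set ℝ} {J : ℝ → (ℝ → Fin 2 → ℂ) → Fin 2 → ℂ} {u : ℝ → ℂ} {lam : ℂ}
  {z : ℝ} {Y : ℝ → ℂ × ℂ}

theorem exp_eq_phase_mul_phase (hz : lam ^ 2 = z) (x y : ℝ) :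
    Complex.exp (2 * Complex.I * lam ^ 2 * ((x : ℂ) - y)) = phase 1 z x * phase (-1) z y := by
  rw [phase, phase, ← Complex.exp_add, hz]
  congr 1; push_cast; ring

theorem exp_neg_eq_phase_mul_phase (hz : lam ^ 2 = z) (x y : ℝ) :
    Complex.exp (-(2 * Complex.I * lam ^ 2 * ((x : ℂ) - y))) = phase (-1) z x * phase 1 z y := by
  rw [phase, phase, ← Complex.exp_add, hz]
  congr 1; push_cast; ring

theorem phase_mul_eq_iff {z x : ℝ} {p q : ℂ} :
    phase 1 z x * p = q ↔ p = phase (-1) z x * q := by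
  constructor
  · rintro rfl; rw [← mul_assoc, phase_neg_mul_phase, one_mul]
  · rintro rfl; rw [← mul_assoc, phase_mul_phase_neg, one_mul]

theorem phase_neg_mul_eq_iff {z x : ℝ} {p q : ℂ} :
    phase (-1) z x * p = q ↔ p = phase 1 z x * q := by
  constructor
  · rintro rfl; rw [← mul_assoc, phase_mul_phase_neg, one_mul]
  · rintro rfl; rw [← mul_assoc, phase_neg_mul_phase, one_mul]

theorem memLp_top_pair {f g : ℝ → ℂ} (hf : MemLp f ⊤ volume) (hg : MemLp g ⊤ volume) :
    MemLp (fun x => ![f x, g x]) ⊤ volume := by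
  rw [memLp_pi_iff]
  intro i
  fin_cases i
  · simpa using hf
  · simpa using hg

theorem memLp_top_of_enorm_le {f : ℝ → ℂ} (hf : AEStronglyMeasurable f volume) {C : ℝ≥0∞}
    (hC : C ≠ ⊤) (h : ∀ x, ‖f x‖ₑ ≤ C) : MemLp f ⊤ volume :=
  memLp_top_of_bound hf C.toReal (Eventually.of_forall fun x => by
    rw [← toReal_enorm]; exact ENNReal.toReal_mono hC (h x))

theorem integrable_mul_of_memLp_top {a f : ℝ → ℂ} (ha : Integrable a) (hf : MemLp f ⊤ volume) :
    Integrable fun y => a y * f y :=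
  integrable_mul_of_enorm_le ha hf.1 hf.2.ne
    (by simpa [eLpNorm_exponent_top] using ae_le_eLpNormEssSup (f := f))

/-- The exponential kernel splits as e^{2izx}e^{-2izy}. The first factor belongs to the second
component of the Jost function, the second to the coefficient. -/
theorem isJostFst_toFst_iff (d : Direction s S) (hJ : ∀ x f, J x f = s • ∫ y in S x, f y)
    (iu : Integrable u) (hz : lam ^ 2 = z) :
    IsJostFst J u lam (toFst z Y) ↔
      IsSol s S (fun y => lam * u y * phase 1 z y) (fun y => -(lam * conj (u y)) * phase (-1) z y)
        (1, 0) Y := by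
  have icu : Integrable fun y => conj (u y) := Complex.conjCLE.toContinuousLinearMap.integrable_comp iu
  have hA : Integrable fun y => lam * u y * phase 1 z y := integrable_mul_phase (iu.const_mul lam) 1 z
  have hB : Integrable fun y => -(lam * conj (u y)) * phase (-1) z y :=
    integrable_mul_phase (icu.const_mul lam).neg (-1) z
  have e : ∀ x y : ℝ, (!![1, 0; 0, Complex.exp (2 * Complex.I * lam ^ 2 * ((x : ℂ) - y))] * Q (u y)) *ᵥ
      toFst z Y y = ![u y * phase 1 z y * (Y y).2,
        phase 1 z x * (-conj (u y) * phase (-1) z y * (Y y).1)] := fun x y => by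
    rw [exp_eq_phase_mul_phase hz]
    ext i
    fin_cases i
    · simp [Q, toFst, Matrix.mulVec, dotProduct, Fin.sum_univ_two]; ring
    · simp [Q, toFst, Matrix.mulVec, dotProduct, Fin.sum_univ_two]; ring
  -- Integrability is a hypothesis here because the integral with values in ℂ² is to be evaluated
  -- componentwise.
  have key : (Integrable fun y => u y * phase 1 z y * (Y y).2) →
      (Integrable fun y => -conj (u y) * phase (-1) z y * (Y y).1) → ∀ x,
      ((toFst z Y x = ![1, 0] + lam • J x (fun y =>
        (!![1, 0; 0, Complex.exp (2 * Complex.I * lam ^ 2 * ((x : ℂ) - y))] * Q (u y)) *ᵥ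
          toFst z Y y)) ↔
      ((Y x).1 = 1 + s * ∫ y in S x, lam * u y * phase 1 z y * (Y y).2) ∧
      ((Y x).2 = 0 + s * ∫ y in S x, -(lam * conj (u y)) * phase (-1) z y * (Y y).1)) := by
    intro i1 i2 x
    have i : ∀ i : Fin 2, Integrable (fun y => ![u y * phase 1 z y * (Y y).2,
        phase 1 z x * (-conj (u y) * phase (-1) z y * (Y y).1)] i) (volume.restrict (S x)) := by
      intro i
      fin_cases i
      · simpa [IntegrableOn] using i1.integrableOn
      · simpa [IntegrableOn] using (i2.const_mul _).integrableOn
    have f1 : ∫ y in S x, lam * u y * phase 1 z y * (Y y).2 =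
        lam * ∫ y in S x, u y * phase 1 z y * (Y y).2 := by
      rw [← integral_const_mul]; simp only [mul_assoc]
    have f2 : ∫ y in S x, -(lam * conj (u y)) * phase (-1) z y * (Y y).1 =
        lam * ∫ y in S x, -conj (u y) * phase (-1) z y * (Y y).1 := by
      rw [← integral_const_mul]; congr 1; ext y; ring
    simp only [e, hJ]
    rw [funext_iff, Fin.forall_fin_two, f1, f2]
    simp only [Pi.add_apply, Pi.smul_apply, eval_integral i]
    simp only [toFst, Matrix.cons_val_zero, Matrix.cons_val_one, smul_eq_mul, integral_const_mul]
    refine and_congr ?_ ?_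
    · rw [mul_left_comm]
    · rw [phase_mul_eq_iff]
      have : phase (-1) z x * (0 + lam * (s * (phase 1 z x *
          ∫ y in S x, -conj (u y) * phase (-1) z y * (Y y).1))) =
          0 + s * (lam * ∫ y in S x, -conj (u y) * phase (-1) z y * (Y y).1) := by
        linear_combination (lam * s * ∫ y in S x, -conj (u y) * phase (-1) z y * (Y y).1) *
          phase_neg_mul_phase z x
      rw [this]
  have iu' : Integrable fun y => u y * phase 1 z y := integrable_mul_phase iu 1 z
  have icu' : Integrable fun y => -conj (u y) * phase (-1) z y := integrable_mul_phase icu.neg (-1) z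
  constructor
  · rintro ⟨h1, h2⟩
    have m0 : MemLp (fun y => (Y y).1) ⊤ volume := by simpa [toFst] using memLp_pi_iff.1 h1 0
    have m1 : MemLp (fun y => (Y y).2) ⊤ volume := by
      have h3 : MemLp (fun y => phase 1 z y * (Y y).2) ⊤ volume := by
        simpa [toFst] using memLp_pi_iff.1 h1 1
      refine (memLp_congr_enorm h3.1 ?_ ?_).1 h3
      · have : (fun y => (Y y).2) = fun y => phase (-1) z y * (phase 1 z y * (Y y).2) := by
          ext y; rw [← mul_assoc, phase_neg_mul_phase, one_mul]
        rw [this]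
        exact AEStronglyMeasurable.mul (by fun_prop) h3.1
      · exact Eventually.of_forall fun y => by rw [enorm_mul, enorm_phase, one_mul]
    have i1 := integrable_mul_of_memLp_top iu' m1
    have i2 := integrable_mul_of_memLp_top icu' m0
    exact IsSol.of_eq d (integrable_mul_of_memLp_top hA m1) (integrable_mul_of_memLp_top hB m0)
      (fun x => ((key i1 i2 x).1 (h2 x)).1) (fun x => ((key i1 i2 x).1 (h2 x)).2)
  · intro h
    obtain ⟨C, hC, hb⟩ := h.bdd
    have m0 : MemLp (fun y => (Y y).1) ⊤ volume := memLp_top_of_enorm_le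
      h.meas.fst.aestronglyMeasurable hC fun x => (enorm_fst_le_absSum _).trans (hb x)
    have m1 : MemLp (fun y => (Y y).2) ⊤ volume := memLp_top_of_enorm_le
      h.meas.snd.aestronglyMeasurable hC fun x => (enorm_snd_le_absSum _).trans (hb x)
    have m2 : MemLp (fun y => phase 1 z y * (Y y).2) ⊤ volume := memLp_top_of_enorm_le
      (AEStronglyMeasurable.mul (by fun_prop) h.meas.snd.aestronglyMeasurable) hC fun x => by
        rw [enorm_mul, enorm_phase, one_mul]
        exact (enorm_snd_le_absSum _).trans (hb x)
    exact ⟨memLp_top_pair m0 m2, fun x => (key (integrable_mul_of_memLp_top iu' m1)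
      (integrable_mul_of_memLp_top icu' m0) x).2 ⟨h.fst x, h.snd x⟩⟩

theorem isJostSnd_toSnd_iff (d : Direction s S) (hJ : ∀ x f, J x f = s • ∫ y in S x, f y)
    (iu : Integrable u) (hz : lam ^ 2 = z) :
    IsJostSnd J u lam (toSnd z Y) ↔
      IsSol s S (fun y => lam * u y * phase 1 z y) (fun y => -(lam * conj (u y)) * phase (-1) z y)
        (0, 1) Y := by
  have icu : Integrable fun y => conj (u y) := Complex.conjCLE.toContinuousLinearMap.integrable_comp iu
  have hA : Integrable fun y => lam * u y * phase 1 z y := integrable_mul_phase (iu.const_mul lam) 1 z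
  have hB : Integrable fun y => -(lam * conj (u y)) * phase (-1) z y :=
    integrable_mul_phase (icu.const_mul lam).neg (-1) z
  have e : ∀ x y : ℝ, (!![Complex.exp (-(2 * Complex.I * lam ^ 2 * ((x : ℂ) - y))), 0; 0, 1] * Q (u y)) *ᵥ
      toSnd z Y y = ![phase (-1) z x * (u y * phase 1 z y * (Y y).2),
        -conj (u y) * phase (-1) z y * (Y y).1] := fun x y => by
    rw [exp_neg_eq_phase_mul_phase hz]
    ext i
    fin_cases i
    · simp [Q, toSnd, Matrix.mulVec, dotProduct, Fin.sum_univ_two]; ring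
    · simp [Q, toSnd, Matrix.mulVec, dotProduct, Fin.sum_univ_two]; ring
  have key : (Integrable fun y => u y * phase 1 z y * (Y y).2) →
      (Integrable fun y => -conj (u y) * phase (-1) z y * (Y y).1) → ∀ x,
      ((toSnd z Y x = ![0, 1] + lam • J x (fun y =>
        (!![Complex.exp (-(2 * Complex.I * lam ^ 2 * ((x : ℂ) - y))), 0; 0, 1] * Q (u y)) *ᵥ
          toSnd z Y y)) ↔
      ((Y x).1 = 0 + s * ∫ y in S x, lam * u y * phase 1 z y * (Y y).2) ∧
      ((Y x).2 = 1 + s * ∫ y in S x, -(lam * conj (u y)) * phase (-1) z y * (Y y).1)) := by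
    intro i1 i2 x
    have i : ∀ i : Fin 2, Integrable (fun y => ![phase (-1) z x * (u y * phase 1 z y * (Y y).2),
        -conj (u y) * phase (-1) z y * (Y y).1] i) (volume.restrict (S x)) := by
      intro i
      fin_cases i
      · simpa [IntegrableOn] using (i1.const_mul _).integrableOn
      · simpa [IntegrableOn] using i2.integrableOn
    have f1 : ∫ y in S x, lam * u y * phase 1 z y * (Y y).2 =
        lam * ∫ y in S x, u y * phase 1 z y * (Y y).2 := by
      rw [← integral_const_mul]; simp only [mul_assoc]
    have f2 : ∫ y in S x, -(lam * conj (u y)) * phase (-1) z y * (Y y).1 =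
        lam * ∫ y in S x, -conj (u y) * phase (-1) z y * (Y y).1 := by
      rw [← integral_const_mul]; congr 1; ext y; ring
    simp only [e, hJ]
    rw [funext_iff, Fin.forall_fin_two, f1, f2]
    simp only [Pi.add_apply, Pi.smul_apply, eval_integral i]
    simp only [toSnd, Matrix.cons_val_zero, Matrix.cons_val_one, smul_eq_mul, integral_const_mul]
    refine and_congr ?_ ?_
    · rw [phase_neg_mul_eq_iff]
      have : phase 1 z x * (0 + lam * (s * (phase (-1) z x *
          ∫ y in S x, u y * phase 1 z y * (Y y).2))) =
          0 + s * (lam * ∫ y in S x, u y * phase 1 z y * (Y y).2) := by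
        linear_combination (lam * s * ∫ y in S x, u y * phase 1 z y * (Y y).2) *
          phase_mul_phase_neg z x
      rw [this]
    · rw [mul_left_comm]
  have iu' : Integrable fun y => u y * phase 1 z y := integrable_mul_phase iu 1 z
  have icu' : Integrable fun y => -conj (u y) * phase (-1) z y := integrable_mul_phase icu.neg (-1) z
  constructor
  · rintro ⟨h1, h2⟩
    have m1 : MemLp (fun y => (Y y).2) ⊤ volume := by simpa [toSnd] using memLp_pi_iff.1 h1 1
    have m0 : MemLp (fun y => (Y y).1) ⊤ volume := by
      have h3 : MemLp (fun y => phase (-1) z y * (Y y).1) ⊤ volume := by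
        simpa [toSnd] using memLp_pi_iff.1 h1 0
      refine (memLp_congr_enorm h3.1 ?_ ?_).1 h3
      · have : (fun y => (Y y).1) = fun y => phase 1 z y * (phase (-1) z y * (Y y).1) := by
          ext y; rw [← mul_assoc, phase_mul_phase_neg, one_mul]
        rw [this]
        exact AEStronglyMeasurable.mul (by fun_prop) h3.1
      · exact Eventually.of_forall fun y => by rw [enorm_mul, enorm_phase, one_mul]
    have i1 := integrable_mul_of_memLp_top iu' m1
    have i2 := integrable_mul_of_memLp_top icu' m0
    exact IsSol.of_eq d (integrable_mul_of_memLp_top hA m1) (integrable_mul_of_memLp_top hB m0)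
      (fun x => ((key i1 i2 x).1 (h2 x)).1) (fun x => ((key i1 i2 x).1 (h2 x)).2)
  · intro h
    obtain ⟨C, hC, hb⟩ := h.bdd
    have m0 : MemLp (fun y => (Y y).1) ⊤ volume := memLp_top_of_enorm_le
      h.meas.fst.aestronglyMeasurable hC fun x => (enorm_fst_le_absSum _).trans (hb x)
    have m1 : MemLp (fun y => (Y y).2) ⊤ volume := memLp_top_of_enorm_le
      h.meas.snd.aestronglyMeasurable hC fun x => (enorm_snd_le_absSum _).trans (hb x)
    have m2 : MemLp (fun y => phase (-1) z y * (Y y).1) ⊤ volume := memLp_top_of_enorm_le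
      (AEStronglyMeasurable.mul (by fun_prop) h.meas.fst.aestronglyMeasurable) hC fun x => by
        rw [enorm_mul, enorm_phase, one_mul]
        exact (enorm_fst_le_absSum _).trans (hb x)
    exact ⟨memLp_top_pair m2 m1, fun x => (key (integrable_mul_of_memLp_top iu' m1)
      (integrable_mul_of_memLp_top icu' m0) x).2 ⟨h.fst x, h.snd x⟩⟩

theorem intBot_eq (x : ℝ) (f : ℝ → Fin 2 → ℂ) : intBot x f = (1 : ℂ) • ∫ y in Iic x, f y := by
  rw [intBot, one_smul]

theorem intTop_eq (x : ℝ) (f : ℝ → Fin 2 → ℂ) : intTop x f = (-1 : ℂ) • ∫ y in Ioi x, f y := by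
  rw [intTop, neg_one_smul]

/-- The scattering coefficients are the limits of a Jost function at `+∞`. -/
theorem scat_eq_jostInf (hu : Measurable u) (iu : Integrable u) (hz : lam ^ 2 = z) :
    (scatA u lam, scatB u lam) =
      jostInf (fun y => lam * u y) (fun y => -(lam * conj (u y))) z := by
  have icu : Integrable fun y => conj (u y) := Complex.conjCLE.toContinuousLinearMap.integrable_comp iu
  have hmc : Measurable fun y => conj (u y) := Complex.continuous_conj.measurable.comp hu
  set A : ℝ → ℂ := fun y => lam * u y * phase 1 z y with hA
  set B : ℝ → ℂ := fun y => -(lam * conj (u y)) * phase (-1) z y with hB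
  have mA : Measurable A := by fun_prop
  have mB : Measurable B := by fun_prop
  have iA : Integrable A := integrable_mul_phase (iu.const_mul lam) 1 z
  have iB : Integrable B := integrable_mul_phase (icu.const_mul lam).neg (-1) z
  have f1 := fun Y => isJostFst_toFst_iff (Y := Y) (J := intBot) (lam := lam) (z := z) direction_Iic intBot_eq iu hz
  have f2 := fun Y => isJostFst_toFst_iff (Y := Y) (J := intTop) (lam := lam) (z := z) direction_Ioi intTop_eq iu hz
  have f3 := fun Y => isJostSnd_toSnd_iff (Y := Y) (J := intTop) (lam := lam) (z := z) direction_Ioi intTop_eq iu hz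
  -- The chosen Jost function does solve its equation because a solution exists; likewise for the
  -- two at +∞.
  obtain ⟨Y, hY, sY⟩ : ∃ Y, jostMinus u lam = toFst z Y ∧ IsSol 1 Iic A B (1, 0) Y := by
    obtain ⟨Y, e⟩ := exists_eq_toFst z (jostMinus u lam)
    refine ⟨Y, e, (f1 _).1 ?_⟩
    rw [← e]
    exact Classical.epsilon_spec ⟨_, (f1 _).2 (isSol_Iic_voltSol mA mB iA iB)⟩
  obtain ⟨Y₁, hY₁, sY₁⟩ : ∃ Y, jostPlusFst u lam = toFst z Y ∧ IsSol (-1) Ioi A B (1, 0) Y := by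
    obtain ⟨Y, e⟩ := exists_eq_toFst z (jostPlusFst u lam)
    refine ⟨Y, e, (f2 _).1 ?_⟩
    rw [← e]
    exact Classical.epsilon_spec ⟨_, (f2 _).2 (exists_isSol_Ioi mA mB iA iB _).choose_spec⟩
  obtain ⟨Y₂, hY₂, sY₂⟩ : ∃ Y, jostPlusSnd u lam = toSnd z Y ∧ IsSol (-1) Ioi A B (0, 1) Y := by
    obtain ⟨Y, e⟩ := exists_eq_toSnd z (jostPlusSnd u lam)
    refine ⟨Y, e, (f3 _).1 ?_⟩
    rw [← e]
    exact Classical.epsilon_spec ⟨_, (f3 _).2 (exists_isSol_Ioi mA mB iA iB _).choose_spec⟩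
  -- After removal of the phases, the scattering relation is a linear combination with constant
  -- coefficients.
  have hs : ∀ p, IsScattering u lam p ↔ Y = fun x => p.1 • Y₁ x + p.2 • Y₂ x := by
    intro p
    rw [funext_iff]
    refine forall_congr' fun x => ?_
    have ex : Complex.exp (2 * Complex.I * lam ^ 2 * (x : ℂ)) = phase 1 z x := by
      rw [phase, hz]; congr 1; push_cast; ring
    rw [hY, hY₁, hY₂, ex, funext_iff, Fin.forall_fin_two, Prod.ext_iff]
    simp only [toFst, toSnd, Pi.add_apply, Pi.smul_apply, Matrix.cons_val_zero,
      Matrix.cons_val_one, smul_eq_mul, Prod.fst_add, Prod.snd_add, Prod.smul_fst, Prod.smul_snd]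
    refine and_congr ?_ ?_
    · rw [show p.2 * phase 1 z x * (phase (-1) z x * (Y₂ x).1) = p.2 * (Y₂ x).1 by
        linear_combination (p.2 * (Y₂ x).1) * phase_mul_phase_neg z x]
    · rw [phase_mul_eq_iff, show phase (-1) z x * (p.1 * (phase 1 z x * (Y₁ x).2) +
        p.2 * phase 1 z x * (Y₂ x).2) = p.1 * (Y₁ x).2 + p.2 * (Y₂ x).2 by
        linear_combination (p.1 * (Y₁ x).2 + p.2 * (Y₂ x).2) * phase_neg_mul_phase z x]
  have hlin : ∀ p : ℂ × ℂ, IsSol (-1) Ioi A B p (fun x => p.1 • Y₁ x + p.2 • Y₂ x) := fun p => by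
    have := sY₁.smul_add_smul iA iB sY₂ direction_Ioi p.1 p.2
    simpa using this
  set p₀ : ℂ × ℂ := (1 + ∫ y, A y * (Y y).2, 0 + ∫ y, B y * (Y y).1) with hp₀
  have sY' : IsSol (-1) Ioi A B p₀ Y := sY.to_Ioi iA iB
  -- Both sides solve the equation from +∞ with data p₀, so uniqueness shows that a scattering pair
  -- exists.
  have hp : IsScattering u lam p₀ := (hs p₀).2 (sY'.eq_of_Ioi mA mB iA iB (hlin p₀))
  have hq := (hs _).1 (Classical.epsilon_spec ⟨p₀, hp⟩ :
    IsScattering u lam (Classical.epsilon (IsScattering u lam)))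
  have hq2 := hlin (Classical.epsilon (IsScattering u lam))
  rw [← hq] at hq2
  -- The chosen pair is the limit of Y at +∞, hence equals p₀. This also shows uniqueness.
  have e := tendsto_nhds_unique (hq2.tendsto_atTop iA iB) (sY'.tendsto_atTop iA iB)
  have eY : Y = jost (fun y => lam * u y) (fun y => -(lam * conj (u y))) z :=
    sY.eq_of_Iic mA mB iA iB (isSol_Iic_voltSol mA mB iA iB)
  change Classical.epsilon (IsScattering u lam) = _
  rw [e, hp₀, eY, zero_add]
  rfl

end

theorem isJostFst_congr {J : ℝ → (ℝ → Fin 2 → ℂ) → Fin 2 → ℂ} {u v : ℝ → ℂ}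
    (hJ : ∀ x f g, f =ᵐ[volume] g → J x f = J x g) (h : u =ᵐ[volume] v) (lam : ℂ) :
    IsJostFst J u lam = IsJostFst J v lam := by
  ext φ
  refine and_congr_right fun _ => forall_congr' fun x => ?_
  rw [hJ x _ _ (h.mono fun y hy => ?_)]
  simp only [hy]

theorem isJostSnd_congr {J : ℝ → (ℝ → Fin 2 → ℂ) → Fin 2 → ℂ} {u v : ℝ → ℂ}
    (hJ : ∀ x f g, f =ᵐ[volume] g → J x f = J x g) (h : u =ᵐ[volume] v) (lam : ℂ) :
    IsJostSnd J u lam = IsJostSnd J v lam := by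
  ext φ
  refine and_congr_right fun _ => forall_congr' fun x => ?_
  rw [hJ x _ _ (h.mono fun y hy => ?_)]
  simp only [hy]

/-- The potential enters only under integrals, so a continuous representative may replace it. -/
theorem isScattering_congr {u v : ℝ → ℂ} (h : u =ᵐ[volume] v) :
    IsScattering u = IsScattering v := by
  have hb : ∀ x f g, f =ᵐ[volume] g → intBot x f = intBot x g := fun x f g h =>
    integral_congr_ae (ae_restrict_of_ae h)
  have ht : ∀ x f g, f =ᵐ[volume] g → intTop x f = intTop x g := fun x f g h =>
    congrArg Neg.neg (integral_congr_ae (ae_restrict_of_ae h))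
  unfold IsScattering jostMinus jostPlusFst jostPlusSnd
  simp only [isJostFst_congr hb h, isJostFst_congr ht h, isJostSnd_congr ht h]

theorem scatA_congr {u v : ℝ → ℂ} (h : u =ᵐ[volume] v) : scatA u = scatA v := by
  unfold scatA; rw [isScattering_congr h]

theorem scatB_congr {u v : ℝ → ℂ} (h : u =ᵐ[volume] v) : scatB u = scatB v := by
  unfold scatB; rw [isScattering_congr h]

theorem aInf_congr {u v : ℝ → ℂ} (h : u =ᵐ[volume] v) : aInf u = aInf v := by
  unfold aInf
  rw [integral_congr_ae (g := fun x => ‖v x‖ ^ 2) (h.mono fun x hx => by simp only [hx])]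

/-! ### Continuous representatives of potentials -/

/-- `U` is a continuous representative of a function in `H^{1,1}` with weak derivative `v`. -/
structure Pot (U v : ℝ → ℂ) : Prop where
  ac : LocAC U v
  meas : Measurable v
  fin : normL21 U ≠ ⊤
  fin' : normL21 v ≠ ⊤

theorem normL21_congr {f g : ℝ → ℂ} (h : f =ᵐ[volume] g) : normL21 f = normL21 g :=
  eLpNorm_congr_ae (h.mono fun x hx => by simp only [weighted, hx])

theorem normH11_eq {u v : ℝ → ℂ} (h : HasWeakDeriv u v) : normH11 u = normL21 u + normL21 v := by
  refine le_antisymm (iInf₂_le v h) (le_iInf₂ fun w hw => ?_)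
  rw [normL21_congr (h.ae_unique hw)]

theorem MemH11.exists_pot {u : ℝ → ℂ} (h : MemH11 u) : ∃ U v, u =ᵐ[volume] U ∧ Pot U v := by
  obtain ⟨h1, v, hv, h2⟩ := h
  obtain ⟨U, hU, e⟩ := hv.exists_locAC
  have hm := hv.2.1.aestronglyMeasurable
  have ev := hm.ae_eq_mk
  refine ⟨U, hm.mk v, e, hU.congr_ae ev, hm.stronglyMeasurable_mk.measurable, ?_, ?_⟩
  · rw [← normL21_congr e]; exact h1.2.ne
  · rw [← normL21_congr ev]; exact h2.2.ne

theorem Pot.normH11_eq {u U v : ℝ → ℂ} (h : Pot U v) (e : u =ᵐ[volume] U) :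
    normH11 u = normL21 U + normL21 v := by
  rw [KaupNewell.normH11_eq ((h.ac.hasWeakDeriv).congr e.symm ae_eq_rfl), normL21_congr e]

theorem normL21_zero : normL21 0 = 0 := by
  have : weighted 0 = 0 := by ext x; simp [weighted]
  rw [normL21, this, eLpNorm_zero]

theorem Pot.zero : Pot 0 0 :=
  ⟨⟨locallyIntegrable_zero, fun x y => by simp⟩, measurable_const, by simp [normL21_zero],
    by simp [normL21_zero]⟩

theorem normH11_sub_eq {u u' U v U' v' : ℝ → ℂ} (h : Pot U v) (e : u =ᵐ[volume] U)
    (h' : Pot U' v') (e' : u' =ᵐ[volume] U') :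
    normH11 (u - u') = normL21 (U - U') + normL21 (v - v') := by
  have hd : HasWeakDeriv (U - U') (v - v') := (h.ac.hasWeakDeriv).sub h'.ac.hasWeakDeriv
  rw [KaupNewell.normH11_eq (hd.congr (e.sub e').symm ae_eq_rfl), normL21_congr (e.sub e')]

section

variable {U v : ℝ → ℂ}

theorem integrable_of_normL21_ne_top {f : ℝ → ℂ} (hf : Measurable f) (h : normL21 f ≠ ⊤) :
    Integrable f :=
  ⟨hf.aestronglyMeasurable, (lintegral_enorm_le_normL21 hf.aestronglyMeasurable).trans_lt
    (ENNReal.mul_lt_top (by simp) (lt_top_iff_ne_top.2 h))⟩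

theorem Pot.measurable (h : Pot U v) : Measurable U := h.ac.continuous.measurable

theorem Pot.integrable (h : Pot U v) : Integrable U := integrable_of_normL21_ne_top h.measurable h.fin

theorem Pot.integrable_deriv (h : Pot U v) : Integrable v := integrable_of_normL21_ne_top h.meas h.fin'

theorem Pot.tendsto_atBot (h : Pot U v) : Tendsto U atBot (𝓝 0) :=
  h.ac.tendsto_zero_atBot h.integrable_deriv h.integrable

theorem Pot.tendsto_atTop (h : Pot U v) : Tendsto U atTop (𝓝 0) :=
  h.ac.tendsto_zero_atTop h.integrable_deriv h.integrable

theorem Pot.eq_integral (h : Pot U v) (x : ℝ) : U x = ∫ y in Iic x, v y := by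
  rw [h.ac.eq_integral_Iic h.integrable_deriv h.tendsto_atBot x, zero_add]

theorem enorm_le_of_eq_integral (hv : Measurable v) (h : ∀ x, U x = ∫ y in Iic x, v y)
    (x : ℝ) : ‖U x‖ₑ ≤ 2 * normL21 v := by
  rw [h x]
  exact ((enorm_integral_le_lintegral_enorm _).trans (setLIntegral_le_lintegral _ _)).trans
    (lintegral_enorm_le_normL21 hv.aestronglyMeasurable)

theorem Pot.enorm_le (h : Pot U v) (x : ℝ) : ‖U x‖ₑ ≤ 2 * normL21 v :=
  enorm_le_of_eq_integral h.meas h.eq_integral x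

theorem Pot.enorm_sub_le {U' v' : ℝ → ℂ} (h : Pot U v) (h' : Pot U' v') (x : ℝ) :
    ‖U x - U' x‖ₑ ≤ 2 * normL21 (v - v') := by
  refine enorm_le_of_eq_integral (U := fun x => U x - U' x) (h.meas.sub h'.meas) (fun x => ?_) x
  rw [h.eq_integral, h'.eq_integral, ← integral_sub h.integrable_deriv.integrableOn
    h'.integrable_deriv.integrableOn]
  rfl

theorem Pot.integrable_sq (h : Pot U v) : Integrable fun x => ‖U x‖ ^ 2 := by
  have h1 : Integrable fun x => U x * U x := integrable_mul_of_enorm_le h.integrable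
    h.measurable.aestronglyMeasurable (ENNReal.mul_ne_top (by simp) h.fin')
    (Eventually.of_forall h.enorm_le)
  refine h1.norm.congr (Eventually.of_forall fun x => ?_)
  simp only [norm_mul]; ring

end

/-! ### The gauge factors -/

/-- The gauge factors `exp((s/2i) ∫_{-∞}^x |U|²)`. -/
noncomputable def gauge (s : ℝ) (U : ℝ → ℂ) (x : ℝ) : ℂ :=
  Complex.exp (s * (1 / (2 * Complex.I)) * ((∫ y in Iic x, ‖U y‖ ^ 2 : ℝ) : ℂ))

/-- The limit of a gauge factor at `+∞`. -/
noncomputable def gaugeInf (s : ℝ) (U : ℝ → ℂ) : ℂ :=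
  Complex.exp (s * (1 / (2 * Complex.I)) * ((∫ y, ‖U y‖ ^ 2 : ℝ) : ℂ))

theorem gaugeInf_one (U : ℝ → ℂ) : gaugeInf 1 U = aInf U := by
  simp [gaugeInf, aInf]

theorem norm_exp_mul_inv_two_I (s t : ℝ) :
    ‖Complex.exp (s * (1 / (2 * Complex.I)) * (t : ℂ))‖ = 1 := by
  have : (s : ℂ) * (1 / (2 * Complex.I)) * (t : ℂ) = ((-(s * t / 2) : ℝ) : ℂ) * Complex.I := by
    push_cast
    field_simp
    rw [Complex.I_sq]; ring
  rw [this, Complex.norm_exp_ofReal_mul_I]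

theorem norm_gauge (s : ℝ) (U : ℝ → ℂ) (x : ℝ) : ‖gauge s U x‖ = 1 := norm_exp_mul_inv_two_I _ _

theorem enorm_gauge (s : ℝ) (U : ℝ → ℂ) (x : ℝ) : ‖gauge s U x‖ₑ = 1 := by
  rw [← ofReal_norm, norm_gauge, ENNReal.ofReal_one]

theorem enorm_gaugeInf (s : ℝ) (U : ℝ → ℂ) : ‖gaugeInf s U‖ₑ = 1 := by
  rw [← ofReal_norm, gaugeInf, norm_exp_mul_inv_two_I, ENNReal.ofReal_one]

theorem gauge_mul_gauge (s t : ℝ) (U : ℝ → ℂ) (x : ℝ) :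
    gauge s U x * gauge t U x = gauge (s + t) U x := by
  rw [gauge, gauge, gauge, ← Complex.exp_add]; congr 1; push_cast; ring

theorem gaugeInf_mul_gaugeInf_neg (U : ℝ → ℂ) : gaugeInf 1 U * gaugeInf (-1) U = 1 := by
  rw [gaugeInf, gaugeInf, ← Complex.exp_add, ← Complex.exp_zero]; congr 1; push_cast; ring

theorem tendsto_integral_Iic_atBot {E : Type*} [NormedAddCommGroup E] [NormedSpace ℝ E] {f : ℝ → E}
    (hf : Integrable f) : Tendsto (fun x => ∫ y in Iic x, f y) atBot (𝓝 0) := by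
  have h1 := intervalIntegral_tendsto_integral_Iic 0 hf.integrableOn tendsto_id
  have h2 := h1.const_sub (∫ y in Iic 0, f y)
  rw [sub_self] at h2
  refine h2.congr fun x => ?_
  rw [← intervalIntegral.integral_Iic_sub_Iic hf.integrableOn hf.integrableOn]
  simp

theorem tendsto_integral_Iic_atTop' {f : ℝ → ℝ} (hf : Integrable f) :
    Tendsto (fun x => ∫ y in Iic x, f y) atTop (𝓝 (∫ y, f y)) :=
  (aecover_Iic (μ := (volume : Measure ℝ)) (b := fun x : ℝ => x)
    tendsto_id).integral_tendsto_of_countably_generated hf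

section

variable {U v : ℝ → ℂ}

theorem Pot.tendsto_gauge_atBot (h : Pot U v) (s : ℝ) : Tendsto (gauge s U) atBot (𝓝 1) := by
  have h1 := tendsto_integral_Iic_atBot h.integrable_sq
  have h2 : Continuous fun t : ℝ => Complex.exp (s * (1 / (2 * Complex.I)) * (t : ℂ)) := by fun_prop
  have h3 := (h2.tendsto 0).comp h1
  rw [Complex.ofReal_zero, mul_zero, Complex.exp_zero] at h3
  exact h3

theorem Pot.tendsto_gauge_atTop (h : Pot U v) (s : ℝ) :
    Tendsto (gauge s U) atTop (𝓝 (gaugeInf s U)) := by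
  have h1 := tendsto_integral_Iic_atTop' h.integrable_sq
  have h2 : Continuous fun t : ℝ => Complex.exp (s * (1 / (2 * Complex.I)) * (t : ℂ)) := by fun_prop
  exact (h2.tendsto _).comp h1

theorem Pot.locAC_gauge (h : Pot U v) (s : ℝ) : LocAC (gauge s U)
    (fun x => s * (1 / (2 * Complex.I)) * (U x * conj (U x)) * gauge s U x) := by
  have hc := h.ac.continuous
  have hd : ∀ x, HasDerivAt (fun x => ∫ y in Iic x, ‖U y‖ ^ 2) (‖U x‖ ^ 2) x := fun x => by
    have hcn : Continuous fun y => ‖U y‖ ^ 2 := by fun_prop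
    have h1 := intervalIntegral.integral_hasDerivAt_right (hcn.intervalIntegrable 0 x)
      (hcn.stronglyMeasurableAtFilter _ _) hcn.continuousAt
    refine (h1.const_add (∫ t in Iic 0, ‖U t‖ ^ 2)).congr_of_eventuallyEq
      (Eventually.of_forall fun y => ?_)
    simp only
    rw [← intervalIntegral.integral_Iic_sub_Iic h.integrable_sq.integrableOn
      h.integrable_sq.integrableOn]; ring
  have hg : ∀ x, HasDerivAt (gauge s U)
      (s * (1 / (2 * Complex.I)) * (U x * conj (U x)) * gauge s U x) x := fun x => by
    have h1 := ((hd x).ofReal_comp.const_mul ((s : ℂ) * (1 / (2 * Complex.I)))).cexp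
    refine h1.congr_deriv ?_
    rw [Complex.mul_conj, Complex.normSq_eq_norm_sq]
    simp only [gauge]; ring
  have hgc : Continuous (gauge s U) :=
    continuous_iff_continuousAt.2 fun x => (hg x).continuousAt
  exact LocAC.of_hasDerivAt (((continuous_const.mul
    (hc.mul (Complex.continuous_conj.comp hc))).mul hgc)) hg

theorem Pot.continuous_gauge (h : Pot U v) (s : ℝ) : Continuous (gauge s U) :=
  (h.locAC_gauge s).continuous

theorem locAC_phase (s z : ℝ) : LocAC (phase s z) (fun x => 2 * Complex.I * (s * z) * phase s z x) := by
  refine LocAC.of_hasDerivAt (by unfold phase; fun_prop) fun x => ?_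
  have h1 : HasDerivAt (fun t : ℝ => 2 * Complex.I * ((s : ℂ) * z) * (t : ℂ))
      (2 * Complex.I * (s * z) * 1) x := (Complex.ofRealCLM.hasDerivAt (x := x)).const_mul _
  exact h1.cexp.congr_deriv (by rw [phase]; ring)

end

/-! ### Bounded functions -/

/-- `f` is bounded. -/
def IsBdd (f : ℝ → ℂ) : Prop := ∃ C : ℝ≥0∞, C ≠ ⊤ ∧ ∀ x, ‖f x‖ₑ ≤ C

theorem IsBdd.mul {f g : ℝ → ℂ} (hf : IsBdd f) (hg : IsBdd g) : IsBdd fun x => f x * g x := by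
  obtain ⟨C, hC, h⟩ := hf
  obtain ⟨D, hD, h'⟩ := hg
  exact ⟨C * D, ENNReal.mul_ne_top hC hD, fun x => by
    rw [enorm_mul]; exact mul_le_mul' (h x) (h' x)⟩

theorem IsBdd.sub {f g : ℝ → ℂ} (hf : IsBdd f) (hg : IsBdd g) : IsBdd fun x => f x - g x := by
  obtain ⟨C, hC, h⟩ := hf
  obtain ⟨D, hD, h'⟩ := hg
  exact ⟨C + D, ENNReal.add_ne_top.2 ⟨hC, hD⟩, fun x =>
    enorm_sub_le.trans (add_le_add (h x) (h' x))⟩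

theorem isBdd_const (c : ℂ) : IsBdd fun _ => c := ⟨‖c‖ₑ, by simp, fun _ => le_rfl⟩

theorem isBdd_phase (s z : ℝ) : IsBdd (phase s z) := ⟨1, by simp, fun x => (enorm_phase s z x).le⟩

theorem isBdd_gauge (s : ℝ) (U : ℝ → ℂ) : IsBdd (gauge s U) :=
  ⟨1, by simp, fun x => (enorm_gauge s U x).le⟩

theorem IsBdd.conj_comp {f : ℝ → ℂ} (hf : IsBdd f) : IsBdd fun x => conj (f x) := by
  obtain ⟨C, hC, h⟩ := hf
  exact ⟨C, hC, fun x => by simpa using h x⟩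

theorem Pot.isBdd {U v : ℝ → ℂ} (h : Pot U v) : IsBdd U :=
  ⟨_, ENNReal.mul_ne_top (by simp) h.fin', h.enorm_le⟩

theorem tendsto_zero_mul_of_isBdd {f g : ℝ → ℂ} {l : Filter ℝ} (hf : IsBdd f)
    (hg : Tendsto g l (𝓝 0)) : Tendsto (fun x => f x * g x) l (𝓝 0) := by
  obtain ⟨C, hC, h⟩ := hf
  rw [tendsto_zero_iff_norm_tendsto_zero] at hg ⊢
  have h1 : ∀ x, ‖f x‖ ≤ C.toReal := fun x => by
    rw [← toReal_enorm]; exact ENNReal.toReal_mono hC (h x)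
  refine squeeze_zero (fun x => norm_nonneg _) (fun x => ?_) (by simpa using hg.const_mul C.toReal)
  rw [norm_mul]
  exact mul_le_mul_of_nonneg_right (h1 x) (norm_nonneg _)

/-! ### The transformations to Zakharov-Shabat systems -/

/-- Bounded functions that satisfy the differential system and have the right limits at -∞ are the
Jost solution. A change of unknowns then only needs the product rule and its limits. -/
theorem IsPotential.jost_eq_of_locAC {M : ℝ≥0} {a b P S : ℝ → ℂ} {z : ℝ} (p : IsPotential M a b)
    (hP : LocAC P fun x => a x * phase 1 z x * S x)
    (hS : LocAC S fun x => b x * phase (-1) z x * P x) (bP : IsBdd P) (bS : IsBdd S)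
    (lP : Tendsto P atBot (𝓝 1)) (lS : Tendsto S atBot (𝓝 0)) :
    jost a b z = fun x => (P x, S x) := by
  obtain ⟨C, hC, hb⟩ := bP
  obtain ⟨D, hD, hb'⟩ := bS
  refine (eq_voltSol (p.kernel z) (hP.continuous.measurable.prodMk hS.continuous.measurable)
    (ENNReal.add_ne_top.2 ⟨hC, hD⟩) (fun x => add_le_add (hb x) (hb' x)) fun x => ?_).symm
  have i1 := integrable_mul_phase_mul p.integrable_a hS.continuous.measurable hD hb' 1 z
  have i2 := integrable_mul_phase_mul p.integrable_b hP.continuous.measurable hC hb (-1) z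
  refine Prod.ext ?_ ?_
  · exact hP.eq_integral_Iic i1 lP x
  · simp only [volt, one_mul]
    exact hS.eq_integral_Iic i2 lS x

theorem IsPotential.jostInf_eq {M : ℝ≥0} {a b P S : ℝ → ℂ} {z : ℝ} {p₁ s₁ : ℂ}
    (p : IsPotential M a b)
    (hP : LocAC P fun x => a x * phase 1 z x * S x)
    (hS : LocAC S fun x => b x * phase (-1) z x * P x) (bP : IsBdd P) (bS : IsBdd S)
    (lP : Tendsto P atBot (𝓝 1)) (lS : Tendsto S atBot (𝓝 0))
    (tP : Tendsto P atTop (𝓝 p₁)) (tS : Tendsto S atTop (𝓝 s₁)) : jostInf a b z = (p₁, s₁) := by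
  have h := p.tendsto_jost z
  rw [p.jost_eq_of_locAC hP hS bP bS lP lS] at h
  exact tendsto_nhds_unique h (tP.prodMk_nhds tS)

section

variable (U v : ℝ → ℂ)

/-- The coefficients of the first Zakharov-Shabat system. -/
noncomputable def alphaFst (x : ℝ) : ℂ := 1 / (2 * Complex.I) * U x * gauge (-2) U x

/-- The coefficients of the first Zakharov-Shabat system. -/
noncomputable def betaFst (x : ℝ) : ℂ :=
  -(gauge 2 U x * (conj (v x) + conj (U x) * (U x * conj (U x)) * (1 / (2 * Complex.I))))

/-- The coefficients of the second Zakharov-Shabat system. -/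
noncomputable def alphaSnd (x : ℝ) : ℂ :=
  gauge (-2) U x * (1 / (2 * Complex.I) *
    (-v x + 1 / (2 * Complex.I) * (U x * (U x * conj (U x)))))

/-- The coefficients of the second Zakharov-Shabat system. -/
noncomputable def betaSnd (x : ℝ) : ℂ := -conj (U x) * gauge 2 U x

end

section

variable {U v : ℝ → ℂ} {M : ℝ≥0}

theorem IsPotential.locAC_fst {a b : ℝ → ℂ} (p : IsPotential M a b) (z : ℝ) :
    LocAC (fun x => (jost a b z x).1) fun x => a x * phase 1 z x * (jost a b z x).2 :=
  LocAC.of_integral_Iic (p.integrable_fst_density z) 1 (p.jost_fst z)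

theorem IsPotential.locAC_snd {a b : ℝ → ℂ} (p : IsPotential M a b) (z : ℝ) :
    LocAC (fun x => (jost a b z x).2) fun x => b x * phase (-1) z x * (jost a b z x).1 :=
  LocAC.of_integral_Iic (p.integrable_snd_density z) 0 (p.jost_snd z)

theorem IsPotential.tendsto_fst_atBot {a b : ℝ → ℂ} (p : IsPotential M a b) (z : ℝ) :
    Tendsto (fun x => (jost a b z x).1) atBot (𝓝 1) := by
  have := (tendsto_integral_Iic_atBot (p.integrable_fst_density z)).const_add 1
  rw [add_zero] at this
  exact this.congr fun x => (p.jost_fst z x).symm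

theorem IsPotential.tendsto_snd_atBot {a b : ℝ → ℂ} (p : IsPotential M a b) (z : ℝ) :
    Tendsto (fun x => (jost a b z x).2) atBot (𝓝 0) := by
  have := (tendsto_integral_Iic_atBot (p.integrable_snd_density z)).const_add 0
  rw [add_zero] at this
  exact this.congr fun x => (p.jost_snd z x).symm

theorem IsPotential.isBdd_fst {a b : ℝ → ℂ} (p : IsPotential M a b) (z : ℝ) :
    IsBdd fun x => (jost a b z x).1 :=
  ⟨_, jostBound_ne_top M, fun x => (enorm_fst_le_absSum _).trans (p.absSum_jost_le z x)⟩

theorem IsPotential.isBdd_snd {a b : ℝ → ℂ} (p : IsPotential M a b) (z : ℝ) :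
    IsBdd fun x => (jost a b z x).2 :=
  ⟨_, jostBound_ne_top M, fun x => (enorm_snd_le_absSum _).trans (p.absSum_jost_le z x)⟩

theorem exists_isPotential {a b : ℝ → ℂ} (ha : Measurable a) (hb : Measurable b)
    (ia : Integrable a) (ib : Integrable b) : ∃ M, IsPotential M a b := by
  refine ⟨(∫⁻ y, (‖a y‖ₑ + ‖b y‖ₑ)).toNNReal, ha, hb, ?_⟩
  rw [ENNReal.coe_toNNReal]
  rw [lintegral_add_left ha.enorm]
  exact ENNReal.add_ne_top.2 ⟨ia.2.ne, ib.2.ne⟩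

theorem two_I_mul_inv : 2 * Complex.I * (1 / (2 * Complex.I)) = 1 :=
  mul_one_div_cancel (by simp)

theorem Pot.exists_isPotential (h : Pot U v) (z : ℝ) :
    ∃ M, IsPotential M (fun y => z * U y) (fun y => -conj (U y)) := by
  have hm := h.measurable
  exact KaupNewell.exists_isPotential (hm.const_mul _)
    (Complex.continuous_conj.measurable.comp hm).neg (h.integrable.const_mul _)
    (Complex.conjCLE.toContinuousLinearMap.integrable_comp h.integrable).neg

theorem Pot.tendsto_conj {l : Filter ℝ} (h : Tendsto U l (𝓝 0)) :
    Tendsto (fun x => conj (U x)) l (𝓝 0) := by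
  simpa [Function.comp_def] using (Complex.continuous_conj.tendsto 0).comp h

/-- Put S̃ = 2izS - e^{-2izx}ŪP. Then zS can be expressed through S̃ and P, which removes z from the
equation of P, and in S̃' the two terms zŪP cancel. What remains on the diagonal is ±(1/2i)|U|²,
which the gauge factors with exponents -1 and 1 absorb. Since U vanishes at ±∞, the correction does
not affect the limits. -/
theorem Pot.jostInf_fst_system (h : Pot U v) (p : IsPotential M (alphaFst U) (betaFst U v)) (z : ℝ) :
    jostInf (alphaFst U) (betaFst U v) z =
      (gaugeInf (-1) U * (jostInf (fun y => z * U y) (fun y => -conj (U y)) z).1,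
        gaugeInf 1 U * (2 * Complex.I * z *
          (jostInf (fun y => z * U y) (fun y => -conj (U y)) z).2)) := by
  obtain ⟨M₀, p₀⟩ := h.exists_isPotential z
  have hp := p₀.locAC_fst z
  have hs := p₀.locAC_snd z
  have bp := p₀.isBdd_fst z
  have bs := p₀.isBdd_snd z
  have lp := p₀.tendsto_fst_atBot z
  have ls := p₀.tendsto_snd_atBot z
  have lim := p₀.tendsto_jost z
  have tp := (continuous_fst.tendsto _).comp lim
  have ts := (continuous_snd.tendsto _).comp lim
  simp only [Function.comp_def] at tp ts
  generalize jostInf (fun y => z * U y) (fun y => -conj (U y)) z = Y₁ at *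
  generalize jost (fun y => z * U y) (fun y => -conj (U y)) z = Y at *
  have g2 : ∀ x, gauge (-2) U x * gauge 1 U x = gauge (-1) U x := fun x => by
    rw [gauge_mul_gauge]; norm_num
  have g1 : ∀ x, gauge 2 U x * gauge (-1) U x = gauge 1 U x := fun x => by
    rw [gauge_mul_gauge]; norm_num
  have hk := two_I_mul_inv
  have hmid := (hs.const_mul (2 * Complex.I * z)).sub
    (((locAC_phase (-1) z).mul h.ac.conj_comp).mul hp)
  have hbb := (isBdd_phase (-1) z).mul h.isBdd.conj_comp
  have hz0 : ∀ {l : Filter ℝ}, Tendsto U l (𝓝 0) →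
      Tendsto (fun x => phase (-1) z x * conj (U x) * (Y x).1) l (𝓝 0) := fun hU => by
    refine (tendsto_zero_mul_of_isBdd ((isBdd_phase (-1) z).mul bp)
      (Pot.tendsto_conj hU)).congr fun x => ?_
    ring
  refine p.jostInf_eq (P := fun x => gauge (-1) U x * (Y x).1)
    (S := fun x => gauge 1 U x * (2 * Complex.I * z * (Y x).2 - phase (-1) z x * conj (U x) * (Y x).1))
    (((h.locAC_gauge (-1)).mul hp).congr_deriv fun x => ?_)
    (((h.locAC_gauge 1).mul hmid).congr_deriv fun x => ?_) ((isBdd_gauge _ _).mul bp)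
    ((isBdd_gauge _ _).mul (((isBdd_const _).mul bs).sub (hbb.mul bp))) ?_ ?_
    ((h.tendsto_gauge_atTop _).mul tp) ?_
  · have e := phase_mul_phase_neg z x
    rw [← g2 x, alphaFst]
    push_cast
    linear_combination (-(gauge (-2) U x * gauge 1 U x * z * U x * phase 1 z x * (Y x).2)) * hk +
      (gauge (-2) U x * gauge 1 U x * (1 / (2 * Complex.I)) * U x * conj (U x) * (Y x).1) * e
  · have e := phase_mul_phase_neg z x
    rw [betaFst]
    push_cast
    linear_combination (gauge 1 U x * z * U x * conj (U x) * (Y x).2) * hk -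
      (gauge 1 U x * z * U x * conj (U x) * (Y x).2) * e +
      ((conj (v x) + conj (U x) * (U x * conj (U x)) * (1 / (2 * Complex.I))) * phase (-1) z x *
        (Y x).1) * g1 x
  · simpa using (h.tendsto_gauge_atBot (-1)).mul lp
  · simpa using (h.tendsto_gauge_atBot 1).mul
      ((ls.const_mul (2 * Complex.I * z)).sub (hz0 h.tendsto_atBot))
  · simpa using (h.tendsto_gauge_atTop 1).mul
      ((ts.const_mul (2 * Complex.I * z)).sub (hz0 h.tendsto_atTop))

/-- Here P is corrected instead: for P̃ = P - (1/2i)Ue^{2izx}S the term zUe^{2izx}S in P' cancels.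
The same diagonal terms ±(1/2i)|U|² arise and are absorbed by the same gauge factors. The second
limit keeps no factor z. -/
theorem Pot.jostInf_snd_system (h : Pot U v) (p : IsPotential M (alphaSnd U v) (betaSnd U)) (z : ℝ) :
    jostInf (alphaSnd U v) (betaSnd U) z =
      (gaugeInf (-1) U * (jostInf (fun y => z * U y) (fun y => -conj (U y)) z).1,
        gaugeInf 1 U * (jostInf (fun y => z * U y) (fun y => -conj (U y)) z).2) := by
  obtain ⟨M₀, p₀⟩ := h.exists_isPotential z
  have hp := p₀.locAC_fst z
  have hs := p₀.locAC_snd z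
  have bp := p₀.isBdd_fst z
  have bs := p₀.isBdd_snd z
  have lp := p₀.tendsto_fst_atBot z
  have ls := p₀.tendsto_snd_atBot z
  have lim := p₀.tendsto_jost z
  have tp := (continuous_fst.tendsto _).comp lim
  have ts := (continuous_snd.tendsto _).comp lim
  simp only [Function.comp_def] at tp ts
  generalize jostInf (fun y => z * U y) (fun y => -conj (U y)) z = Y₁ at *
  generalize jost (fun y => z * U y) (fun y => -conj (U y)) z = Y at *
  have g2 : ∀ x, gauge (-2) U x * gauge 1 U x = gauge (-1) U x := fun x => by
    rw [gauge_mul_gauge]; norm_num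
  have g1 : ∀ x, gauge 2 U x * gauge (-1) U x = gauge 1 U x := fun x => by
    rw [gauge_mul_gauge]; norm_num
  have hk := two_I_mul_inv
  have hmid := hp.sub (((h.ac.mul (locAC_phase 1 z)).mul hs).const_mul (1 / (2 * Complex.I)))
  have hbb := h.isBdd.mul (isBdd_phase 1 z)
  have hz0 : ∀ {l : Filter ℝ}, Tendsto U l (𝓝 0) →
      Tendsto (fun x => 1 / (2 * Complex.I) * (U x * phase 1 z x * (Y x).2)) l (𝓝 0) := fun hU => by
    refine (tendsto_zero_mul_of_isBdd ((isBdd_const (1 / (2 * Complex.I))).mul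
      ((isBdd_phase 1 z).mul bs)) hU).congr fun x => ?_
    ring
  refine p.jostInf_eq (P := fun x => gauge (-1) U x * ((Y x).1 -
      1 / (2 * Complex.I) * (U x * phase 1 z x * (Y x).2)))
    (S := fun x => gauge 1 U x * (Y x).2)
    (((h.locAC_gauge (-1)).mul hmid).congr_deriv fun x => ?_)
    (((h.locAC_gauge 1).mul hs).congr_deriv fun x => ?_)
    ((isBdd_gauge _ _).mul (bp.sub ((isBdd_const _).mul (hbb.mul bs)))) ((isBdd_gauge _ _).mul bs)
    ?_ ?_ ?_ ((h.tendsto_gauge_atTop _).mul ts)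
  · have e := phase_mul_phase_neg z x
    rw [alphaSnd]
    push_cast
    linear_combination (gauge (-1) U x * (1 / (2 * Complex.I)) * U x * conj (U x) * (Y x).1) * e -
      (gauge (-1) U x * z * U x * phase 1 z x * (Y x).2) * hk -
      ((1 / (2 * Complex.I)) * (-v x + 1 / (2 * Complex.I) * (U x * (U x * conj (U x)))) *
        phase 1 z x * (Y x).2) * g2 x
  · have e := phase_mul_phase_neg z x
    rw [betaSnd]
    push_cast
    linear_combination (-(1 / (2 * Complex.I) * U x * conj (U x) * gauge 1 U x * (Y x).2)) * e +
      (conj (U x) * phase (-1) z x * (Y x).1 - 1 / (2 * Complex.I) * U x * conj (U x) *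
        phase 1 z x * phase (-1) z x * (Y x).2) * g1 x
  · simpa using (h.tendsto_gauge_atBot (-1)).mul (lp.sub (hz0 h.tendsto_atBot))
  · simpa using (h.tendsto_gauge_atBot 1).mul ls
  · simpa using (h.tendsto_gauge_atTop (-1)).mul (tp.sub (hz0 h.tendsto_atTop))

end

/-! ### The scattering coefficients as functions of `z` -/

/-- The limits `a` and `λ⁻¹ b` of the normalized Jost function, as functions of `z`. -/
noncomputable def scatLim (U : ℝ → ℂ) (z : ℝ) : ℂ × ℂ :=
  jostInf (fun y => z * U y) (fun y => -conj (U y)) z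

/-- Conjugation by diag(1, c⁻¹). With c = λ it turns the coefficients λu, -λū into λ²u, -ū, which
depend on z alone. -/
theorem jostInf_scale {M : ℝ≥0} {a b : ℝ → ℂ} (p : IsPotential M a b) {c : ℂ} (hc : c ≠ 0) (z : ℝ) :
    jostInf (fun y => c * a y) (fun y => c⁻¹ * b y) z =
      ((jostInf a b z).1, c⁻¹ * (jostInf a b z).2) := by
  obtain ⟨M', p'⟩ := exists_isPotential (p.meas_a.const_mul c) (p.meas_b.const_mul c⁻¹)
    (p.integrable_a.const_mul c) (p.integrable_b.const_mul c⁻¹)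
  have lim := p.tendsto_jost z
  have tp := (continuous_fst.tendsto _).comp lim
  have ts := (continuous_snd.tendsto _).comp lim
  refine p'.jostInf_eq (P := fun x => (jost a b z x).1) (S := fun x => c⁻¹ * (jost a b z x).2)
    ((p.locAC_fst z).congr_deriv fun x => ?_) (((p.locAC_snd z).const_mul c⁻¹).congr_deriv fun x => ?_)
    (p.isBdd_fst z) ((isBdd_const _).mul (p.isBdd_snd z)) (p.tendsto_fst_atBot z)
    (by simpa using (p.tendsto_snd_atBot z).const_mul c⁻¹) tp (ts.const_mul _)
  · linear_combination (-(a x * phase 1 z x * (jost a b z x).2)) * mul_inv_cancel₀ hc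
  · ring

section

variable {u U v : ℝ → ℂ}

theorem Pot.scat_eq (h : Pot U v) (e : u =ᵐ[volume] U) {lam : ℂ} {z : ℝ} (hz : lam ^ 2 = z) :
    scatA u lam = (scatLim U z).1 ∧ scatB u lam = lam * (scatLim U z).2 := by
  have h1 := scat_eq_jostInf h.measurable h.integrable hz
  rw [← scatA_congr e, ← scatB_congr e] at h1
  have hm := h.measurable
  have hcm : Measurable fun y => conj (U y) := Complex.continuous_conj.measurable.comp hm
  have hci : Integrable fun y => conj (U y) :=
    Complex.conjCLE.toContinuousLinearMap.integrable_comp h.integrable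
  obtain ⟨M, p⟩ : ∃ M, IsPotential M (fun y => lam * U y) (fun y => -(lam * conj (U y))) :=
    KaupNewell.exists_isPotential (hm.const_mul lam) (hcm.const_mul lam).neg
    (h.integrable.const_mul lam) (hci.const_mul lam).neg
  by_cases hl : lam = 0
  -- At λ = 0 the rescaling is not available, but the coefficients vanish and the limit is (1, 0).
  · subst hl
    have hz0 : z = 0 := by
      have : (z : ℂ) = 0 := by rw [← hz]; simp
      exact_mod_cast this
    subst hz0
    simp only [jostInf, zero_mul, neg_zero, integral_zero, add_zero, Prod.mk.injEq] at h1
    rw [h1.1, h1.2]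
    simp [scatLim, jostInf]
  · have h2 := jostInf_scale p hl z
    have e1 : (fun y => lam * (lam * U y)) = fun y => z * U y := by
      ext y; rw [← hz]; ring
    have e2 : (fun y => lam⁻¹ * -(lam * conj (U y))) = fun y => -conj (U y) := by
      ext y; rw [mul_neg, ← mul_assoc, inv_mul_cancel₀ hl, one_mul]
    rw [e1, e2] at h2
    rw [scatLim, h2, ← h1]
    exact ⟨rfl, by rw [← mul_assoc, mul_inv_cancel₀ hl, one_mul]⟩

theorem root_sq (z : ℝ) : root z ^ 2 = z := by
  unfold root
  split_ifs with hz
  · rw [← Complex.ofReal_pow, Real.sq_sqrt hz]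
  · rw [mul_pow, Complex.I_sq, ← Complex.ofReal_pow, Real.sq_sqrt (by linarith)]
    push_cast; ring

theorem exists_eq_ofReal_of_im_eq_zero {lam : ℂ} (h : (lam ^ 2).im = 0) : ∃ z : ℝ, lam ^ 2 = z :=
  ⟨(lam ^ 2).re, Complex.ext (by simp) (by simpa using h)⟩

theorem Pot.aSub_eq (h : Pot U v) (e : u =ᵐ[volume] U) {lam : ℂ} {z : ℝ} (hz : lam ^ 2 = z) :
    aSub u lam = (scatLim U z).1 - gaugeInf 1 U := by
  rw [aSub, (h.scat_eq e hz).1, aInf_congr e, gaugeInf_one]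

theorem Pot.lamB_eq (h : Pot U v) (e : u =ᵐ[volume] U) {lam : ℂ} {z : ℝ} (hz : lam ^ 2 = z) :
    lamB u lam = z * (scatLim U z).2 := by
  rw [lamB, (h.scat_eq e hz).2, ← hz]; ring

theorem Pot.lamInvB_eq (h : Pot U v) (e : u =ᵐ[volume] U) {lam : ℂ} {z : ℝ} (hz : lam ^ 2 = z)
    (h0 : lam ≠ 0) : lamInvB u lam = (scatLim U z).2 := by
  rw [lamInvB, (h.scat_eq e hz).2, ← mul_assoc, inv_mul_cancel₀ h0, one_mul]

theorem dependsOnSq_of_eq {f : ℂ → ℂ} {g : ℝ → ℂ} (h : ∀ lam : ℂ, ∀ z : ℝ, lam ^ 2 = z → f lam = g z) :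
    DependsOnSq f := by
  intro lam mu hl hmu
  obtain ⟨z, hz⟩ := exists_eq_ofReal_of_im_eq_zero hl
  rw [h lam z hz, h mu z (hmu.trans hz)]

/-- The only square root of 0 is 0, so the arbitrary value at λ = 0 does no harm. -/
theorem Pot.dependsOnSq_lamInvB (h : Pot U v) (e : u =ᵐ[volume] U) : DependsOnSq (lamInvB u) := by
  intro lam mu hl hmu
  obtain ⟨z, hz⟩ := exists_eq_ofReal_of_im_eq_zero hl
  by_cases h0 : lam = 0
  · subst h0
    have : mu = 0 := by simpa using hmu
    rw [this]
  · have h1 : mu ≠ 0 := by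
      rintro rfl
      exact h0 (by simpa using hmu.symm)
    rw [h.lamInvB_eq e hz h0, h.lamInvB_eq e (hmu.trans hz) h1]

theorem Pot.onZ_aSub (h : Pot U v) (e : u =ᵐ[volume] U) :
    onZ (aSub u) = fun z => (scatLim U z).1 - gaugeInf 1 U :=
  funext fun z => h.aSub_eq e (root_sq z)

theorem Pot.onZ_lamB (h : Pot U v) (e : u =ᵐ[volume] U) :
    onZ (lamB u) = fun z => z * (scatLim U z).2 :=
  funext fun z => h.lamB_eq e (root_sq z)

theorem Pot.onZ_lamInvB (h : Pot U v) (e : u =ᵐ[volume] U) :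
    onZ (lamInvB u) =ᵐ[volume] fun z => (scatLim U z).2 := by
  filter_upwards [compl_mem_ae_iff.2 (measure_singleton (μ := volume) (0 : ℝ))] with z hz
  refine h.lamInvB_eq e (root_sq z) fun h0 => hz ?_
  have := root_sq z
  rw [h0] at this
  simpa using this.symm

end

/-! ### Analytic continuation of the first scattering coefficient -/

/-- A half disc with its diameter. -/
def halfDisc (R : ℝ) : Set ℂ := {w | 0 ≤ w.im ∧ ‖w‖ < R}

/-- An open half disc. -/
def openHalfDisc (R : ℝ) : Set ℂ := {w | 0 < w.im ∧ ‖w‖ < R}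

theorem openHalfDisc_subset (R : ℝ) : openHalfDisc R ⊆ halfDisc R := fun _ h => ⟨h.1.le, h.2⟩

theorem isOpen_openHalfDisc (R : ℝ) : IsOpen (openHalfDisc R) :=
  (isOpen_lt continuous_const Complex.continuous_im).inter (isOpen_lt continuous_norm continuous_const)

/-- `f` is continuous in the half disc and holomorphic in its interior. -/
structure HoloOn (R : ℝ) (f : ℂ → ℂ) : Prop where
  cont : ContinuousOn f (halfDisc R)
  diff : DifferentiableOn ℂ f (openHalfDisc R)

theorem HoloOn.mul {R : ℝ} {f g : ℂ → ℂ} (hf : HoloOn R f) (hg : HoloOn R g) :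
    HoloOn R fun w => f w * g w := ⟨hf.cont.mul hg.cont, hf.diff.mul hg.diff⟩

theorem HoloOn.const_add {R : ℝ} {f : ℂ → ℂ} (hf : HoloOn R f) (c : ℂ) :
    HoloOn R fun w => c + f w :=
  ⟨continuousOn_const.add hf.cont, (differentiableOn_const c).add hf.diff⟩

theorem holoOn_of_differentiable (R : ℝ) {f : ℂ → ℂ} (hf : Differentiable ℂ f) : HoloOn R f :=
  ⟨hf.continuous.continuousOn, hf.differentiableOn⟩

/-- Cauchy's estimate on discs of radius r bounds the derivative in w by g/r, which is the
domination needed to differentiate under the integral. -/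
theorem differentiableOn_integral {α : Type*} [MeasurableSpace α] {μ : Measure α} {V : Set ℂ}
    (hV : IsOpen V) {G : ℂ → α → ℂ} (hm : ∀ w ∈ V, AEStronglyMeasurable (G w) μ) {g : α → ℝ}
    (hg : Integrable g μ) (hb : ∀ᵐ y ∂μ, ∀ w ∈ V, ‖G w y‖ ≤ g y)
    (hd : ∀ y, DifferentiableOn ℂ (fun w => G w y) V) :
    DifferentiableOn ℂ (fun w => ∫ y, G w y ∂μ) V := by
  intro w hw
  obtain ⟨ε, hε, hεV⟩ := Metric.isOpen_iff.1 hV w hw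
  -- Discs of radius r about points at distance less than r from w stay in V, as 2r < ε.
  set r := ε / 3 with hr
  have hr0 : 0 < r := by positivity
  have hball : ∀ w' ∈ Metric.ball w r, Metric.closedBall w' r ⊆ V := fun w' hw' y hy => by
    refine hεV ?_
    rw [Metric.mem_ball] at hw' ⊢
    rw [Metric.mem_closedBall] at hy
    calc dist y w ≤ dist y w' + dist w' w := dist_triangle _ _ _
      _ < ε := by linarith
  have hda : ∀ y, ∀ w' ∈ Metric.ball w r, HasDerivAt (fun w => G w y) (deriv (fun w => G w y) w') w' :=
    fun y w' hw' => ((hd y).differentiableAt (hV.mem_nhds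
      (hball w' hw' (Metric.mem_closedBall_self hr0.le)))).hasDerivAt
  have key := hasDerivAt_integral_of_dominated_loc_of_deriv_le (μ := μ) (F := G) (x₀ := w)
    (F' := fun w' y => deriv (fun w => G w y) w') (bound := fun y => g y / r)
    (Metric.ball_mem_nhds w hr0)
    (by filter_upwards [hV.mem_nhds hw] with w' hw' using hm w' hw')
    (hg.mono' (hm w hw) (hb.mono fun _ h => h w hw)) ?_ ?_ (hg.div_const r)
    (Eventually.of_forall hda)
  · exact key.2.differentiableAt.differentiableWithinAt
  -- The derivative in w is measurable in y as a pointwise limit of slopes.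
  · have hs : Tendsto (fun n : ℕ => w + ((r / (n + 2) : ℝ) : ℂ)) atTop (𝓝[≠] w) := by
      refine tendsto_nhdsWithin_iff.2 ⟨?_, Eventually.of_forall fun n => ?_⟩
      · have h1 : Tendsto (fun n : ℕ => r / ((n : ℝ) + 2)) atTop (𝓝 0) :=
          (tendsto_natCast_atTop_atTop.atTop_add tendsto_const_nhds).const_div_atTop r
        have h2 := ((Complex.continuous_ofReal.tendsto 0).comp h1).const_add w
        simpa using h2
      · have : (0 : ℝ) < r / ((n : ℝ) + 2) := by positivity
        simp only [mem_compl_iff, mem_singleton_iff, add_eq_left]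
        exact_mod_cast this.ne'
    have hsV : ∀ n : ℕ, w + ((r / (n + 2) : ℝ) : ℂ) ∈ V := fun n => by
      refine hball w (Metric.mem_ball_self hr0) ?_
      rw [Metric.mem_closedBall, dist_eq_norm, add_sub_cancel_left, Complex.norm_real,
        Real.norm_of_nonneg (by positivity)]
      exact div_le_self hr0.le (by linarith [(Nat.cast_nonneg n : (0 : ℝ) ≤ n)])
    refine aestronglyMeasurable_of_tendsto_ae atTop
      (f := fun (n : ℕ) y => slope (fun w => G w y) w (w + ((r / (n + 2) : ℝ) : ℂ))) (fun n => ?_)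
      (Eventually.of_forall fun y => ?_)
    · simp only [slope_def_module]
      exact ((hm _ (hsV n)).sub (hm w hw)).const_smul (w + ((r / (n + 2) : ℝ) : ℂ) - w)⁻¹
    · exact (hasDerivAt_iff_tendsto_slope.1 (hda y w (Metric.mem_ball_self hr0))).comp hs
  · filter_upwards [hb] with y hy w' hw'
    refine Complex.norm_deriv_le_of_forall_mem_sphere_norm_le hr0 ?_ fun s hs =>
      hy s (hball w' hw' (Metric.sphere_subset_closedBall hs))
    refine DifferentiableOn.diffContOnCl ((hd y).mono ?_)
    exact Metric.closure_ball_subset_closedBall.trans (hball w' hw')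

theorem HoloOn.integral {R : ℝ} {α : Type*} [MeasurableSpace α] {μ : Measure α} {G : ℂ → α → ℂ}
    (hm : ∀ w ∈ halfDisc R, AEStronglyMeasurable (G w) μ) {g : α → ℝ}
    (hg : Integrable g μ) (hb : ∀ᵐ y ∂μ, ∀ w ∈ halfDisc R, ‖G w y‖ ≤ g y)
    (h : ∀ y, HoloOn R fun w => G w y) : HoloOn R fun w => ∫ y, G w y ∂μ :=
  ⟨continuousOn_of_dominated hm (fun w hw => hb.mono fun _ h => h w hw) hg
    (Eventually.of_forall fun y => (h y).cont),
  differentiableOn_integral (isOpen_openHalfDisc R)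
    (fun w hw => hm w (openHalfDisc_subset R hw)) hg
    (hb.mono fun _ h w hw => h w (openHalfDisc_subset R hw)) fun y => (h y).diff⟩

theorem HoloOn.of_tendstoUniformlyOn {R : ℝ} {F : ℕ → ℂ → ℂ} {f : ℂ → ℂ} (h : ∀ n, HoloOn R (F n))
    (hu : TendstoUniformlyOn F f atTop (halfDisc R)) : HoloOn R f :=
  ⟨hu.continuousOn (Frequently.of_forall fun n => (h n).cont),
    (hu.mono (openHalfDisc_subset R)).tendstoLocallyUniformlyOn.differentiableOn
      (Eventually.of_forall fun n => (h n).diff) (isOpen_openHalfDisc R)⟩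

/-- The propagator of the second component. -/
noncomputable def propagator (w : ℂ) (t : ℝ) : ℂ := Complex.exp (2 * Complex.I * w * t)

/-- The modulus is e^{-2t Im w}. The upper half plane is the one where a solution started at -∞
stays bounded. -/
theorem enorm_propagator_le {w : ℂ} (hw : 0 ≤ w.im) {t : ℝ} (ht : 0 ≤ t) : ‖propagator w t‖ₑ ≤ 1 := by
  rw [propagator, ← ofReal_norm, Complex.norm_exp, ← ENNReal.ofReal_one]
  refine ENNReal.ofReal_le_ofReal (Real.exp_le_one_iff.2 ?_)
  have : (2 * Complex.I * w * t).re = -(2 * (w.im * t)) := by simp; ring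
  rw [this]
  have := mul_nonneg hw ht
  linarith

section

variable {U : ℝ → ℂ}

theorem voltKernel_propagator (hU : Measurable U) (hi : Integrable U) {w : ℂ} (hw : 0 ≤ w.im) :
    VoltKernel (propagator w) (fun y => w * U y) (fun y => -conj (U y)) where
  meas_e := by unfold propagator; fun_prop
  meas_a := hU.const_mul w
  meas_b := (Complex.continuous_conj.measurable.comp hU).neg
  le_one _ ht := enorm_propagator_le hw ht
  fin := by
    rw [lintegral_add_left (hU.const_mul w).enorm]
    refine ENNReal.add_ne_top.2 ⟨(hi.const_mul w).2.ne, ?_⟩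
    simp only [enorm_neg, RCLike.enorm_conj]
    exact hi.2.ne

/-- The analytic continuation of the first scattering coefficient. -/
noncomputable def scatExt (U : ℝ → ℂ) (w : ℂ) : ℂ :=
  1 + ∫ y, w * U y *
    (voltSol (propagator w) (fun y => w * U y) (fun y => -conj (U y)) (1, 0) y).2

/-- The mass of wU grows with |w|, so uniform bounds hold only on bounded sets. This is the reason
for half discs. -/
theorem exists_mass_bound (hi : Integrable U) (R : ℝ) :
    ∃ M : ℝ≥0, ∀ w ∈ halfDisc R, ∫⁻ y, (‖w * U y‖ₑ + ‖-conj (U y)‖ₑ) ≤ M := by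
  refine ⟨((ENNReal.ofReal R + 1) * ∫⁻ y, ‖U y‖ₑ).toNNReal, fun w hw => ?_⟩
  rw [ENNReal.coe_toNNReal (ENNReal.mul_ne_top (by simp) hi.2.ne), ← lintegral_const_mul' _ _ (by simp)]
  refine lintegral_mono fun y => ?_
  rw [enorm_neg, RCLike.enorm_conj, enorm_mul, add_mul, one_mul]
  gcongr
  rw [← ofReal_norm]
  exact ENNReal.ofReal_le_ofReal hw.2.le

theorem exists_picard_bound (hU : Measurable U) (hi : Integrable U) (R : ℝ) :
    ∃ C : ℝ≥0, ∀ w ∈ halfDisc R, ∀ n x,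
      edist (picard (propagator w) (fun y => w * U y) (fun y => -conj (U y)) (1, 0) n x)
        (voltSol (propagator w) (fun y => w * U y) (fun y => -conj (U y)) (1, 0) x) ≤ C * 2⁻¹ ^ n ∧
      absSum (picard (propagator w) (fun y => w * U y) (fun y => -conj (U y)) (1, 0) n x) ≤ C ∧
      absSum (voltSol (propagator w) (fun y => w * U y) (fun y => -conj (U y)) (1, 0) x) ≤ C := by
  obtain ⟨M, hM⟩ := exists_mass_bound hi R
  set E := ENNReal.ofReal (Real.exp (2 * M)) with hE
  have hEt : 8 * E ≠ ⊤ := ENNReal.mul_ne_top (by simp) ENNReal.ofReal_ne_top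
  refine ⟨(8 * E).toNNReal, fun w hw n x => ?_⟩
  rw [ENNReal.coe_toNNReal hEt]
  have k := voltKernel_propagator hU hi hw.1
  have h0 : absSum ((1 : ℂ), (0 : ℂ)) = 1 := by simp [absSum]
  have h1 := edist_picard_voltSol_le k (1, 0) n x
  have h2 := absSum_voltSol_le' k (1, 0) (hM w hw) x
  rw [h0] at h1 h2
  have h3 : edist (picard (propagator w) (fun y => w * U y) (fun y => -conj (U y)) (1, 0) n x)
      (voltSol (propagator w) (fun y => w * U y) (fun y => -conj (U y)) (1, 0) x) ≤
      2 * E * 2⁻¹ ^ n := by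
    refine h1.trans ?_
    gcongr
    rw [one_mul]
    exact gronWeight_le (hM w hw) x
  have h4 : (2⁻¹ : ℝ≥0∞) ^ n ≤ 1 := pow_le_one' (by simp) n
  refine ⟨h3.trans (by gcongr; norm_num), ?_, h2.trans (by rw [mul_one]; gcongr; norm_num)⟩
  have h5 := absSum_sub_le_edist
    (picard (propagator w) (fun y => w * U y) (fun y => -conj (U y)) (1, 0) n x)
    (voltSol (propagator w) (fun y => w * U y) (fun y => -conj (U y)) (1, 0) x)
  have h6 := absSum_add_le
    (picard (propagator w) (fun y => w * U y) (fun y => -conj (U y)) (1, 0) n x -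
      voltSol (propagator w) (fun y => w * U y) (fun y => -conj (U y)) (1, 0) x)
    (voltSol (propagator w) (fun y => w * U y) (fun y => -conj (U y)) (1, 0) x)
  rw [sub_add_cancel] at h6
  calc _ ≤ 2 * (2 * E * 2⁻¹ ^ n) + 4 * 1 * E :=
        h6.trans (add_le_add (h5.trans (by gcongr)) h2)
    _ ≤ 2 * (2 * E * 1) + 4 * 1 * E := by gcongr
    _ = 8 * E := by ring

theorem norm_le_of_enorm_le {z : ℂ} {C : ℝ≥0} (h : ‖z‖ₑ ≤ C) : ‖z‖ ≤ C := by
  rw [← toReal_enorm]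
  exact ENNReal.toReal_le_coe_of_le_coe h

/-- Induction on n: each iterate is an integral of functions holomorphic in w, dominated uniformly
on the half disc because the previous iterate is bounded there and the propagator is at most 1 for y
≤ x. -/
theorem holoOn_picard (hU : Measurable U) (hi : Integrable U) (R : ℝ) (n : ℕ) (x : ℝ) :
    HoloOn R (fun w => (picard (propagator w) (fun y => w * U y) (fun y => -conj (U y)) (1, 0) n x).1) ∧
    HoloOn R (fun w => (picard (propagator w) (fun y => w * U y) (fun y => -conj (U y)) (1, 0) n x).2) := by
  obtain ⟨C, hC⟩ := exists_picard_bound hU hi R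
  have hUc : Measurable fun y => conj (U y) := Complex.continuous_conj.measurable.comp hU
  induction n generalizing x with
  | zero => exact ⟨holoOn_of_differentiable R (by simp [picard]), holoOn_of_differentiable R (by simp [picard])⟩
  | succ n ih =>
    have hm : ∀ w ∈ halfDisc R, Measurable
        (picard (propagator w) (fun y => w * U y) (fun y => -conj (U y)) (1, 0) n) := fun w hw => by
      have k := voltKernel_propagator hU hi hw.1
      exact measurable_picard' k.meas_e k.meas_a k.meas_b n
    constructor
    · refine HoloOn.const_add (HoloOn.integral (g := fun y => R * ‖U y‖ * C) (fun w hw => ?_)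
        ((hi.norm.const_mul R).mul_const _).integrableOn (Eventually.of_forall fun y w hw => ?_)
        fun y => ?_) 1
      · exact ((hU.const_mul w).mul (hm w hw).snd).aestronglyMeasurable
      · rw [norm_mul, norm_mul]
        have h2 := norm_le_of_enorm_le ((enorm_snd_le_absSum _).trans (hC w hw n y).2.1)
        have := hw.2.le
        have : 0 ≤ R := (norm_nonneg w).trans this
        gcongr
      · exact ((holoOn_of_differentiable R differentiable_id).mul
          (holoOn_of_differentiable R (differentiable_const (U y)))).mul (ih y).2
    · refine HoloOn.const_add (HoloOn.integral (g := fun y => 1 * (‖U y‖ * C)) (fun w hw => ?_)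
        ((hi.norm.mul_const _).const_mul _).integrableOn ?_
        fun y => ?_) 0
      · refine Measurable.aestronglyMeasurable (Measurable.mul ?_ (hUc.neg.mul (hm w hw).fst))
        unfold propagator; fun_prop
      · filter_upwards [ae_restrict_mem measurableSet_Iic] with y hy w hw
        rw [norm_mul, norm_mul, norm_neg, RCLike.norm_conj]
        have h1 := norm_le_of_enorm_le ((enorm_fst_le_absSum _).trans (hC w hw n y).2.1)
        have h2 : ‖propagator w (x - y)‖ ≤ (1 : ℝ≥0) :=
          norm_le_of_enorm_le (enorm_propagator_le hw.1 (sub_nonneg.2 hy))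
        have h3 : ‖propagator w (x - y)‖ ≤ 1 := h2
        gcongr
      · refine HoloOn.mul (holoOn_of_differentiable R ?_)
          ((holoOn_of_differentiable R (differentiable_const (-conj (U y)))).mul (ih y).1)
        unfold propagator; fun_prop

theorem holoOn_scatExt (hU : Measurable U) (hi : Integrable U) (R : ℝ) : HoloOn R (scatExt U) := by
  obtain ⟨C, hC⟩ := exists_picard_bound hU hi R
  refine HoloOn.of_tendstoUniformlyOn (F := fun n w => 1 + ∫ y, w * U y *
    (picard (propagator w) (fun y => w * U y) (fun y => -conj (U y)) (1, 0) n y).2) (fun n => ?_) ?_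
  · refine HoloOn.const_add (HoloOn.integral (g := fun y => R * ‖U y‖ * C) (fun w hw => ?_)
      ((hi.norm.const_mul R).mul_const _) (Eventually.of_forall fun y w hw => ?_)
      fun y => ?_) 1
    · have k := voltKernel_propagator hU hi hw.1
      exact ((hU.const_mul w).mul
        (measurable_picard' k.meas_e k.meas_a k.meas_b n).snd).aestronglyMeasurable
    · rw [norm_mul, norm_mul]
      have h2 := norm_le_of_enorm_le ((enorm_snd_le_absSum _).trans (hC w hw n y).2.1)
      have := hw.2.le
      have : 0 ≤ R := (norm_nonneg w).trans this
      gcongr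
    · exact ((holoOn_of_differentiable R differentiable_id).mul
        (holoOn_of_differentiable R (differentiable_const (U y)))).mul (holoOn_picard hU hi R n y).2
  · have hlim : Tendsto (fun n : ℕ => ENNReal.ofReal R * (∫⁻ y, ‖U y‖ₑ) * (C * 2⁻¹ ^ n)) atTop (𝓝 0) := by
      have h1 := ENNReal.tendsto_pow_atTop_nhds_zero_of_lt_one (r := 2⁻¹) (by simp)
      have h2 := ENNReal.Tendsto.const_mul (a := ENNReal.ofReal R * (∫⁻ y, ‖U y‖ₑ) * C) h1
        (Or.inr (ENNReal.mul_ne_top (ENNReal.mul_ne_top (by simp) hi.2.ne) (by simp)))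
      rw [mul_zero] at h2
      exact h2.congr fun n => by ring
    rw [EMetric.tendstoUniformlyOn_iff]
    intro ε hε
    filter_upwards [hlim.eventually (gt_mem_nhds hε)] with n hn w hw
    refine lt_of_le_of_lt ?_ hn
    have k := voltKernel_propagator hU hi hw.1
    have i1 : Integrable fun y => w * U y *
        (voltSol (propagator w) (fun y => w * U y) (fun y => -conj (U y)) (1, 0) y).2 :=
      integrable_mul_of_enorm_le k.integrable_a (measurable_voltSol' k _).snd.aestronglyMeasurable
        ENNReal.coe_ne_top (Eventually.of_forall fun y =>
          (enorm_snd_le_absSum _).trans (hC w hw n y).2.2)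
    have i2 : Integrable fun y => w * U y *
        (picard (propagator w) (fun y => w * U y) (fun y => -conj (U y)) (1, 0) n y).2 :=
      integrable_mul_of_enorm_le k.integrable_a
        (measurable_picard' k.meas_e k.meas_a k.meas_b n).snd.aestronglyMeasurable
        ENNReal.coe_ne_top (Eventually.of_forall fun y =>
          (enorm_snd_le_absSum _).trans (hC w hw n y).2.1)
    rw [edist_comm, edist_eq_enorm_sub, scatExt, add_sub_add_left_eq_sub, ← integral_sub i2 i1]
    refine (enorm_integral_le_lintegral_enorm _).trans ?_
    rw [mul_right_comm, mul_assoc, ← mul_assoc,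
      ← lintegral_const_mul' _ _ (ENNReal.mul_ne_top (by simp)
        (ENNReal.mul_ne_top (by simp) (by finiteness)))]
    refine lintegral_mono fun y => ?_
    rw [← mul_sub, enorm_mul, enorm_mul]
    have h1 : ‖w‖ₑ ≤ ENNReal.ofReal R := by
      rw [← ofReal_norm]; exact ENNReal.ofReal_le_ofReal hw.2.le
    have h2 := (hC w hw n y).1
    rw [Prod.edist_eq] at h2
    have h3 := (le_max_right _ _).trans h2
    rw [edist_eq_enorm_sub] at h3
    calc _ ≤ ENNReal.ofReal R * ‖U y‖ₑ * (C * 2⁻¹ ^ n) := by gcongr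
      _ = _ := by ring

theorem continuousOn_scatExt (hU : Measurable U) (hi : Integrable U) :
    ContinuousOn (scatExt U) {w | 0 ≤ w.im} := fun w hw => by
  have h := (holoOn_scatExt hU hi (‖w‖ + 1)).cont w ⟨hw, by linarith⟩
  refine h.mono_of_mem_nhdsWithin ?_
  exact inter_mem self_mem_nhdsWithin (mem_nhdsWithin_of_mem_nhds
    ((isOpen_lt continuous_norm continuous_const).mem_nhds (by simp)))

theorem differentiableOn_scatExt (hU : Measurable U) (hi : Integrable U) :
    DifferentiableOn ℂ (scatExt U) {w | 0 < w.im} := fun w hw =>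
  ((holoOn_scatExt hU hi (‖w‖ + 1)).diff.differentiableAt
    ((isOpen_openHalfDisc _).mem_nhds ⟨hw, by linarith⟩)).differentiableWithinAt

/-- On the real axis the phase may be moved from the propagator into the coefficients: (P,
e^{2izx}S) solves the system with propagator, and uniqueness applies. -/
theorem scatExt_ofReal (hU : Measurable U) (hi : Integrable U) (z : ℝ) :
    scatExt U z = (scatLim U z).1 := by
  have k := voltKernel_propagator hU hi (w := z) (by simp)
  obtain ⟨M, p⟩ := exists_isPotential k.meas_a k.meas_b k.integrable_a k.integrable_b
  set Y := jost (fun y => z * U y) (fun y => -conj (U y)) z with hY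
  have hm := p.measurable_jost_left z
  have e : (fun x => ((Y x).1, phase 1 z x * (Y x).2)) =
      voltSol (propagator z) (fun y => z * U y) (fun y => -conj (U y)) (1, 0) := by
    refine eq_voltSol k (hm.fst.prodMk (Measurable.mul (by fun_prop) hm.snd)) (jostBound_ne_top M)
      (fun x => ?_) fun x => Prod.ext ?_ ?_
    · refine le_of_eq_of_le ?_ (p.absSum_jost_le z x)
      simp [absSum, enorm_phase, hY]
    · simp only [volt]
      rw [hY, p.jost_fst]
      simp only [mul_assoc]
    · simp only [volt]
      rw [hY, p.jost_snd, zero_add, zero_add, ← integral_const_mul]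
      congr 1; ext y
      have : propagator z (x - y) = phase 1 z x * phase (-1) z y := by
        rw [propagator, phase, phase, ← Complex.exp_add]; congr 1; push_cast; ring
      rw [this]; ring
  rw [scatExt, ← e, scatLim, jostInf]
  simp only [mul_assoc, hY]

end

theorem Pot.exists_extension {u U v : ℝ → ℂ} (h : Pot U v) (e : u =ᵐ[volume] U) :
    ∃ A : ℂ → ℂ, ContinuousOn A {z | 0 ≤ z.im} ∧ DifferentiableOn ℂ A {z | 0 < z.im} ∧
      ∀ lam : ℂ, (lam ^ 2).im = 0 → A (lam ^ 2) = scatA u lam := by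
  refine ⟨scatExt U, continuousOn_scatExt h.measurable h.integrable,
    differentiableOn_scatExt h.measurable h.integrable, fun lam hl => ?_⟩
  obtain ⟨z, hz⟩ := exists_eq_ofReal_of_im_eq_zero hl
  rw [hz, scatExt_ofReal h.measurable h.integrable, (h.scat_eq e hz).1]

theorem exists_conj_extension {f : ℂ → ℂ} (h : ∃ A : ℂ → ℂ, ContinuousOn A {z | 0 ≤ z.im} ∧
    DifferentiableOn ℂ A {z | 0 < z.im} ∧ ∀ lam : ℂ, (lam ^ 2).im = 0 → A (lam ^ 2) = f lam) :
    ∃ A : ℂ → ℂ, ContinuousOn A {z | z.im ≤ 0} ∧ DifferentiableOn ℂ A {z | z.im < 0} ∧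
      ∀ lam : ℂ, (lam ^ 2).im = 0 → A (lam ^ 2) = conj (f (conj lam)) := by
  obtain ⟨A, h1, h2, h3⟩ := h
  refine ⟨fun z => conj (A (conj z)), ?_, fun z hz => ?_, fun lam hl => ?_⟩
  · refine Complex.continuous_conj.comp_continuousOn (h1.comp Complex.continuous_conj.continuousOn
      fun z hz => ?_)
    simpa using hz
  · have hz' : 0 < (conj z).im := by simpa using hz
    have hd : DifferentiableAt ℂ A (conj z) := h2.differentiableAt
      ((isOpen_lt continuous_const Complex.continuous_im).mem_nhds hz')
    have := hd.conj_conj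
    simp only [Complex.conj_conj] at this
    exact this.differentiableWithinAt
  · have hc : conj (lam ^ 2) = conj lam ^ 2 := map_pow _ _ _
    rw [← h3 (conj lam) (by rw [← hc]; simpa [-map_pow] using hl), ← hc]

/-! ### Lipschitz estimates for products -/

/-- Two functions with supremum norm at most `K` and distance at most `K * D`. -/
structure LipInf (K D : ℝ≥0) (f f' : ℝ → ℂ) : Prop where
  meas : Measurable f
  meas' : Measurable f'
  le : ∀ x, ‖f x‖ₑ ≤ K
  le' : ∀ x, ‖f' x‖ₑ ≤ K
  sub_le : ∀ x, ‖f x - f' x‖ₑ ≤ K * D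

/-- Two functions with weighted `L²` norm at most `K` and distance at most `K * D`. -/
structure LipTwo (ρ : ℝ → ℂ) (K D : ℝ≥0) (f f' : ℝ → ℂ) : Prop where
  meas : Measurable f
  meas' : Measurable f'
  le : eLpNorm (fun x => ρ x * f x) 2 volume ≤ K
  le' : eLpNorm (fun x => ρ x * f' x) 2 volume ≤ K
  sub_le : eLpNorm (fun x => ρ x * (f x - f' x)) 2 volume ≤ K * D

theorem eLpNorm_two_le_mul {F G : ℝ → ℂ} {K : ℝ≥0} (h : ∀ x, ‖F x‖ₑ ≤ K * ‖G x‖ₑ) :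
    eLpNorm F 2 volume ≤ K * eLpNorm G 2 volume := by
  refine (eLpNorm_le_nnreal_smul_eLpNorm_of_ae_le_mul (c := K) (g := G)
    (Eventually.of_forall fun x => ?_) 2).trans_eq rfl
  have := h x
  simp only [enorm_eq_nnnorm] at this
  exact_mod_cast this

section

variable {ρ : ℝ → ℂ} {K K' D : ℝ≥0} {f f' g g' : ℝ → ℂ}

theorem enorm_mul_sub_mul_le {a b a' b' : ℂ} {A B E F : ℝ≥0∞} (ha : ‖a‖ₑ ≤ A) (hb : ‖b'‖ₑ ≤ B)
    (h1 : ‖a - a'‖ₑ ≤ E) (h2 : ‖b - b'‖ₑ ≤ F) : ‖a * b - a' * b'‖ₑ ≤ A * F + E * B := by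
  have : a * b - a' * b' = a * (b - b') + (a - a') * b' := by ring
  rw [this]
  refine (enorm_add_le _ _).trans ?_
  rw [enorm_mul, enorm_mul]
  gcongr

/-- The difference of products is at most K·K'D + KD·K', whence the factor 2. One constant serves
for size and distance, so that such pairs can be multiplied repeatedly. -/
theorem LipInf.mul (hf : LipInf K D f f') (hg : LipInf K' D g g') :
    LipInf (2 * (K * K')) D (fun x => f x * g x) (fun x => f' x * g' x) where
  meas := hf.meas.mul hg.meas
  meas' := hf.meas'.mul hg.meas'
  le x := by
    rw [enorm_mul]
    refine (mul_le_mul' (hf.le x) (hg.le x)).trans ?_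
    push_cast
    exact le_mul_of_one_le_left' one_le_two
  le' x := by
    rw [enorm_mul]
    refine (mul_le_mul' (hf.le' x) (hg.le' x)).trans ?_
    push_cast
    exact le_mul_of_one_le_left' one_le_two
  sub_le x := by
    refine (enorm_mul_sub_mul_le (hf.le x) (hg.le' x) (hf.sub_le x) (hg.sub_le x)).trans_eq ?_
    push_cast; ring

theorem LipInf.const (c : ℂ) (D : ℝ≥0) : LipInf ‖c‖₊ D (fun _ => c) (fun _ => c) where
  meas := measurable_const
  meas' := measurable_const
  le _ := le_rfl
  le' _ := le_rfl
  sub_le _ := by simp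

theorem LipInf.conj_comp (hf : LipInf K D f f') :
    LipInf K D (fun x => conj (f x)) (fun x => conj (f' x)) where
  meas := Complex.continuous_conj.measurable.comp hf.meas
  meas' := Complex.continuous_conj.measurable.comp hf.meas'
  le x := by simpa using hf.le x
  le' x := by simpa using hf.le' x
  sub_le x := by rw [← map_sub, RCLike.enorm_conj]; exact hf.sub_le x

theorem LipTwo.conj_comp (hf : LipTwo ρ K D f f') :
    LipTwo ρ K D (fun x => conj (f x)) (fun x => conj (f' x)) := by
  have e : ∀ F : ℝ → ℂ, eLpNorm (fun x => ρ x * conj (F x)) 2 volume =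
      eLpNorm (fun x => ρ x * F x) 2 volume := fun F =>
    eLpNorm_congr_enorm_ae (Eventually.of_forall fun x => by simp [enorm_mul])
  refine ⟨Complex.continuous_conj.measurable.comp hf.meas,
    Complex.continuous_conj.measurable.comp hf.meas', ?_, ?_, ?_⟩
  · rw [e]; exact hf.le
  · rw [e]; exact hf.le'
  · simp only [← map_sub]
    rw [e fun x => f x - f' x]; exact hf.sub_le

theorem LipTwo.neg (hf : LipTwo ρ K D f f') : LipTwo ρ K D (fun x => -f x) (fun x => -f' x) := by
  have e : ∀ F : ℝ → ℂ, eLpNorm (fun x => ρ x * -F x) 2 volume =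
      eLpNorm (fun x => ρ x * F x) 2 volume := fun F =>
    eLpNorm_congr_enorm_ae (Eventually.of_forall fun x => by simp [enorm_mul])
  refine ⟨hf.meas.neg, hf.meas'.neg, ?_, ?_, ?_⟩
  · rw [e]; exact hf.le
  · rw [e]; exact hf.le'
  · have : ∀ x, -f x - -f' x = -(f x - f' x) := fun x => by ring
    simp only [this]
    rw [e fun x => f x - f' x]; exact hf.sub_le

theorem LipTwo.add (hρ : Measurable ρ) (hf : LipTwo ρ K D f f') (hg : LipTwo ρ K' D g g') :
    LipTwo ρ (K + K') D (fun x => f x + g x) (fun x => f' x + g' x) := by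
  have e : ∀ {F G : ℝ → ℂ}, Measurable F → Measurable G → eLpNorm (fun x => ρ x * (F x + G x)) 2 volume ≤
      eLpNorm (fun x => ρ x * F x) 2 volume + eLpNorm (fun x => ρ x * G x) 2 volume :=
    fun {F G} hF hG => by
      simp only [mul_add]
      exact eLpNorm_add_le (hρ.mul hF).aestronglyMeasurable (hρ.mul hG).aestronglyMeasurable one_le_two
  refine ⟨hf.meas.add hg.meas, hf.meas'.add hg.meas', ?_, ?_, ?_⟩
  · push_cast
    exact (e hf.meas hg.meas).trans (add_le_add hf.le hg.le)
  · push_cast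
    exact (e hf.meas' hg.meas').trans (add_le_add hf.le' hg.le')
  · have : ∀ x, f x + g x - (f' x + g' x) = (f x - f' x) + (g x - g' x) := fun x => by ring
    simp only [this]
    push_cast
    rw [add_mul]
    exact (e (hf.meas.sub hf.meas') (hg.meas.sub hg.meas')).trans (add_le_add hf.sub_le hg.sub_le)

theorem LipInf.mul_two (hρ : Measurable ρ) (hf : LipInf K D f f') (hg : LipTwo ρ K' D g g') :
    LipTwo ρ (2 * (K * K')) D (fun x => f x * g x) (fun x => f' x * g' x) := by
  have e : ∀ {F G : ℝ → ℂ} {L : ℝ≥0}, (∀ x, ‖F x‖ₑ ≤ L) → eLpNorm (fun x => ρ x * (F x * G x)) 2 volume ≤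
      L * eLpNorm (fun x => ρ x * G x) 2 volume := fun {F G L} hF =>
    eLpNorm_two_le_mul fun x => by
      rw [mul_left_comm, enorm_mul]
      gcongr
      exact hF x
  refine ⟨hf.meas.mul hg.meas, hf.meas'.mul hg.meas', ?_, ?_, ?_⟩
  · refine (e hf.le).trans ((mul_le_mul' le_rfl hg.le).trans ?_)
    push_cast
    exact le_mul_of_one_le_left' one_le_two
  · refine (e hf.le').trans ((mul_le_mul' le_rfl hg.le').trans ?_)
    push_cast
    exact le_mul_of_one_le_left' one_le_two
  · have : ∀ x, ρ x * (f x * g x - f' x * g' x) =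
        ρ x * (f x * (g x - g' x)) + ρ x * ((f x - f' x) * g' x) := fun x => by ring
    simp only [this]
    refine (eLpNorm_add_le ?_ ?_ one_le_two).trans ((add_le_add (e hf.le)
      (e (L := K * D) fun x => by simpa using hf.sub_le x)).trans ?_)
    · exact (hρ.mul (hf.meas.mul (hg.meas.sub hg.meas'))).aestronglyMeasurable
    · exact (hρ.mul ((hf.meas.sub hf.meas').mul hg.meas')).aestronglyMeasurable
    · calc _ ≤ (K : ℝ≥0∞) * (K' * D) + (K * D : ℝ≥0) * K' := by
            gcongr
            · exact hg.sub_le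
            · exact hg.le'
        _ = _ := by push_cast; ring

theorem LipTwo.congr {F F' : ℝ → ℂ} (h : LipTwo ρ K D f f') (e : ∀ x, F x = f x)
    (e' : ∀ x, F' x = f' x) : LipTwo ρ K D F F' := by
  rwa [funext e, funext e']

end

/-! ### The coefficients of the Zakharov-Shabat systems -/

/-- Two potentials of norm at most `R` and distance at most `D`. -/
structure PotPair (R D : ℝ≥0) (U v U' v' : ℝ → ℂ) : Prop where
  fst : Pot U v
  snd : Pot U' v'
  le : normL21 U + normL21 v ≤ R
  le' : normL21 U' + normL21 v' ≤ R
  sub_le : normL21 (U - U') + normL21 (v - v') ≤ D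

/-- The weight of `L^{2,1}`. -/
noncomputable def bracket (x : ℝ) : ℂ := (Real.sqrt (1 + x ^ 2) : ℂ)

theorem measurable_bracket : Measurable bracket := by unfold bracket; fun_prop

section

variable {R D : ℝ≥0} {U v U' v' : ℝ → ℂ}

/-- With the summand 1 the constant is at least 1, so that it also covers the distance D when R is
small. -/
theorem PotPair.lipTwo (h : PotPair R D U v U' v') : LipTwo bracket (R + 1) D U U' where
  meas := h.fst.measurable
  meas' := h.snd.measurable
  le := (le_self_add.trans h.le).trans (by push_cast; exact le_self_add)
  le' := (le_self_add.trans h.le').trans (by push_cast; exact le_self_add)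
  sub_le := (le_self_add.trans h.sub_le).trans (le_mul_of_one_le_left' (by push_cast; exact le_add_self))

theorem PotPair.lipTwo_deriv (h : PotPair R D U v U' v') : LipTwo bracket (R + 1) D v v' where
  meas := h.fst.meas
  meas' := h.snd.meas
  le := (le_add_self.trans h.le).trans (by push_cast; exact le_self_add)
  le' := (le_add_self.trans h.le').trans (by push_cast; exact le_self_add)
  sub_le := (le_add_self.trans h.sub_le).trans (le_mul_of_one_le_left' (by push_cast; exact le_add_self))

theorem PotPair.lipInf (h : PotPair R D U v U' v') : LipInf (2 * (R + 1)) D U U' where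
  meas := h.fst.measurable
  meas' := h.snd.measurable
  le x := (h.fst.enorm_le x).trans (by
    push_cast; gcongr; exact h.lipTwo_deriv.le.trans (by push_cast; exact le_rfl))
  le' x := (h.snd.enorm_le x).trans (by
    push_cast; gcongr; exact h.lipTwo_deriv.le'.trans (by push_cast; exact le_rfl))
  sub_le x := (h.fst.enorm_sub_le h.snd x).trans (by
    push_cast; rw [mul_assoc]; gcongr; exact h.lipTwo_deriv.sub_le.trans (by push_cast; exact le_rfl))

theorem PotPair.lintegral_sq_sub_le (h : PotPair R D U v U' v') :
    ∫⁻ y, ‖‖U y‖ ^ 2 - ‖U' y‖ ^ 2‖ₑ ≤ 8 * (R + 1) * D := by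
  have e : ∀ y, ‖‖U y‖ ^ 2 - ‖U' y‖ ^ 2‖ₑ ≤ 4 * (R + 1) * ‖(U - U') y‖ₑ := fun y => by
    have h1 : ‖‖U y‖ ^ 2 - ‖U' y‖ ^ 2‖ ≤ (‖U y‖ + ‖U' y‖) * ‖(U - U') y‖ := by
      rw [sq_sub_sq, norm_mul, Real.norm_of_nonneg (by positivity)]
      gcongr
      exact abs_norm_sub_norm_le _ _
    rw [← ofReal_norm]
    refine (ENNReal.ofReal_le_ofReal h1).trans ?_
    rw [ENNReal.ofReal_mul (by positivity), ENNReal.ofReal_add (norm_nonneg _) (norm_nonneg _),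
      ofReal_norm, ofReal_norm, ofReal_norm]
    gcongr
    refine (add_le_add (h.lipInf.le y) (h.lipInf.le' y)).trans_eq ?_
    push_cast; ring
  refine (lintegral_mono e).trans ?_
  rw [lintegral_const_mul' _ _ (by finiteness)]
  have h2 := lintegral_enorm_le_normL21 (h.fst.measurable.sub h.snd.measurable).aestronglyMeasurable
  calc _ ≤ 4 * ((R : ℝ≥0∞) + 1) * (2 * D) := by
        gcongr
        refine h2.trans ?_
        gcongr
        exact le_self_add.trans h.sub_le
    _ = _ := by ring

theorem norm_exp_sub_exp_le (s t t' : ℝ) :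
    ‖Complex.exp (s * (1 / (2 * Complex.I)) * (t : ℂ)) -
      Complex.exp (s * (1 / (2 * Complex.I)) * (t' : ℂ))‖ ≤ |s| * |t - t'| := by
  have e : ∀ t : ℝ, (s : ℂ) * (1 / (2 * Complex.I)) * (t : ℂ) = Complex.I * ((-(s * t / 2) : ℝ) : ℂ) := by
    intro t
    push_cast
    field_simp
    rw [Complex.I_sq]; ring
  have e2 : Complex.exp (Complex.I * ((-(s * t / 2) : ℝ) : ℂ)) -
      Complex.exp (Complex.I * ((-(s * t' / 2) : ℝ) : ℂ)) =
      Complex.exp (Complex.I * ((-(s * t' / 2) : ℝ) : ℂ)) *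
        (Complex.exp (Complex.I * ((-(s * (t - t') / 2) : ℝ) : ℂ)) - 1) := by
    rw [mul_sub, ← Complex.exp_add, mul_one]
    congr 2
    push_cast; ring
  rw [e, e, e2, norm_mul, mul_comm Complex.I, Complex.norm_exp_ofReal_mul_I, one_mul]
  refine (Real.norm_exp_I_mul_ofReal_sub_one_le).trans ?_
  rw [Real.norm_eq_abs, abs_neg, abs_div, abs_mul, abs_two]
  have : 0 ≤ |s| * |t - t'| := by positivity
  linarith

theorem enorm_exp_sub_exp_le (s t t' : ℝ) :
    ‖Complex.exp (s * (1 / (2 * Complex.I)) * (t : ℂ)) -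
      Complex.exp (s * (1 / (2 * Complex.I)) * (t' : ℂ))‖ₑ ≤ ‖s‖ₑ * ‖t - t'‖ₑ := by
  rw [← enorm_mul, ← ofReal_norm, ← ofReal_norm]
  refine ENNReal.ofReal_le_ofReal ((norm_exp_sub_exp_le s t t').trans_eq ?_)
  rw [norm_mul]; rfl

theorem PotPair.enorm_gauge_sub_le (h : PotPair R D U v U' v') (s : ℝ) (x : ℝ) :
    ‖gauge s U x - gauge s U' x‖ₑ ≤ ‖s‖ₑ * (8 * (R + 1) * D) := by
  refine (enorm_exp_sub_exp_le _ _ _).trans ?_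
  gcongr
  rw [← integral_sub h.fst.integrable_sq.integrableOn h.snd.integrable_sq.integrableOn]
  exact ((enorm_integral_le_lintegral_enorm _).trans (setLIntegral_le_lintegral _ _)).trans
    h.lintegral_sq_sub_le

theorem PotPair.enorm_gaugeInf_sub_le (h : PotPair R D U v U' v') (s : ℝ) :
    ‖gaugeInf s U - gaugeInf s U'‖ₑ ≤ ‖s‖ₑ * (8 * (R + 1) * D) := by
  refine (enorm_exp_sub_exp_le _ _ _).trans ?_
  gcongr
  rw [← integral_sub h.fst.integrable_sq h.snd.integrable_sq]
  exact (enorm_integral_le_lintegral_enorm _).trans h.lintegral_sq_sub_le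

theorem PotPair.lipInf_gauge (h : PotPair R D U v U' v') (s : ℝ) :
    LipInf (1 + ‖s‖₊ * (8 * (R + 1))) D (gauge s U) (gauge s U') where
  meas := (h.fst.continuous_gauge s).measurable
  meas' := (h.snd.continuous_gauge s).measurable
  le x := by rw [enorm_gauge]; push_cast; exact le_self_add
  le' x := by rw [enorm_gauge]; push_cast; exact le_self_add
  sub_le x := by
    refine (h.enorm_gauge_sub_le s x).trans ?_
    push_cast
    rw [← mul_assoc, add_mul]
    exact le_add_self

/-- Every summand of a coefficient is one factor from L^{2,1}, namely U, v or a conjugate, times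
bounded factors, all Lipschitz in the potential. The product rules above assemble K, which depends
on R alone. -/
theorem exists_lipTwo_system (R : ℝ≥0) : ∃ K : ℝ≥0, ∀ {D : ℝ≥0} {U v U' v' : ℝ → ℂ},
    PotPair R D U v U' v' →
    LipTwo bracket K D (alphaFst U) (alphaFst U') ∧ LipTwo bracket K D (betaFst U v) (betaFst U' v') ∧
    LipTwo bracket K D (alphaSnd U v) (alphaSnd U' v') ∧
      LipTwo bracket K D (betaSnd U) (betaSnd U') := by
  have mono : ∀ {K K' D : ℝ≥0} {f f' : ℝ → ℂ}, LipTwo bracket K D f f' → K ≤ K' →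
      LipTwo bracket K' D f f' := fun {K K' D f f'} h hK =>
    ⟨h.meas, h.meas', h.le.trans (by exact_mod_cast hK), h.le'.trans (by exact_mod_cast hK),
      h.sub_le.trans (by gcongr)⟩
  have hb := measurable_bracket
  have h1 : ∃ K : ℝ≥0, ∀ {D : ℝ≥0} {U v U' v' : ℝ → ℂ}, PotPair R D U v U' v' →
      LipTwo bracket K D (alphaFst U) (alphaFst U') :=
    ⟨_, fun {D U v U' v'} h => (((LipInf.const (1 / (2 * Complex.I)) D).mul
      (h.lipInf_gauge (-2))).mul_two hb h.lipTwo).congr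
      (fun x => by rw [alphaFst]; ring) (fun x => by rw [alphaFst]; ring)⟩
  have h2 : ∃ K : ℝ≥0, ∀ {D : ℝ≥0} {U v U' v' : ℝ → ℂ}, PotPair R D U v U' v' →
      LipTwo bracket K D (betaFst U v) (betaFst U' v') :=
    ⟨_, fun {D U v U' v'} h => ((h.lipInf_gauge 2).mul_two hb (h.lipTwo_deriv.conj_comp.add hb
      (((LipInf.const (1 / (2 * Complex.I)) D).mul (h.lipInf.mul h.lipInf.conj_comp)).mul_two hb
        h.lipTwo.conj_comp))).neg.congr
      (fun x => by rw [betaFst]; ring) (fun x => by rw [betaFst]; ring)⟩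
  have h3 : ∃ K : ℝ≥0, ∀ {D : ℝ≥0} {U v U' v' : ℝ → ℂ}, PotPair R D U v U' v' →
      LipTwo bracket K D (alphaSnd U v) (alphaSnd U' v') :=
    ⟨_, fun {D U v U' v'} h => (((h.lipInf_gauge (-2)).mul
      (LipInf.const (1 / (2 * Complex.I)) D)).mul_two hb (h.lipTwo_deriv.neg.add hb
      (((LipInf.const (1 / (2 * Complex.I)) D).mul (h.lipInf.mul h.lipInf.conj_comp)).mul_two hb
        h.lipTwo))).congr
      (fun x => by rw [alphaSnd]; ring) (fun x => by rw [alphaSnd]; ring)⟩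
  have h4 : ∃ K : ℝ≥0, ∀ {D : ℝ≥0} {U v U' v' : ℝ → ℂ}, PotPair R D U v U' v' →
      LipTwo bracket K D (betaSnd U) (betaSnd U') :=
    ⟨_, fun {D U v U' v'} h => ((h.lipInf_gauge 2).mul_two hb h.lipTwo.conj_comp).neg.congr
      (fun x => by rw [betaSnd]; ring) (fun x => by rw [betaSnd]; ring)⟩
  obtain ⟨K₁, h1⟩ := h1
  obtain ⟨K₂, h2⟩ := h2
  obtain ⟨K₃, h3⟩ := h3
  obtain ⟨K₄, h4⟩ := h4
  exact ⟨max (max K₁ K₂) (max K₃ K₄), fun h => ⟨mono (h1 h) (by simp), mono (h2 h) (by simp),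
    mono (h3 h) (by simp), mono (h4 h) (by simp)⟩⟩

end

/-! ### Estimates for the scattering coefficients -/

theorem H1Bound.mono {K K' : ℝ≥0∞} {f : ℝ → ℂ} (h : H1Bound K f) (hK : K ≤ K') : H1Bound K' f :=
  ⟨h.meas, h.le.trans hK, fun t => (h.shift t).trans (by gcongr)⟩

theorem H1Bound.congr {K : ℝ≥0∞} {f g : ℝ → ℂ} (h : H1Bound K f) (e : ∀ z, g z = f z) :
    H1Bound K g := by
  rwa [funext e]

theorem H1Bound.const_mul {K : ℝ≥0∞} {f : ℝ → ℂ} (h : H1Bound K f) (c : ℂ) :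
    H1Bound (‖c‖ₑ * K) fun z => c * f z := by
  have e : ∀ g : ℝ → ℂ, eLpNorm (fun z => c * g z) 2 volume = ‖c‖ₑ * eLpNorm g 2 volume := fun g =>
    eLpNorm_const_smul c g 2 volume
  refine ⟨h.meas.const_mul c, ?_, fun t => ?_⟩
  · rw [e]; gcongr; exact h.le
  · simp only [← mul_sub]
    rw [e fun z => f (z + t) - f z, mul_assoc]
    gcongr
    exact h.shift t

theorem H1Bound.add {K K' : ℝ≥0∞} {f g : ℝ → ℂ} (h : H1Bound K f) (h' : H1Bound K' g) :
    H1Bound (K + K') fun z => f z + g z := by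
  have hs : ∀ {f : ℝ → ℂ}, Measurable f → ∀ t : ℝ, Measurable fun z => f (z + t) - f z :=
    fun hf t => (hf.comp (measurable_id.add_const t)).sub hf
  refine ⟨h.meas.add h'.meas, ?_, fun t => ?_⟩
  · exact (eLpNorm_add_le h.meas.aestronglyMeasurable h'.meas.aestronglyMeasurable
      one_le_two).trans (add_le_add h.le h'.le)
  · have e : ∀ z, f (z + t) + g (z + t) - (f z + g z) = (f (z + t) - f z) + (g (z + t) - g z) :=
      fun z => by ring
    simp only [e]
    rw [add_mul]
    exact (eLpNorm_add_le (hs h.meas t).aestronglyMeasurable (hs h'.meas t).aestronglyMeasurable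
      one_le_two).trans (add_le_add (h.shift t) (h'.shift t))

/-- Multiplication by Lipschitz dependent unimodular constants. -/
theorem H1Bound.mul_sub_mul {K L D : ℝ≥0} {f f' : ℝ → ℂ} (h : H1Bound (K * D) fun z => f z - f' z)
    (h' : H1Bound K f') {c c' : ℂ} (hc : ‖c‖ₑ ≤ L) (hcc : ‖c - c'‖ₑ ≤ L * D) :
    H1Bound ((2 * (K * L) : ℝ≥0) * D) fun z => c * f z - c' * f' z := by
  have e : ∀ z, c * f z - c' * f' z = c * (f z - f' z) + (c - c') * f' z := fun z => by ring
  simp only [e]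
  refine ((h.const_mul c).add (h'.const_mul (c - c'))).mono ?_
  calc _ ≤ (L : ℝ≥0∞) * (K * D) + L * D * K := by gcongr
    _ = _ := by push_cast; ring

theorem normH1_congr {f f' : ℝ → ℂ} (h : f =ᵐ[volume] f') : normH1 f = normH1 f' := by
  have key : ∀ {f f' : ℝ → ℂ}, f =ᵐ[volume] f' → normH1 f ≤ normH1 f' := fun {f f'} h =>
    le_iInf₂ fun g hg => (iInf₂_le g (hg.congr h.symm ae_eq_rfl)).trans_eq (by rw [eLpNorm_congr_ae h])
  exact le_antisymm (key h) (key h.symm)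

theorem MemH1.congr {f f' : ℝ → ℂ} (hf : MemH1 f) (h : f =ᵐ[volume] f') : MemH1 f' := by
  obtain ⟨h1, g, hg, h2⟩ := hf
  exact ⟨(memLp_congr_ae h).1 h1, g, hg.congr h ae_eq_rfl, h2⟩

theorem H1Bound.exists_hasWeakDeriv {K : ℝ≥0} {f : ℝ → ℂ} (h : H1Bound K f) :
    MemLp f 2 volume ∧ ∃ g, HasWeakDeriv f g ∧ MemLp g 2 volume ∧ eLpNorm g 2 volume ≤ K := by
  have hf : MemLp f 2 volume := ⟨h.meas.aestronglyMeasurable, h.le.trans_lt ENNReal.coe_lt_top⟩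
  exact ⟨hf, exists_hasWeakDeriv_of_eLpNorm_translate_le hf h.shift⟩

theorem H1Bound.memH1 {K : ℝ≥0} {f : ℝ → ℂ} (h : H1Bound K f) : MemH1 f := by
  obtain ⟨h1, g, h2, h3, -⟩ := h.exists_hasWeakDeriv
  exact ⟨h1, g, h2, h3⟩

theorem H1Bound.normH1_le {K : ℝ≥0} {f : ℝ → ℂ} (h : H1Bound K f) : normH1 f ≤ 2 * K := by
  obtain ⟨-, g, h2, -, h4⟩ := h.exists_hasWeakDeriv
  refine (iInf₂_le g h2).trans ?_
  rw [two_mul]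
  exact add_le_add h.le h4

theorem jostInf_zero (z : ℝ) : jostInf 0 0 z = (1, 0) := by
  simp [jostInf]

section

variable {K D : ℝ≥0} {a b a' b' : ℝ → ℂ}

/-- The last two bounds are comparisons with zero coefficients, for which the limit is (1, 0). -/
theorem LipTwo.h1Bound_jostInf (ha : LipTwo bracket K D a a') (hb : LipTwo bracket K D b b') :
    IsPotential (2 * (2 * K)) a b ∧ IsPotential (2 * (2 * K)) a' b' ∧
    H1Bound (((h1Const (2 * K)).toNNReal * (2 * K) : ℝ≥0) * D)
      (fun z => (jostInf a b z).1 - (jostInf a' b' z).1) ∧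
    H1Bound (((h1Const (2 * K)).toNNReal * (2 * K) : ℝ≥0) * D)
      (fun z => (jostInf a b z).2 - (jostInf a' b' z).2) ∧
    H1Bound ((h1Const (2 * K)).toNNReal * (2 * K) : ℝ≥0) (fun z => (jostInf a' b' z).1 - 1) ∧
    H1Bound ((h1Const (2 * K)).toNNReal * (2 * K) : ℝ≥0) (fun z => (jostInf a' b' z).2) := by
  have hC := ENNReal.coe_toNNReal (h1Const_ne_top (2 * K))
  have h1 : normL21 a + normL21 b ≤ (2 * K : ℝ≥0) := by
    push_cast; rw [two_mul]; exact add_le_add ha.le hb.le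
  have h2 : normL21 a' + normL21 b' ≤ (2 * K : ℝ≥0) := by
    push_cast; rw [two_mul]; exact add_le_add ha.le' hb.le'
  have h3 : normL21 (a - a') + normL21 (b - b') ≤ (2 * K : ℝ≥0) * D := by
    push_cast; rw [mul_assoc, two_mul]; exact add_le_add ha.sub_le hb.sub_le
  have h0 : normL21 (0 : ℝ → ℂ) + normL21 (0 : ℝ → ℂ) ≤ (2 * K : ℝ≥0) := by simp [normL21_zero]
  refine ⟨isPotential_of_normL21_le ha.meas hb.meas h1,
    isPotential_of_normL21_le ha.meas' hb.meas' h2, ?_⟩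
  obtain ⟨k1, k2⟩ := KaupNewell.h1Bound_jostInf ha.meas hb.meas ha.meas' hb.meas' h1 h2
  obtain ⟨k3, k4⟩ := KaupNewell.h1Bound_jostInf ha.meas' hb.meas' measurable_zero measurable_zero h2 h0
  simp only [jostInf_zero, sub_zero] at k3 k4
  have m1 : h1Const (2 * K) * (normL21 (a - a') + normL21 (b - b')) ≤
      ((h1Const (2 * K)).toNNReal * (2 * K) : ℝ≥0) * D := by
    rw [ENNReal.coe_mul, hC, mul_assoc]; gcongr
  have m2 : h1Const (2 * K) * (normL21 a' + normL21 b') ≤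
      ((h1Const (2 * K)).toNNReal * (2 * K) : ℝ≥0) := by
    rw [ENNReal.coe_mul, hC]; gcongr
  exact ⟨k1.mono m1, k2.mono m1, k3.mono m2, k4.mono m2⟩

end

/-- The estimates for the scattering coefficients of a pair of potentials. -/
structure ScatBound (K D : ℝ≥0) (U U' : ℝ → ℂ) : Prop where
  aSub : H1Bound (K * D) fun z =>
    ((scatLim U z).1 - gaugeInf 1 U) - ((scatLim U' z).1 - gaugeInf 1 U')
  lamB : H1Bound (K * D) fun z => (z : ℂ) * (scatLim U z).2 - (z : ℂ) * (scatLim U' z).2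
  lamInvB : H1Bound (K * D) fun z => (scatLim U z).2 - (scatLim U' z).2

/-- The first system controls a and λb, the second λ⁻¹b. It remains to undo the gauge constants,
which are unimodular and Lipschitz in the potential. -/
theorem exists_scatBound (R : ℝ≥0) : ∃ K : ℝ≥0, ∀ {D : ℝ≥0} {U v U' v' : ℝ → ℂ},
    PotPair R D U v U' v' → ScatBound K D U U' := by
  obtain ⟨K, hK⟩ := exists_lipTwo_system R
  set C : ℝ≥0 := (h1Const (2 * K)).toNNReal * (2 * K) with hC
  set L : ℝ≥0 := 1 + 8 * (R + 1) with hL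
  refine ⟨max (2 * (C * L)) (‖1 / (2 * Complex.I)‖₊ * (2 * (C * L))), fun {D U v U' v'} h => ?_⟩
  obtain ⟨h1, h2, h3, h4⟩ := hK h
  obtain ⟨p, p', b1, b2, b3, b4⟩ := h1.h1Bound_jostInf h2
  obtain ⟨q, q', -, c2, -, c4⟩ := h3.h1Bound_jostInf h4
  have e1 := fun z => h.fst.jostInf_fst_system p z
  have e1' := fun z => h.snd.jostInf_fst_system p' z
  have e2 := fun z => h.fst.jostInf_snd_system q z
  have e2' := fun z => h.snd.jostInf_snd_system q' z
  simp only [e1, e1'] at b1 b2 b3 b4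
  simp only [e2, e2'] at c2 c4
  have hg : ∀ s : ℝ, ‖s‖ₑ = 1 → ‖gaugeInf s U - gaugeInf s U'‖ₑ ≤ L * D := fun s hs => by
    refine (h.enorm_gaugeInf_sub_le s).trans ?_
    rw [hs, one_mul, hL]
    push_cast
    gcongr
    exact le_add_self
  have hg1 : ∀ s : ℝ, ‖gaugeInf s U‖ₑ ≤ L := fun s => by
    rw [enorm_gaugeInf, hL]; push_cast; exact le_self_add
  have n1 : ‖(1 : ℝ)‖ₑ = 1 := by simp
  have n2 : ‖(-1 : ℝ)‖ₑ = 1 := by simp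
  have gg := fun U => gaugeInf_mul_gaugeInf_neg U
  have m1 : ((2 * (C * L) : ℝ≥0) : ℝ≥0∞) * D ≤
      (max (2 * (C * L)) (‖1 / (2 * Complex.I)‖₊ * (2 * (C * L))) : ℝ≥0) * D := by
    gcongr; exact le_max_left _ _
  refine ⟨?_, ?_, ?_⟩
  -- a - a_∞ = a_∞(a_∞⁻¹a - 1), where a_∞⁻¹a is the first limit of the Zakharov-Shabat system.
  · have f := H1Bound.mul_sub_mul (f := fun z => gaugeInf (-1) U * (scatLim U z).1 - 1)
      (f' := fun z => gaugeInf (-1) U' * (scatLim U' z).1 - 1) (K := C) (D := D)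
      (by simpa only [sub_sub_sub_cancel_right, scatLim] using b1) b3 (hg1 1) (hg 1 n1)
    refine (f.mono m1).congr fun z => ?_
    linear_combination (-(scatLim U z).1) * gg U + (scatLim U' z).1 * gg U'
  · have f := (H1Bound.mul_sub_mul (f := fun z => gaugeInf 1 U * (2 * Complex.I * z * (scatLim U z).2))
      (f' := fun z => gaugeInf 1 U' * (2 * Complex.I * z * (scatLim U' z).2)) (K := C) (D := D)
      b2 b4 (hg1 (-1)) (hg (-1) n2)).const_mul (1 / (2 * Complex.I))
    refine (f.mono ?_).congr fun z => ?_
    · rw [← mul_assoc, enorm_eq_nnnorm, ← ENNReal.coe_mul]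
      gcongr; exact le_max_right _ _
    · have hk := two_I_mul_inv
      linear_combination ((z : ℂ) * (scatLim U' z).2 * (2 * Complex.I * (1 / (2 * Complex.I)))) * gg U' -
        ((z : ℂ) * (scatLim U z).2 * (2 * Complex.I * (1 / (2 * Complex.I)))) * gg U -
        ((z : ℂ) * (scatLim U z).2 - (z : ℂ) * (scatLim U' z).2) * hk
  · have f := H1Bound.mul_sub_mul (f := fun z => gaugeInf 1 U * (scatLim U z).2)
      (f' := fun z => gaugeInf 1 U' * (scatLim U' z).2) (K := C) (D := D)
      c2 c4 (hg1 (-1)) (hg (-1) n2)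
    refine (f.mono m1).congr fun z => ?_
    linear_combination (-(scatLim U z).2) * gg U + (scatLim U' z).2 * gg U'

/-! ### Potentials in `H²` -/

theorem LocAC.translate_sub_le {f f' F F' : ℝ → ℂ} {K D : ℝ≥0} (h : LocAC F f) (h' : LocAC F' f')
    (l : LipTwo (fun _ => 1) K D f f') (t : ℝ) :
    eLpNorm ((fun y => F (y + t)) - F) 2 volume ≤ K * ‖t‖ₑ ∧
    eLpNorm ((fun y => F' (y + t)) - F') 2 volume ≤ K * ‖t‖ₑ ∧
    eLpNorm ((fun y => (F - F') (y + t)) - (F - F')) 2 volume ≤ K * D * ‖t‖ₑ := by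
  obtain ⟨m, m', l1, l2, l3⟩ := l
  simp only [one_mul] at l1 l2 l3
  refine ⟨(h.eLpNorm_translate_sub_le m t).trans (by gcongr),
    (h'.eLpNorm_translate_sub_le m' t).trans (by gcongr),
    ((h.sub h').eLpNorm_translate_sub_le (m.sub m') t).trans (by gcongr)⟩

/-- Two potentials in `H² ∩ H^{1,1}` of norm at most `R` and distance at most `D`, with the second
derivatives `w` and `w'`. -/
structure PotPairTwo (R D : ℝ≥0) (U v w U' v' w' : ℝ → ℂ) : Prop extends PotPair R D U v U' v' where
  ac : LocAC v w
  ac' : LocAC v' w'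
  two : LipTwo (fun _ => 1) (R + 1) D w w'

theorem LipTwo.of_bracket {K D : ℝ≥0} {f f' : ℝ → ℂ} (h : LipTwo bracket K D f f') :
    LipTwo (fun _ => 1) K D f f' := by
  have e : ∀ g : ℝ → ℂ, eLpNorm (fun x => (1 : ℂ) * g x) 2 volume ≤
      eLpNorm (fun x => bracket x * g x) 2 volume := fun g => by
    simp only [one_mul]; exact eLpNorm_le_normL21 g
  exact ⟨h.meas, h.meas', (e _).trans h.le, (e _).trans h.le', (e fun x => f x - f' x).trans h.sub_le⟩

theorem Pot.locAC_alphaFst {U v : ℝ → ℂ} (h : Pot U v) : LocAC (alphaFst U) fun x =>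
    1 / (2 * Complex.I) * gauge (-2) U x * v x +
      (1 / (2 * Complex.I) * (-2 * (1 / (2 * Complex.I)) * (U x * conj (U x)) * gauge (-2) U x)) * U x := by
  refine ((h.ac.const_mul (1 / (2 * Complex.I))).mul (h.locAC_gauge (-2))).congr_deriv fun x => ?_
  push_cast; ring

theorem Pot.locAC_betaFst {U v w : ℝ → ℂ} (h : Pot U v) (hv : LocAC v w) : LocAC (betaFst U v) fun x =>
    -((2 * (1 / (2 * Complex.I)) * (U x * conj (U x)) * gauge 2 U x) *
      (conj (v x) + (1 / (2 * Complex.I) * (U x * conj (U x))) * conj (U x)) +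
      gauge 2 U x * (conj (w x) + (1 / (2 * Complex.I) * ((2 * (U x * conj (U x))) * conj (v x) +
        (conj (U x) * conj (U x)) * v x)))) := by
  have hc := h.ac.conj_comp
  have h1 := ((h.locAC_gauge 2).mul (hv.conj_comp.add
    (((h.ac.mul hc).const_mul (1 / (2 * Complex.I))).mul hc))).const_mul (-1)
  have e : betaFst U v = fun x => -1 * (gauge 2 U x * (conj (v x) +
      1 / (2 * Complex.I) * (U x * conj (U x)) * conj (U x))) := by
    ext x; rw [betaFst]; ring
  rw [e]
  refine h1.congr_deriv fun x => ?_
  push_cast; ring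

/-- The coefficient `betaFst` contains the derivative v, so its own derivative contains w, which is
in L² without weight. All other terms are bounded factors times U, v or their conjugates. -/
theorem exists_lipTwo_deriv (R : ℝ≥0) : ∃ K : ℝ≥0, ∀ {D : ℝ≥0} {U v w U' v' w' : ℝ → ℂ},
    PotPairTwo R D U v w U' v' w' → ∃ f f' g g' : ℝ → ℂ,
      LocAC (alphaFst U) f ∧ LocAC (alphaFst U') f' ∧ LocAC (betaFst U v) g ∧ LocAC (betaFst U' v') g' ∧
      LipTwo (fun _ => 1) K D f f' ∧ LipTwo (fun _ => 1) K D g g' := by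
  have mono : ∀ {K K' D : ℝ≥0} {f f' : ℝ → ℂ}, LipTwo (fun _ => 1) K D f f' → K ≤ K' →
      LipTwo (fun _ => 1) K' D f f' := fun {K K' D f f'} h hK =>
    ⟨h.meas, h.meas', h.le.trans (by exact_mod_cast hK), h.le'.trans (by exact_mod_cast hK),
      h.sub_le.trans (by gcongr)⟩
  have hb : Measurable fun _ : ℝ => (1 : ℂ) := measurable_const
  have h1 : ∃ K : ℝ≥0, ∀ {D : ℝ≥0} {U v w U' v' w' : ℝ → ℂ}, PotPairTwo R D U v w U' v' w' →
      ∃ f f' : ℝ → ℂ, LocAC (alphaFst U) f ∧ LocAC (alphaFst U') f' ∧ LipTwo (fun _ => 1) K D f f' :=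
    ⟨_, fun {D U v w U' v' w'} h => ⟨_, _, h.fst.locAC_alphaFst, h.snd.locAC_alphaFst,
      (((LipInf.const _ D).mul (h.lipInf_gauge (-2))).mul_two hb h.lipTwo_deriv.of_bracket).add hb
      (((LipInf.const _ D).mul (((LipInf.const _ D).mul (h.lipInf.mul h.lipInf.conj_comp)).mul
        (h.lipInf_gauge (-2)))).mul_two hb h.lipTwo.of_bracket)⟩⟩
  have h2 : ∃ K : ℝ≥0, ∀ {D : ℝ≥0} {U v w U' v' w' : ℝ → ℂ}, PotPairTwo R D U v w U' v' w' →
      ∃ f f' : ℝ → ℂ, LocAC (betaFst U v) f ∧ LocAC (betaFst U' v') f' ∧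
        LipTwo (fun _ => 1) K D f f' :=
    ⟨_, fun {D U v w U' v' w'} h => ⟨_, _, h.fst.locAC_betaFst h.ac, h.snd.locAC_betaFst h.ac',
      ((((((LipInf.const _ D).mul (h.lipInf.mul h.lipInf.conj_comp)).mul (h.lipInf_gauge 2)).mul_two hb
        (h.lipTwo_deriv.of_bracket.conj_comp.add hb
          (((LipInf.const _ D).mul (h.lipInf.mul h.lipInf.conj_comp)).mul_two hb
            h.lipTwo.of_bracket.conj_comp))).add hb
        ((h.lipInf_gauge 2).mul_two hb (h.two.conj_comp.add hb ((LipInf.const _ D).mul_two hb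
          ((((LipInf.const _ D).mul (h.lipInf.mul h.lipInf.conj_comp)).mul_two hb
            h.lipTwo_deriv.of_bracket.conj_comp).add hb
            ((h.lipInf.conj_comp.mul h.lipInf.conj_comp).mul_two hb
              h.lipTwo_deriv.of_bracket)))))).neg)⟩⟩
  obtain ⟨K₁, h1⟩ := h1
  obtain ⟨K₂, h2⟩ := h2
  refine ⟨max K₁ K₂, fun h => ?_⟩
  obtain ⟨f, f', a1, a2, a3⟩ := h1 h
  obtain ⟨g, g', b1, b2, b3⟩ := h2 h
  exact ⟨f, f', g, g', a1, a2, b1, b2, mono a3 (le_max_left _ _), mono b3 (le_max_right _ _)⟩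

/-- The constant of the weighted estimate for the limits at infinity. -/
noncomputable def weightConst (K₁ K₂ : ℝ≥0) : ℝ≥0 :=
  (secondConst (2 * (2 * K₁))).toNNReal * (2 * K₂ + 4 * (2 * K₂) * (2 * K₁))

theorem coe_weightConst (K₁ K₂ : ℝ≥0) : (weightConst K₁ K₂ : ℝ≥0∞) =
    secondConst (2 * (2 * K₁)) * (2 * K₂ + 4 * (2 * K₂) * (2 * K₁)) := by
  rw [weightConst]; push_cast; rw [ENNReal.coe_toNNReal (secondConst_ne_top _)]

section

variable {K₁ K₂ D : ℝ≥0} {a b a' b' f f' g g' : ℝ → ℂ}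

theorem eLpNorm_mul_jostInf_sub_le (ha : LipTwo bracket K₁ D a a') (hb : LipTwo bracket K₁ D b b')
    (hf : LocAC a f) (hf' : LocAC a' f') (hg : LocAC b g) (hg' : LocAC b' g')
    (l : LipTwo (fun _ => 1) K₂ D f f') (l' : LipTwo (fun _ => 1) K₂ D g g') :
    eLpNorm (fun z : ℝ => (z : ℂ) * ((jostInf a b z).2 - (jostInf a' b' z).2)) 2 volume ≤
      weightConst K₁ K₂ * D := by
  have t1 := fun t => hf.translate_sub_le hf' l t
  have t2 := fun t => hg.translate_sub_le hg' l' t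
  refine (eLpNorm_mul_jostInf_snd_sub_le ha.meas hb.meas ha.meas' hb.meas' (R := 2 * K₁) (S := 2 * K₂)
    (E := 2 * K₂ * D) ?_ ?_ (fun t => ?_) (fun t => ?_) fun t => ?_).trans ?_
  · push_cast; rw [two_mul]; exact add_le_add ha.le hb.le
  · push_cast; rw [two_mul]; exact add_le_add ha.le' hb.le'
  · push_cast; rw [mul_assoc, two_mul]; exact add_le_add (t1 t).1 (t2 t).1
  · push_cast; rw [mul_assoc, two_mul]; exact add_le_add (t1 t).2.1 (t2 t).2.1
  · rw [mul_assoc, mul_assoc, two_mul, ← mul_assoc]; exact add_le_add (t1 t).2.2 (t2 t).2.2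
  · rw [coe_weightConst, mul_assoc (secondConst _)]
    refine mul_le_mul' le_rfl ?_
    have n : normL21 (a - a') + normL21 (b - b') ≤ 2 * K₁ * D := by
      rw [mul_assoc, two_mul]; exact add_le_add ha.sub_le hb.sub_le
    push_cast
    calc _ ≤ 2 * (K₂ : ℝ≥0∞) * D + 4 * (2 * (K₂ : ℝ≥0∞)) * (2 * K₁ * D) := by gcongr
      _ = _ := by ring

theorem LipTwo.snd_zero {ρ : ℝ → ℂ} {K : ℝ≥0} (h : LipTwo ρ K D f f') : LipTwo ρ K 1 f' 0 := by
  refine ⟨h.meas', measurable_zero, h.le', ?_, ?_⟩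
  · simp
  · simpa using h.le'

end

/-- Undoing the gauge constant splits the difference into the difference of the limits and that of
the constants, the latter multiplied by the limit for U' alone. -/
theorem eLpNorm_sq_mul_scatLim_sub_le {R C D : ℝ≥0} {U v U' v' : ℝ → ℂ} (h : PotPair R D U v U' v')
    (m₁ : Measurable (jostInf (alphaFst U) (betaFst U v)))
    (m₂ : Measurable (jostInf (alphaFst U') (betaFst U' v')))
    (e₁ : ∀ z : ℝ, (jostInf (alphaFst U) (betaFst U v) z).2 =
      gaugeInf 1 U * (2 * Complex.I * z * (scatLim U z).2))
    (e₂ : ∀ z : ℝ, (jostInf (alphaFst U') (betaFst U' v') z).2 =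
      gaugeInf 1 U' * (2 * Complex.I * z * (scatLim U' z).2))
    (r₁ : eLpNorm (fun z : ℝ => (z : ℂ) * ((jostInf (alphaFst U) (betaFst U v) z).2 -
      (jostInf (alphaFst U') (betaFst U' v') z).2)) 2 volume ≤ C * D)
    (r₂ : eLpNorm (fun z : ℝ => (z : ℂ) * (jostInf (alphaFst U') (betaFst U' v') z).2) 2 volume ≤ C) :
    eLpNorm (fun z : ℝ => (z : ℂ) * ((z : ℂ) * (scatLim U z).2 - (z : ℂ) * (scatLim U' z).2)) 2 volume ≤
      (C + (1 + 8 * (R + 1)) * C : ℝ≥0) * D := by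
  have hg : ‖gaugeInf (-1) U - gaugeInf (-1) U'‖ₑ ≤ (1 + 8 * (R + 1) : ℝ≥0) * D := by
    refine (h.enorm_gaugeInf_sub_le (-1)).trans ?_
    push_cast
    simp only [enorm_neg, enorm_one, one_mul]
    gcongr
    exact le_add_self
  generalize 1 + 8 * (R + 1) = L at hg ⊢
  have hk : ‖1 / (2 * Complex.I)‖ₑ ≤ 1 := by
    rw [← ofReal_norm, ← ENNReal.ofReal_one]
    refine ENNReal.ofReal_le_ofReal ?_
    rw [norm_div, norm_mul, Complex.norm_I]; norm_num
  have hkI := two_I_mul_inv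
  have g1 := gaugeInf_mul_gaugeInf_neg U
  have g2 := gaugeInf_mul_gaugeInf_neg U'
  have hG := enorm_gaugeInf (-1) U
  replace m₁ := m₁.snd
  replace m₂ := m₂.snd
  have e : (fun z : ℝ => (z : ℂ) * ((z : ℂ) * (scatLim U z).2 - (z : ℂ) * (scatLim U' z).2)) =
      (1 / (2 * Complex.I) * gaugeInf (-1) U) • (fun z : ℝ => (z : ℂ) *
        ((jostInf (alphaFst U) (betaFst U v) z).2 - (jostInf (alphaFst U') (betaFst U' v') z).2)) +
      (1 / (2 * Complex.I) * (gaugeInf (-1) U - gaugeInf (-1) U')) •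
        fun z : ℝ => (z : ℂ) * (jostInf (alphaFst U') (betaFst U' v') z).2 := by
    ext z
    simp only [Pi.add_apply, Pi.smul_apply, smul_eq_mul]
    rw [e₁, e₂]
    linear_combination (-((z : ℂ) * z * (scatLim U z).2 * (2 * Complex.I * (1 / (2 * Complex.I))))) * g1 +
      ((z : ℂ) * z * (scatLim U' z).2 * (2 * Complex.I * (1 / (2 * Complex.I)))) * g2 -
      ((z : ℂ) * z * (scatLim U z).2 - (z : ℂ) * z * (scatLim U' z).2) * hkI
  have mz : Measurable fun z : ℝ => (z : ℂ) := Complex.measurable_ofReal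
  have n₁ : AEStronglyMeasurable (fun z : ℝ => (z : ℂ) * ((jostInf (alphaFst U) (betaFst U v) z).2 -
      (jostInf (alphaFst U') (betaFst U' v') z).2)) volume :=
    (mz.mul (m₁.sub m₂)).aestronglyMeasurable
  have n₂ : AEStronglyMeasurable (fun z : ℝ => (z : ℂ) * (jostInf (alphaFst U') (betaFst U' v') z).2)
      volume := (mz.mul m₂).aestronglyMeasurable
  generalize (fun z : ℝ => (z : ℂ) * ((jostInf (alphaFst U) (betaFst U v) z).2 -
      (jostInf (alphaFst U') (betaFst U' v') z).2)) = F₁ at *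
  generalize (fun z : ℝ => (z : ℂ) * (jostInf (alphaFst U') (betaFst U' v') z).2) = F₂ at *
  rw [e]
  refine (eLpNorm_add_le (n₁.const_smul _) (n₂.const_smul _) one_le_two).trans ?_
  rw [eLpNorm_const_smul, eLpNorm_const_smul, enorm_mul, enorm_mul, hG, mul_one]
  have s₁ := mul_le_mul' hk r₁
  have s₂ := mul_le_mul' (mul_le_mul' hk hg) r₂
  rw [one_mul] at s₁ s₂
  refine (add_le_add s₁ s₂).trans (le_of_eq ?_)
  rw [ENNReal.coe_add, ENNReal.coe_mul]
  ring

theorem exists_eLpNorm_sq_mul_le (R : ℝ≥0) : ∃ K : ℝ≥0, ∀ {D : ℝ≥0} {U v w U' v' w' : ℝ → ℂ},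
    PotPairTwo R D U v w U' v' w' →
    eLpNorm (fun z : ℝ => (z : ℂ) * ((z : ℂ) * (scatLim U z).2 - (z : ℂ) * (scatLim U' z).2)) 2 volume ≤
      K * D := by
  obtain ⟨K₁, hK₁⟩ := exists_lipTwo_system R
  obtain ⟨K₂, hK₂⟩ := exists_lipTwo_deriv R
  obtain ⟨C, hC⟩ : ∃ C : ℝ≥0, C = weightConst K₁ K₂ := ⟨_, rfl⟩
  refine ⟨C + (1 + 8 * (R + 1)) * C, fun {D U v w U' v' w'} h => ?_⟩
  obtain ⟨h1, h2, -, -⟩ := hK₁ h.toPotPair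
  obtain ⟨p, p', -⟩ := h1.h1Bound_jostInf h2
  obtain ⟨f, f', g, g', a1, a2, b1, b2, a3, b3⟩ := hK₂ h
  have r1 := eLpNorm_mul_jostInf_sub_le h1 h2 a1 a2 b1 b2 a3 b3
  -- The same estimate against zero coefficients, with distance 1, bounds the limit for U' itself.
  have r2 := eLpNorm_mul_jostInf_sub_le h1.snd_zero h2.snd_zero a2 Pot.zero.ac b2 Pot.zero.ac
    a3.snd_zero b3.snd_zero
  simp only [jostInf_zero, sub_zero, ENNReal.coe_one, mul_one, ← hC] at r1 r2
  refine eLpNorm_sq_mul_scatLim_sub_le h.toPotPair p.measurable_jostInf p'.measurable_jostInf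
    (fun z => ?_) (fun z => ?_) r1 r2
  · rw [h.fst.jostInf_fst_system p z, scatLim]
  · rw [h.snd.jostInf_fst_system p' z, scatLim]

/-! ### The scattering map on Sobolev spaces -/

theorem scatLim_zero (z : ℝ) : scatLim 0 z = (1, 0) := by
  simp [scatLim, jostInf]

theorem gaugeInf_zero (s : ℝ) : gaugeInf s 0 = 1 := by
  simp [gaugeInf]

section

variable {u u' U v w U' v' w' : ℝ → ℂ}

/-- Membership statements follow from the Lipschitz estimates by comparison with the zero potential,
for which a = a_∞ = 1 and b = 0. -/
theorem Pot.exists_potPair_zero (h : Pot U v) : ∃ R : ℝ≥0, PotPair R R U v 0 0 := by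
  have hf : normL21 U + normL21 v ≠ ⊤ := ENNReal.add_ne_top.2 ⟨h.fin, h.fin'⟩
  refine ⟨(normL21 U + normL21 v).toNNReal, h, Pot.zero, ?_, ?_, ?_⟩
  · rw [ENNReal.coe_toNNReal hf]
  · simp [normL21_zero]
  · rw [ENNReal.coe_toNNReal hf, sub_zero, sub_zero]

theorem Pot.memH1 (h : Pot U v) (e : u =ᵐ[volume] U) :
    MemH1 (onZ (aSub u)) ∧ MemH1 (onZ (lamB u)) ∧ MemH1 (onZ (lamInvB u)) := by
  obtain ⟨R, hR⟩ := h.exists_potPair_zero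
  obtain ⟨K, hK⟩ := exists_scatBound R
  obtain ⟨h1, h2, h3⟩ := hK hR
  simp only [scatLim_zero, gaugeInf_zero, sub_self, sub_zero, mul_zero, ← ENNReal.coe_mul] at h1 h2 h3
  rw [h.onZ_aSub e, h.onZ_lamB e]
  exact ⟨h1.memH1, h2.memH1, h3.memH1.congr (h.onZ_lamInvB e).symm⟩

theorem exists_normH1_le (R : ℝ≥0) : ∃ C : ℝ≥0, 0 < C ∧ ∀ u v : ℝ → ℂ, MemH11 u → MemH11 v →
    normH11 u ≤ R → normH11 v ≤ R →
    normH1 (onZ (aSub u) - onZ (aSub v)) + normH1 (onZ (lamB u) - onZ (lamB v)) +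
      normH1 (onZ (lamInvB u) - onZ (lamInvB v)) ≤ C * normH11 (u - v) := by
  obtain ⟨K, hK⟩ := exists_scatBound R
  -- Three norms, each at most 2KD; the summand 1 makes the constant positive.
  refine ⟨6 * K + 1, by positivity, fun u u' hu hu' hR hR' => ?_⟩
  obtain ⟨U, v, e, p⟩ := hu.exists_pot
  obtain ⟨U', v', e', p'⟩ := hu'.exists_pot
  rw [p.normH11_eq e] at hR
  rw [p'.normH11_eq e'] at hR'
  have hD := normH11_sub_eq p e p' e'
  by_cases htop : normH11 (u - u') = ⊤
  · rw [htop, ENNReal.mul_top (by positivity)]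
    exact le_top
  lift normH11 (u - u') to ℝ≥0 using htop with D
  obtain ⟨h1, h2, h3⟩ := hK ⟨p, p', hR, hR', hD.symm.le⟩
  rw [p.onZ_aSub e, p'.onZ_aSub e', p.onZ_lamB e, p'.onZ_lamB e',
    normH1_congr ((p.onZ_lamInvB e).sub (p'.onZ_lamInvB e'))]
  rw [← ENNReal.coe_mul] at h1 h2 h3
  refine (add_le_add (add_le_add h1.normH1_le h2.normH1_le) h3.normH1_le).trans ?_
  push_cast
  calc _ = 6 * (K : ℝ≥0∞) * D := by ring
    _ ≤ _ := by gcongr; exact le_self_add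

theorem normL21_le_add {F : ℝ → ℂ} (hF : Measurable F) :
    normL21 F ≤ eLpNorm F 2 volume + eLpNorm (fun x : ℝ => (x : ℂ) * F x) 2 volume := by
  have mz : Measurable fun z : ℝ => (z : ℂ) := Complex.measurable_ofReal
  calc normL21 F ≤ eLpNorm ((fun x => ‖F x‖ₑ) + fun x : ℝ => ‖(x : ℂ) * F x‖ₑ) 2 volume := by
        refine eLpNorm_mono_enorm fun x => ?_
        rw [Pi.add_apply, enorm_weighted, enorm_eq_self, enorm_mul]
        nth_rw 2 [← one_mul ‖F x‖ₑ]
        rw [← add_mul]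
        gcongr
        rw [← ofReal_norm, ← ENNReal.ofReal_one, ← ENNReal.ofReal_add zero_le_one (norm_nonneg _),
          Complex.norm_real, Real.norm_eq_abs]
        refine ENNReal.ofReal_le_ofReal (Real.sqrt_le_iff.2 ⟨by positivity, ?_⟩)
        nlinarith [abs_nonneg x, sq_abs x]
    _ ≤ eLpNorm (fun x => ‖F x‖ₑ) 2 volume + eLpNorm (fun x : ℝ => ‖(x : ℂ) * F x‖ₑ) 2 volume :=
        eLpNorm_add_le hF.enorm.aestronglyMeasurable (mz.mul hF).enorm.aestronglyMeasurable one_le_two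
    _ = _ := by rw [eLpNorm_enorm, eLpNorm_enorm]

/-- For λb the weight costs the bound on zλb from smoothness. For λ⁻¹b it costs only zλ⁻¹b = λb,
which is already in L². -/
theorem exists_normL21_scatLim_le (R : ℝ≥0) : ∃ K : ℝ≥0, ∀ {D : ℝ≥0} {U v w U' v' w' : ℝ → ℂ},
    PotPairTwo R D U v w U' v' w' →
    (Measurable (fun z : ℝ => (z : ℂ) * (scatLim U z).2 - (z : ℂ) * (scatLim U' z).2) ∧
    normL21 (fun z => (z : ℂ) * (scatLim U z).2 - (z : ℂ) * (scatLim U' z).2) ≤ K * D) ∧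
    Measurable (fun z : ℝ => (scatLim U z).2 - (scatLim U' z).2) ∧
    normL21 (fun z => (scatLim U z).2 - (scatLim U' z).2) ≤ K * D := by
  obtain ⟨K₁, h1⟩ := exists_scatBound R
  obtain ⟨K₂, h2⟩ := exists_eLpNorm_sq_mul_le R
  refine ⟨2 * K₁ + K₂, fun {D U v w U' v' w'} h => ?_⟩
  have b := h1 h.toPotPair
  have b2 := h2 h
  refine ⟨⟨b.lamB.meas, (normL21_le_add b.lamB.meas).trans ?_⟩, b.lamInvB.meas,
    (normL21_le_add b.lamInvB.meas).trans ?_⟩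
  · calc _ ≤ (K₁ : ℝ≥0∞) * D + K₂ * D := add_le_add b.lamB.le b2
      _ = (K₁ + K₂) * D := by ring
      _ ≤ _ := by
        push_cast
        gcongr
        exact le_mul_of_one_le_left' one_le_two
  · simp only [mul_sub]
    calc _ ≤ (K₁ : ℝ≥0∞) * D + K₁ * D := add_le_add b.lamInvB.le b.lamB.le
      _ = (2 * K₁) * D := by ring
      _ ≤ _ := by
        push_cast
        gcongr
        exact le_self_add

/-- The derivative in `Pot` is chosen as its own locally absolutely continuous representative, so
that the coefficient containing it can be differentiated. -/
theorem exists_pot_of_memH2 (h2 : MemH2 u) (h : MemH11 u) : ∃ U v w, u =ᵐ[volume] U ∧ Pot U v ∧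
    LocAC v w ∧ Measurable w ∧ eLpNorm w 2 volume ≠ ⊤ := by
  obtain ⟨U, v, e, p⟩ := h.exists_pot
  obtain ⟨-, g, h, hg, hh, -, hL⟩ := h2
  have ev : v =ᵐ[volume] g := ((p.ac.hasWeakDeriv).congr e.symm ae_eq_rfl).ae_unique hg
  obtain ⟨V, hV, eV⟩ := hh.exists_locAC
  have hm := hh.2.1.aestronglyMeasurable
  have ew := hm.ae_eq_mk
  refine ⟨U, V, hm.mk h, e, ⟨p.ac.congr_ae (ev.trans eV), hV.continuous.measurable, p.fin, ?_⟩,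
    hV.congr_ae ew, hm.stronglyMeasurable_mk.measurable, ?_⟩
  · rw [← normL21_congr (ev.trans eV)]; exact p.fin'
  · rw [← eLpNorm_congr_ae ew]; exact hL.2.ne

theorem eLpNorm_le_normH2 (h1 : HasWeakDeriv u v) (h2 : HasWeakDeriv v w) :
    eLpNorm w 2 volume ≤ normH2 u := by
  refine le_iInf fun g => le_iInf fun h => le_iInf fun hg => le_iInf fun hh => ?_
  have e1 := h1.ae_unique hg
  have e2 := h2.ae_unique (hh.congr e1.symm ae_eq_rfl)
  rw [eLpNorm_congr_ae e2]
  exact le_add_self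

theorem memL21_of_pot (p : Pot U v) (e : u =ᵐ[volume] U) (hv : LocAC v w) (hw : Measurable w)
    (hw2 : eLpNorm w 2 volume ≠ ⊤) : MemL21 (onZ (lamB u)) ∧ MemL21 (onZ (lamInvB u)) := by
  have hf : normL21 U + normL21 v + eLpNorm w 2 volume ≠ ⊤ :=
    ENNReal.add_ne_top.2 ⟨ENNReal.add_ne_top.2 ⟨p.fin, p.fin'⟩, hw2⟩
  obtain ⟨R, hR⟩ : ∃ R : ℝ≥0, (R : ℝ≥0∞) = normL21 U + normL21 v + eLpNorm w 2 volume :=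
    ⟨_, ENNReal.coe_toNNReal hf⟩
  have l1 : normL21 U + normL21 v ≤ R := by rw [hR]; exact le_self_add
  have l2 : eLpNorm w 2 volume ≤ R := by rw [hR]; exact le_add_self
  have l3 : eLpNorm w 2 volume ≤ (R + 1 : ℝ≥0) := l2.trans (by push_cast; exact le_self_add)
  have pp : PotPairTwo R R U v w 0 0 0 := by
    refine ⟨⟨p, Pot.zero, l1, by simp [normL21_zero], by simpa using l1⟩, hv, Pot.zero.ac,
      ⟨hw, measurable_zero, by simpa using l3, by simp, ?_⟩⟩
    simp only [one_mul, Pi.zero_apply, sub_zero]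
    exact l2.trans (le_mul_of_one_le_left' (by push_cast; exact le_add_self))
  obtain ⟨K, hK⟩ := exists_normL21_scatLim_le R
  obtain ⟨⟨m1, n1⟩, m2, n2⟩ := hK pp
  simp only [scatLim_zero, mul_zero, sub_zero] at m1 n1 m2 n2
  have key : ∀ {F f : ℝ → ℂ}, Measurable F → normL21 F ≤ K * R → f =ᵐ[volume] F → MemL21 f :=
    fun {F f} hF hn he => by
      have hmb : Measurable (weighted F) := measurable_bracket.mul hF
      refine (memLp_congr_ae (he.mono fun x hx => ?_)).2
        (⟨hmb.aestronglyMeasurable, hn.trans_lt (by finiteness)⟩ : MemLp (weighted F) 2 volume)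
      simp only [weighted, hx]
  exact ⟨key m1 n1 (p.onZ_lamB e).eventuallyEq, key m2 n2 (p.onZ_lamInvB e)⟩

theorem exists_normL21_le (R : ℝ≥0) : ∃ C : ℝ≥0, 0 < C ∧ ∀ u v : ℝ → ℂ, MemH2 u → MemH11 u →
    MemH2 v → MemH11 v → normH2 u + normH11 u ≤ R → normH2 v + normH11 v ≤ R →
    normL21 (onZ (lamB u) - onZ (lamB v)) + normL21 (onZ (lamInvB u) - onZ (lamInvB v)) ≤
      C * (normH2 (u - v) + normH11 (u - v)) := by
  obtain ⟨K, hK⟩ := exists_normL21_scatLim_le R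
  refine ⟨2 * K + 1, by positivity, fun u u' hu2 hu hu2' hu' hR hR' => ?_⟩
  obtain ⟨U, v, w, e, p, a, m, -⟩ := exists_pot_of_memH2 hu2 hu
  obtain ⟨U', v', w', e', p', a', m', -⟩ := exists_pot_of_memH2 hu2' hu'
  have hd : HasWeakDeriv u v := (p.ac.hasWeakDeriv).congr e.symm ae_eq_rfl
  have hd' : HasWeakDeriv u' v' := (p'.ac.hasWeakDeriv).congr e'.symm ae_eq_rfl
  have hD := normH11_sub_eq p e p' e'
  by_cases htop : normH2 (u - u') + normH11 (u - u') = ⊤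
  · rw [htop, ENNReal.mul_top (by positivity)]
    exact le_top
  obtain ⟨D, hDe⟩ : ∃ D : ℝ≥0, (D : ℝ≥0∞) = normH2 (u - u') + normH11 (u - u') :=
    ⟨_, ENNReal.coe_toNNReal htop⟩
  rw [← hDe]
  have o1 : (1 : ℝ≥0∞) ≤ (R + 1 : ℝ≥0) := by push_cast; exact le_add_self
  have o2 : (R : ℝ≥0∞) ≤ (R + 1 : ℝ≥0) := by push_cast; exact le_self_add
  have pp : PotPairTwo R D U v w U' v' w' := by
    refine ⟨⟨p, p', ?_, ?_, ?_⟩, a, a', ⟨m, m', ?_, ?_, ?_⟩⟩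
    · rw [← p.normH11_eq e]; exact le_add_self.trans hR
    · rw [← p'.normH11_eq e']; exact le_add_self.trans hR'
    · rw [← hD, hDe]; exact le_add_self
    · simp only [one_mul]
      exact ((eLpNorm_le_normH2 hd a.hasWeakDeriv).trans (le_self_add.trans hR)).trans o2
    · simp only [one_mul]
      exact ((eLpNorm_le_normH2 hd' a'.hasWeakDeriv).trans (le_self_add.trans hR')).trans o2
    · simp only [one_mul]
      refine le_trans ?_ (le_mul_of_one_le_left' o1)
      rw [hDe]
      exact (eLpNorm_le_normH2 (hd.sub hd') (a.hasWeakDeriv.sub a'.hasWeakDeriv)).trans le_self_add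
  obtain ⟨⟨-, n1⟩, -, n2⟩ := hK pp
  rw [p.onZ_lamB e, p'.onZ_lamB e', normL21_congr ((p.onZ_lamInvB e).sub (p'.onZ_lamInvB e'))]
  refine (add_le_add n1 n2).trans ?_
  push_cast
  calc _ = 2 * (K : ℝ≥0∞) * D := by ring
    _ ≤ _ := by gcongr; exact le_self_add

end

end KaupNewell

theorem lemma2p9 :
    -- regularity for potentials in `H^{1,1}`
    (∀ u : ℝ → ℂ, KaupNewell.MemH11 u →
      (∃ A : ℂ → ℂ, ContinuousOn A {z | 0 ≤ z.im} ∧ DifferentiableOn ℂ A {z | 0 < z.im} ∧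
        ∀ lam : ℂ, (lam ^ 2).im = 0 → A (lam ^ 2) = KaupNewell.scatA u lam) ∧
      (∃ A : ℂ → ℂ, ContinuousOn A {z | z.im ≤ 0} ∧ DifferentiableOn ℂ A {z | z.im < 0} ∧
        ∀ lam : ℂ, (lam ^ 2).im = 0 →
          A (lam ^ 2) = conj (KaupNewell.scatA u (conj lam))) ∧
      KaupNewell.DependsOnSq (KaupNewell.aSub u) ∧
      KaupNewell.DependsOnSq (KaupNewell.lamB u) ∧
      KaupNewell.DependsOnSq (KaupNewell.lamInvB u) ∧
      KaupNewell.MemH1 (KaupNewell.onZ (KaupNewell.aSub u)) ∧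
      KaupNewell.MemH1 (KaupNewell.onZ (KaupNewell.lamB u)) ∧
      KaupNewell.MemH1 (KaupNewell.onZ (KaupNewell.lamInvB u))) ∧
    -- regularity for potentials in `H^2 ∩ H^{1,1}`
    (∀ u : ℝ → ℂ, KaupNewell.MemH2 u → KaupNewell.MemH11 u →
      KaupNewell.MemL21 (KaupNewell.onZ (KaupNewell.lamB u)) ∧
      KaupNewell.MemL21 (KaupNewell.onZ (KaupNewell.lamInvB u))) ∧
    -- Lipschitz continuity on balls of `H^{1,1}`
    (∀ U : ℝ≥0, 0 < U → ∃ C : ℝ≥0, 0 < C ∧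
      ∀ u v : ℝ → ℂ, KaupNewell.MemH11 u → KaupNewell.MemH11 v →
        KaupNewell.normH11 u ≤ U → KaupNewell.normH11 v ≤ U →
        KaupNewell.normH1
            (KaupNewell.onZ (KaupNewell.aSub u) - KaupNewell.onZ (KaupNewell.aSub v)) +
          KaupNewell.normH1
            (KaupNewell.onZ (KaupNewell.lamB u) - KaupNewell.onZ (KaupNewell.lamB v)) +
          KaupNewell.normH1
            (KaupNewell.onZ (KaupNewell.lamInvB u) - KaupNewell.onZ (KaupNewell.lamInvB v)) ≤
        C * KaupNewell.normH11 (u - v)) ∧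
    -- Lipschitz continuity on balls of `H^2 ∩ H^{1,1}`
    (∀ U : ℝ≥0, 0 < U → ∃ C : ℝ≥0, 0 < C ∧
      ∀ u v : ℝ → ℂ, KaupNewell.MemH2 u → KaupNewell.MemH11 u →
        KaupNewell.MemH2 v → KaupNewell.MemH11 v →
        KaupNewell.normH2 u + KaupNewell.normH11 u ≤ U →
        KaupNewell.normH2 v + KaupNewell.normH11 v ≤ U →
        KaupNewell.normL21
            (KaupNewell.onZ (KaupNewell.lamB u) - KaupNewell.onZ (KaupNewell.lamB v)) +
          KaupNewell.normL21
            (KaupNewell.onZ (KaupNewell.lamInvB u) - KaupNewell.onZ (KaupNewell.lamInvB v)) ≤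
        C * (KaupNewell.normH2 (u - v) + KaupNewell.normH11 (u - v))) := by
  refine ⟨fun u hu => ?_, fun u h2 h => ?_, fun R _ => KaupNewell.exists_normH1_le R,
    fun R _ => KaupNewell.exists_normL21_le R⟩
  · obtain ⟨U, v, e, p⟩ := hu.exists_pot
    have hext := p.exists_extension e
    exact ⟨hext, KaupNewell.exists_conj_extension hext,
      KaupNewell.dependsOnSq_of_eq fun _ _ hz => p.aSub_eq e hz,
      KaupNewell.dependsOnSq_of_eq fun _ _ hz => p.lamB_eq e hz, p.dependsOnSq_lamInvB e, p.memH1 e⟩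
  · obtain ⟨U, v, w, e, p, a, m, hw⟩ := KaupNewell.exists_pot_of_memH2 h2 h
    exact KaupNewell.memL21_of_pot p e a m hw
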